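/- Let $d\in\{2,3\}$ and let $\Omega\subset\mathbb R^d$ be a bounded domain with smooth boundary, with exterior unit normal $\mathbf n$. Suppose that $\partial\Omega=\Gamma^v_1\cup\Gamma^v_2\cup\Gamma^v_3$, where $\Gamma^v_1,\Gamma^v_2,\Gamma^v_3$ are pairwise disjoint closed sets (some of them possibly empty). Put $$X=\{\psi\in H^1(\Omega)^d:\ \psi|_{\Gamma^v_1}=0,\ \mathbf n\cdot\psi|_{\Gamma^v_2}=0\},$$ with boundary values understood in the sense of traces, equipped with the $H^1$ norm. Let $F\colon X\to\mathbb R$ be linear and bounded, and suppose that $$F(\psi)=0\quad\text{for all }\psi\in V(\Omega)=\{\psi\in X:\ \operatorname{div}\psi=0\}.$$ Then there is a unique $p\in L^2(\Omega)$, subject to $\int_\Omega p\,dx=0$ if $\Gamma^v_3=\emptyset$, such that $$F(\psi)=-\int_\Omega p\,\operatorname{div}\psi\,dx\qquad\text{for all }\psi\in X.$$ -/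

import Mathlib

open MeasureTheory Filter Topology
open scoped ContDiff RealInnerProductSpace

noncomputable section

namespace StokesPressure

/-- The Euclidean space `ℝ^d`. -/
abbrev E (d : ℕ) : Type := EuclideanSpace ℝ (Fin d)

variable {d : ℕ}

/-! ### Smooth domains -/

/-- `ρ` is a smooth local defining function of `Ω` on the open neighbourhood `U` of `x`:
its gradient does not vanish on `U`, and `Ω ∩ U = {ρ < 0} ∩ U`. -/
structure IsLocalDefiningFunction (Ω : Set (E d)) (x : E d) (U : Set (E d)) (ρ : E d → ℝ) :
    Prop where
  isOpen : IsOpen U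
  mem : x ∈ U
  smooth : ContDiffOn ℝ ∞ ρ U
  gradient_ne_zero : ∀ y ∈ U, gradient ρ y ≠ 0
  mem_iff : ∀ y ∈ U, y ∈ Ω ↔ ρ y < 0

/-- A bounded domain (nonempty connected open set) in `ℝ^d` with `C^∞` boundary. -/
structure IsBoundedSmoothDomain (Ω : Set (E d)) : Prop where
  isOpen : IsOpen Ω
  isConnected : IsConnected Ω
  isBounded : Bornology.IsBounded Ω
  smooth_boundary : ∀ x ∈ frontier Ω, ∃ U ρ, IsLocalDefiningFunction Ω x U ρ

/-- `n` is the exterior unit normal of `Ω` at `x`: the normalized gradient of a local defining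
function. -/
def IsExteriorNormal (Ω : Set (E d)) (x n : E d) : Prop :=
  ∃ U ρ, IsLocalDefiningFunction Ω x U ρ ∧ n = ‖gradient ρ x‖⁻¹ • gradient ρ x

/-- The exterior unit normal field on `∂Ω` (its values off `∂Ω` are irrelevant). -/
def exteriorNormal (Ω : Set (E d)) (x : E d) : E d := by
  classical exact if h : ∃ n, IsExteriorNormal Ω x n then h.choose else 0

theorem exteriorNormal_spec {Ω : Set (E d)} (hΩ : IsBoundedSmoothDomain Ω) {x : E d}
    (hx : x ∈ frontier Ω) : IsExteriorNormal Ω x (exteriorNormal Ω x) := by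
  obtain ⟨U, ρ, h⟩ := hΩ.smooth_boundary x hx
  have hex : ∃ n, IsExteriorNormal Ω x n := ⟨_, U, ρ, h, rfl⟩
  rw [exteriorNormal, dif_pos hex]
  exact hex.choose_spec

/-! ### Lebesgue and Sobolev spaces -/

/-- Lebesgue measure on `Ω`. -/
abbrev vol (Ω : Set (E d)) : Measure (E d) := (volume : Measure (E d)).restrict Ω

/-- The surface measure on `∂Ω`: the `(d-1)`-dimensional Hausdorff measure. -/
abbrev surface (Ω : Set (E d)) : Measure (E d) :=
  (Measure.hausdorffMeasure ((d : ℝ) - 1)).restrict (frontier Ω)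

/-- `L²(Ω)`. -/
abbrev L2 (Ω : Set (E d)) : Type := Lp ℝ 2 (vol Ω)

/-- `L²(Ω)^d`. -/
abbrev L2Vec (Ω : Set (E d)) : Type := Lp (E d) 2 (vol Ω)

/-- `G` is the weak gradient of `u` in `Ω`. -/
def IsWeakGradient (Ω : Set (E d)) (u : L2 Ω) (G : L2Vec Ω) : Prop :=
  ∀ φ : E d → ℝ, ContDiff ℝ ∞ φ → HasCompactSupport φ → tsupport φ ⊆ Ω →
    ∫ x in Ω, u x • gradient φ x = -∫ x in Ω, φ x • G x

theorem memLp_test {Ω : Set (E d)} {φ : E d → ℝ} (h : ContDiff ℝ ∞ φ)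
    (hc : HasCompactSupport φ) : MemLp φ 2 (vol Ω) :=
  (h.continuous.memLp_of_hasCompactSupport hc).restrict Ω

theorem memLp_gradient_test {Ω : Set (E d)} {φ : E d → ℝ} (h : ContDiff ℝ ∞ φ)
    (hc : HasCompactSupport φ) : MemLp (gradient φ) 2 (vol Ω) := by
  have h1 : Continuous (fderiv ℝ φ) := h.continuous_fderiv (by simp)
  have h2 : Continuous (gradient φ) :=
    (InnerProductSpace.toDual ℝ (E d)).symm.continuous.comp h1
  have h3 : HasCompactSupport (gradient φ) :=
    (hc.fderiv (𝕜 := ℝ)).comp_left (g := (InnerProductSpace.toDual ℝ (E d)).symm) (map_zero _)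
  exact (h2.memLp_of_hasCompactSupport h3).restrict Ω

theorem isWeakGradient_zero (Ω : Set (E d)) : IsWeakGradient Ω 0 0 := by
  intro φ _ _ _
  have h1 : (fun x => (0 : L2 Ω) x • gradient φ x) =ᵐ[vol Ω] fun _ => 0 := by
    filter_upwards [Lp.coeFn_zero ℝ 2 (vol Ω)] with x hx
    rw [hx]; simp
  have h2 : (fun x => φ x • (0 : L2Vec Ω) x) =ᵐ[vol Ω] fun _ => 0 := by
    filter_upwards [Lp.coeFn_zero (E d) 2 (vol Ω)] with x hx
    rw [hx]; simp
  rw [integral_congr_ae h1, integral_congr_ae h2]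
  simp

theorem IsWeakGradient.add {Ω : Set (E d)} {u v : L2 Ω} {G H : L2Vec Ω}
    (hu : IsWeakGradient Ω u G) (hv : IsWeakGradient Ω v H) :
    IsWeakGradient Ω (u + v) (G + H) := by
  intro φ hφ hc hs
  have m1 := memLp_test (Ω := Ω) hφ hc
  have m2 := memLp_gradient_test (Ω := Ω) hφ hc
  have h1 : (fun x => (u + v) x • gradient φ x) =ᵐ[vol Ω]
      fun x => u x • gradient φ x + v x • gradient φ x := by
    filter_upwards [Lp.coeFn_add u v] with x hx
    rw [hx, Pi.add_apply, add_smul]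
  have h2 : (fun x => φ x • (G + H) x) =ᵐ[vol Ω] fun x => φ x • G x + φ x • H x := by
    filter_upwards [Lp.coeFn_add G H] with x hx
    rw [hx, Pi.add_apply, smul_add]
  have i1 : Integrable (fun x => u x • gradient φ x) (vol Ω) :=
    memLp_one_iff_integrable.1 (m2.smul (Lp.memLp u))
  have i2 : Integrable (fun x => v x • gradient φ x) (vol Ω) :=
    memLp_one_iff_integrable.1 (m2.smul (Lp.memLp v))
  have i3 : Integrable (fun x => φ x • G x) (vol Ω) :=
    memLp_one_iff_integrable.1 ((Lp.memLp G).smul m1)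
  have i4 : Integrable (fun x => φ x • H x) (vol Ω) :=
    memLp_one_iff_integrable.1 ((Lp.memLp H).smul m1)
  rw [integral_congr_ae h1, integral_congr_ae h2, integral_add i1 i2, integral_add i3 i4,
    hu φ hφ hc hs, hv φ hφ hc hs, neg_add]

theorem IsWeakGradient.smul {Ω : Set (E d)} (c : ℝ) {u : L2 Ω} {G : L2Vec Ω}
    (hu : IsWeakGradient Ω u G) : IsWeakGradient Ω (c • u) (c • G) := by
  intro φ hφ hc hs
  have h1 : (fun x => (c • u) x • gradient φ x) =ᵐ[vol Ω]
      fun x => c • (u x • gradient φ x) := by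
    filter_upwards [Lp.coeFn_smul c u] with x hx
    rw [hx, Pi.smul_apply, smul_assoc]
  have h2 : (fun x => φ x • (c • G) x) =ᵐ[vol Ω] fun x => c • (φ x • G x) := by
    filter_upwards [Lp.coeFn_smul c G] with x hx
    rw [hx, Pi.smul_apply, smul_comm]
  rw [integral_congr_ae h1, integral_congr_ae h2, integral_smul, integral_smul,
    hu φ hφ hc hs, smul_neg]

/-- The Sobolev space `H¹(Ω)`. An element is stored as the pair `(u, ∇u)` of a function
`u ∈ L²(Ω)` and its weak gradient `∇u ∈ L²(Ω)^d`, which is determined by `u`; the norm is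
`(‖u‖² + ‖∇u‖²)^{1/2}`. -/
def H1 (Ω : Set (E d)) : Submodule ℝ (WithLp 2 (L2 Ω × L2Vec Ω)) where
  carrier := {w | IsWeakGradient Ω w.fst w.snd}
  zero_mem' := isWeakGradient_zero Ω
  add_mem' := fun hu hv => IsWeakGradient.add hu hv
  smul_mem' := fun c _ hu => IsWeakGradient.smul c hu

/-- The underlying `L²` function of an element of `H¹(Ω)`. -/
def H1.toL2 {Ω : Set (E d)} (u : H1 Ω) : L2 Ω := (u : WithLp 2 (L2 Ω × L2Vec Ω)).fst

/-- The weak gradient of an element of `H¹(Ω)`. -/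
def H1.grad {Ω : Set (E d)} (u : H1 Ω) : L2Vec Ω := (u : WithLp 2 (L2 Ω × L2Vec Ω)).snd

/-- `H¹(Ω)^d`, with the norm `(∑ᵢ ‖ψᵢ‖²)^{1/2}`. -/
abbrev H1Vec (Ω : Set (E d)) : Type := PiLp 2 (fun _ : Fin d => H1 Ω)

/-- The (weak) divergence `div ψ = ∑ᵢ ∂ᵢψᵢ ∈ L²(Ω)`. -/
def divergence {Ω : Set (E d)} (ψ : H1Vec Ω) : L2 Ω :=
  ∑ i, (EuclideanSpace.proj i : E d →L[ℝ] ℝ).compLp (H1.grad (ψ i))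

/-! ### Boundary traces -/

/-- `g ∈ L²(∂Ω)` is the boundary trace of `u ∈ H¹(Ω)`: there are functions `φ k`, smooth up to the
boundary, with `φ k → u` in `H¹(Ω)` and `φ k → g` in `L²(∂Ω)`. -/
def HasTrace {Ω : Set (E d)} (u : H1 Ω) (g : E d → ℝ) : Prop :=
  MemLp g 2 (surface Ω) ∧ ∃ φ : ℕ → E d → ℝ,
    (∀ k, ContDiff ℝ ∞ (φ k)) ∧
    Tendsto (fun k => eLpNorm (fun x => φ k x - H1.toL2 u x) 2 (vol Ω)) atTop (𝓝 0) ∧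
    Tendsto (fun k => eLpNorm (fun x => gradient (φ k) x - H1.grad u x) 2 (vol Ω)) atTop (𝓝 0) ∧
    Tendsto (fun k => eLpNorm (fun x => φ k x - g x) 2 (surface Ω)) atTop (𝓝 0)

theorem hasTrace_zero (Ω : Set (E d)) : HasTrace (0 : H1 Ω) fun _ => 0 := by
  refine ⟨MemLp.zero, fun _ _ => 0, fun _ => contDiff_const, ?_, ?_, ?_⟩
  · have h : (fun x => (0 : ℝ) - H1.toL2 (0 : H1 Ω) x) =ᵐ[vol Ω] 0 := by
      filter_upwards [Lp.coeFn_zero ℝ 2 (vol Ω)] with x hx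
      change (0 : ℝ) - (0 : L2 Ω) x = 0
      rw [hx]; simp
    simp only [eLpNorm_congr_ae h]
    simp
  · have h : (fun x => gradient (fun _ : E d => (0 : ℝ)) x - H1.grad (0 : H1 Ω) x)
        =ᵐ[vol Ω] 0 := by
      filter_upwards [Lp.coeFn_zero (E d) 2 (vol Ω)] with x hx
      change gradient (fun _ : E d => (0 : ℝ)) x - (0 : L2Vec Ω) x = 0
      rw [hx]; simp [gradient]
    simp only [eLpNorm_congr_ae h]
    simp
  · simp

theorem tendsto_eLpNorm_sub_add {F : Type*} [NormedAddCommGroup F] {μ : Measure (E d)}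
    {a b : ℕ → E d → F} {u v w : E d → F} (ha : ∀ k, Continuous (a k)) (hb : ∀ k, Continuous (b k))
    (hu : MemLp u 2 μ) (hv : MemLp v 2 μ) (hw : w =ᵐ[μ] u + v)
    (h1 : Tendsto (fun k => eLpNorm (fun x => a k x - u x) 2 μ) atTop (𝓝 0))
    (h2 : Tendsto (fun k => eLpNorm (fun x => b k x - v x) 2 μ) atTop (𝓝 0)) :
    Tendsto (fun k => eLpNorm (fun x => (a k x + b k x) - w x) 2 μ) atTop (𝓝 0) := by
  have h3 := h1.add h2
  rw [add_zero] at h3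
  refine tendsto_of_tendsto_of_tendsto_of_le_of_le tendsto_const_nhds h3 (fun _ => zero_le)
    fun k => ?_
  have e : (fun x => (a k x + b k x) - w x) =ᵐ[μ]
      (fun x => a k x - u x) + fun x => b k x - v x := by
    filter_upwards [hw] with x hx
    rw [hx]
    simp only [Pi.add_apply]
    abel
  simp only [eLpNorm_congr_ae e]
  exact eLpNorm_add_le ((ha k).aestronglyMeasurable.sub hu.1)
    ((hb k).aestronglyMeasurable.sub hv.1) (by norm_num)

theorem tendsto_eLpNorm_sub_smul {F : Type*} [NormedAddCommGroup F] [NormedSpace ℝ F]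
    {μ : Measure (E d)} (c : ℝ) {a : ℕ → E d → F} {u w : E d → F} (hw : w =ᵐ[μ] c • u)
    (h1 : Tendsto (fun k => eLpNorm (fun x => a k x - u x) 2 μ) atTop (𝓝 0)) :
    Tendsto (fun k => eLpNorm (fun x => c • a k x - w x) 2 μ) atTop (𝓝 0) := by
  have e : ∀ k, (fun x => c • a k x - w x) =ᵐ[μ] c • fun x => a k x - u x := fun k => by
    filter_upwards [hw] with x hx
    rw [hx]
    simp only [Pi.smul_apply, smul_sub]
  simp only [eLpNorm_congr_ae (e _), eLpNorm_const_smul]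
  have h2 := ENNReal.Tendsto.const_mul (a := ‖c‖ₑ) h1 (Or.inr enorm_ne_top)
  rwa [mul_zero] at h2

theorem continuous_gradient {φ : E d → ℝ} (h : ContDiff ℝ ∞ φ) : Continuous (gradient φ) :=
  (InnerProductSpace.toDual ℝ (E d)).symm.continuous.comp (h.continuous_fderiv (by simp))

theorem HasTrace.add {Ω : Set (E d)} {u v : H1 Ω} {g h : E d → ℝ}
    (hu : HasTrace u g) (hv : HasTrace v h) : HasTrace (u + v) (fun x => g x + h x) := by
  obtain ⟨mg, a, sa, a1, a2, a3⟩ := hu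
  obtain ⟨mh, b, sb, b1, b2, b3⟩ := hv
  refine ⟨mg.add mh, fun k x => a k x + b k x, fun k => (sa k).add (sb k), ?_, ?_, ?_⟩
  · exact tendsto_eLpNorm_sub_add (fun k => (sa k).continuous) (fun k => (sb k).continuous)
      (Lp.memLp _) (Lp.memLp _) (Lp.coeFn_add _ _) a1 b1
  · have e : ∀ k, gradient (fun x => a k x + b k x) =
        fun x => gradient (a k) x + gradient (b k) x := fun k => by
      funext x
      simp only [gradient]
      rw [fderiv_fun_add ((sa k).differentiable (by simp) x)
        ((sb k).differentiable (by simp) x), map_add]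
    simp only [e]
    exact tendsto_eLpNorm_sub_add (fun k => continuous_gradient (sa k))
      (fun k => continuous_gradient (sb k)) (Lp.memLp _) (Lp.memLp _) (Lp.coeFn_add _ _) a2 b2
  · exact tendsto_eLpNorm_sub_add (fun k => (sa k).continuous) (fun k => (sb k).continuous)
      mg mh (Eventually.of_forall fun _ => rfl) a3 b3

theorem HasTrace.smul {Ω : Set (E d)} (c : ℝ) {u : H1 Ω} {g : E d → ℝ}
    (hu : HasTrace u g) : HasTrace (c • u) (fun x => c * g x) := by
  obtain ⟨mg, a, sa, a1, a2, a3⟩ := hu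
  refine ⟨mg.const_smul c, fun k x => c • a k x, fun k => (sa k).const_smul c, ?_, ?_, ?_⟩
  · exact tendsto_eLpNorm_sub_smul c (Lp.coeFn_smul c _) a1
  · have e : ∀ k, gradient (fun x => c • a k x) = fun x => c • gradient (a k) x := fun k => by
      funext x
      simp only [gradient]
      rw [fderiv_fun_const_smul ((sa k).differentiable (by simp) x)]
      simp
    simp only [e]
    exact tendsto_eLpNorm_sub_smul c (Lp.coeFn_smul c _) a2
  · exact tendsto_eLpNorm_sub_smul c (Eventually.of_forall fun _ => rfl) a3

/-- The test space `{ψ ∈ H¹(Ω)^d : ψ|_Γ₁ = 0, n·ψ|_Γ₂ = 0}`, where the boundary values (here `g`)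
are taken in the sense of traces and `n` is the exterior unit normal. -/
def testSpace (Ω Γ₁ Γ₂ : Set (E d)) : Submodule ℝ (H1Vec Ω) where
  carrier := {ψ | ∃ g : E d → E d, (∀ i, HasTrace (ψ i) fun x => g x i) ∧
    (∀ᵐ x ∂(surface Ω), x ∈ Γ₁ → g x = 0) ∧
    (∀ᵐ x ∂(surface Ω), x ∈ Γ₂ → ⟪exteriorNormal Ω x, g x⟫ = 0)}
  zero_mem' := ⟨fun _ => 0, fun _ => hasTrace_zero Ω, by simp, by simp⟩
  add_mem' := by
    rintro ψ χ ⟨g, g0, g1, g2⟩ ⟨h, h0, h1, h2⟩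
    refine ⟨fun x => g x + h x, fun i => (g0 i).add (h0 i), ?_, ?_⟩
    · filter_upwards [g1, h1] with x hg hh hx
      rw [hg hx, hh hx, add_zero]
    · filter_upwards [g2, h2] with x hg hh hx
      rw [inner_add_right, hg hx, hh hx, add_zero]
  smul_mem' := by
    rintro c ψ ⟨g, g0, g1, g2⟩
    refine ⟨fun x => c • g x, fun i => (g0 i).smul c, ?_, ?_⟩
    · filter_upwards [g1] with x hg hx
      rw [hg hx, smul_zero]
    · filter_upwards [g2] with x hg hx
      rw [inner_smul_right, hg hx, mul_zero]

/-- Membership in `V(Ω) = {ψ ∈ H¹(Ω)^d : div ψ = 0, ψ|_Γ₁ = 0, n·ψ|_Γ₂ = 0}`. -/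
def solenoidal (Ω Γ₁ Γ₂ : Set (E d)) : Set (testSpace Ω Γ₁ Γ₂) :=
  {ψ | divergence (ψ : H1Vec Ω) = 0}

end StokesPressure

end

open StokesPressure

section

open MeasureTheory Filter Topology Set
open scoped ContDiff RealInnerProductSpace ENNReal FourierTransform Manifold

namespace StokesPressure

variable {d n : ℕ}

/-! The core is that the divergence maps `H₀¹` fields onto the mean-zero functions of `L²(Ω)`.
Granted this, `F` depends only on the divergence of its argument, and the open mapping theorem turns
it into a bounded functional of that divergence. Riesz representation then gives `p`.

Surjectivity is obtained locally and then glued. Bogovskii's field carries the mass `f y` along all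
segments from `y` to points `z`, with `z` weighted by a fixed bump `θ` of integral one. If `f` has
mean zero, the fundamental theorem of calculus on each segment shows that its divergence is `f`, and
its support stays on those segments. The `H¹` bound is proved by Fourier transform: each component
has a transform of the form `∫₀¹ a((1 - s)ξ) b(sξ) ds`, with `a` coming from `f` and `b` rapidly
decreasing. A Schur-type argument handles `s ≤ 1/2`, and the decay of `b` together with `a` being
bounded handles `s ≥ 1/2` (`exists_lintegral_sq_le`). The bound extends solvability from smooth data
to all mean-zero `L²` data vanishing off a patch whose points all see one ball inside `Ω`.
Smoothness of the boundary makes every point of the closure the centre of such a patch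
(`exists_isStarPatch`). Finitely many patches cover, and connectedness allows mass to be moved from
one patch to another, which gives `isDiv_of_integral_eq_zero`.

The boundary conditions enter through the total flux. A divergence theorem for traces
(`integral_divergence_eq_zero`) shows that fields with vanishing normal trace have mean-zero
divergence. It needs no formula for the surface element, only some measure dominated by the surface
measure and a density parallel to the normal. If `Γ₃` is empty, all test fields have mean-zero
divergence, so `p` is determined up to a constant and the normalization fixes it. If `Γ₃` is
nonempty, a field concentrated near a point of `Γ₃` has nonzero flux
(`exists_mem_testSpace_integral_ne_zero`). Corrected by an `H₀¹` field it has divergence one, and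
the value of `F` on it fixes the mean of `p`. -/

/-! ### The Bogovskii field: smoothness, support and divergence -/

/-- A test function on `E d`: smooth with compact support. -/
structure IsTest (f : E d → ℝ) : Prop where
  smooth : ContDiff ℝ ∞ f
  compact : HasCompactSupport f

/-- The integrand of the Bogovskii field, cut off smoothly in the time variable. -/
noncomputable def bogovskiiKernel (f θ : E d → ℝ) (x : E d) (p : ℝ × E d) : E d :=
  ((⟨1, 2, one_pos, one_lt_two⟩ : ContDiffBump (0 : ℝ)) p.1 *
    (f (x - p.1 • p.2) * θ (x + (1 - p.1) • p.2))) • p.2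

/-- The Bogovskii field of `f` with weight `θ`. -/
noncomputable def bogovskii (f θ : E d → ℝ) (x : E d) : E d :=
  ∫ p in Icc (0 : ℝ) 1 ×ˢ (univ : Set (E d)), bogovskiiKernel f θ x p

theorem bogovskiiKernel_of_mem (f θ : E d → ℝ) (x : E d) {s : ℝ} (hs : s ∈ Icc (0 : ℝ) 1)
    (w : E d) :
    bogovskiiKernel f θ x (s, w) = (f (x - s • w) * θ (x + (1 - s) • w)) • w := by
  rw [bogovskiiKernel, ContDiffBump.one_of_mem_closedBall, one_mul]
  simpa [abs_of_nonneg hs.1] using hs.2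

theorem contDiff_bogovskiiKernel {f θ : E d → ℝ} (hf : ContDiff ℝ ∞ f) (hθ : ContDiff ℝ ∞ θ) :
    ContDiff ℝ ∞ (fun q : E d × (ℝ × E d) => bogovskiiKernel f θ q.1 q.2) := by
  have h1 : ContDiff ℝ ∞ (fun q : E d × (ℝ × E d) => q.2.1) := contDiff_snd.fst
  have h2 : ContDiff ℝ ∞ (fun q : E d × (ℝ × E d) => q.2.2) := contDiff_snd.snd
  have h3 : ContDiff ℝ ∞ (fun q : E d × (ℝ × E d) => q.1) := contDiff_fst
  refine ContDiff.smul (𝕜 := ℝ) (𝕜' := ℝ) (ContDiff.mul ?_ (ContDiff.mul ?_ ?_)) h2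
  · exact ContDiff.comp (g := (⟨1, 2, one_pos, one_lt_two⟩ : ContDiffBump (0 : ℝ)))
      (ContDiffBump.contDiff _) h1
  · exact hf.comp (h3.sub (h1.smul h2))
  · exact hθ.comp (h3.add ((contDiff_const.sub h1).smul h2))

/-- With `y = x - s • w` and `z = x + (1 - s) • w` one has `w = z - y` and `x = y + s • w`, so
bounds on the supports of `f` and `θ` bound `w`. The cutoff in time gives `|s| ≤ 2`, and then `x` is
bounded too. -/
theorem exists_isCompact_bogovskiiKernel {f θ : E d → ℝ} (hf : HasCompactSupport f)
    (hθ : HasCompactSupport θ) : ∃ (K : Set (E d)) (L : Set (ℝ × E d)), IsCompact K ∧ IsCompact L ∧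
      ∀ x p, bogovskiiKernel f θ x p ≠ 0 → x ∈ K ∧ p ∈ L := by
  obtain ⟨R, hR⟩ := (hf.isCompact.isBounded).exists_norm_le
  obtain ⟨S, hS⟩ := (hθ.isCompact.isBounded).exists_norm_le
  refine ⟨Metric.closedBall 0 (R + 2 * (R + S)),
    Metric.closedBall 0 2 ×ˢ Metric.closedBall 0 (R + S), isCompact_closedBall _ _,
    (isCompact_closedBall _ _).prod (isCompact_closedBall _ _), ?_⟩
  rintro x ⟨s, w⟩ h
  simp only [bogovskiiKernel, ne_eq, smul_eq_zero, mul_eq_zero, not_or] at h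
  obtain ⟨⟨h1, h2, h3⟩, -⟩ := h
  have hs : |s| ≤ 2 := by
    by_contra hs
    exact h1 (ContDiffBump.zero_of_le_dist _ (by simpa using (not_le.1 hs).le))
  have hy := hR _ (subset_tsupport _ h2)
  have hz := hS _ (subset_tsupport _ h3)
  have hw : ‖w‖ ≤ R + S := by
    have : w = (x + (1 - s) • w) - (x - s • w) := by module
    rw [this]
    exact (norm_sub_le _ _).trans (by linarith)
  have hx : ‖x‖ ≤ R + 2 * (R + S) := by
    have : x = (x - s • w) + s • w := by module
    rw [this]
    refine (norm_add_le _ _).trans (add_le_add hy ?_)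
    rw [norm_smul]
    exact mul_le_mul hs hw (norm_nonneg _) (by norm_num)
  simp [hs, hw, hx]

/-- The field is the value at `0` of a convolution of the indicator of `[0,1] × E d` with the
reflected kernel, depending on the parameter `x`. The kernel is smooth with support in one compact
set for all `x`, which is why it was cut off smoothly in time. -/
theorem contDiff_bogovskii {f θ : E d → ℝ} (hf : IsTest f) (hθ : IsTest θ) :
    ContDiff ℝ ∞ (bogovskii f θ) := by
  obtain ⟨K, L, hK, hL, hKL⟩ := exists_isCompact_bogovskiiKernel hf.compact hθ.compact
  have hm : MeasurableSet (Icc (0 : ℝ) 1 ×ˢ (univ : Set (E d))) :=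
    measurableSet_Icc.prod MeasurableSet.univ
  have h := contDiffOn_convolution_right_with_param_comp (𝕜 := ℝ) (n := ⊤)
    (μ := (volume : Measure (ℝ × E d))) (ContinuousLinearMap.lsmul ℝ ℝ)
    (s := (univ : Set (E d))) (v := fun _ => (0 : ℝ × E d)) contDiffOn_const
    (f := (Icc (0 : ℝ) 1 ×ˢ (univ : Set (E d))).indicator fun _ => (1 : ℝ))
    (g := fun x p => bogovskiiKernel f θ x (-p)) (k := -L) isOpen_univ hL.neg
    (fun x p _ hp => by
      by_contra h
      exact hp (by simpa using (hKL x _ h).2))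
    ((locallyIntegrable_const (1 : ℝ)).indicator hm)
    (by
      refine ContDiff.contDiffOn ?_
      exact (contDiff_bogovskiiKernel hf.smooth hθ.smooth).comp
        (contDiff_fst.prodMk contDiff_snd.neg))
  rw [contDiffOn_univ] at h
  convert h using 2 with x
  rw [bogovskii, convolution, ← integral_indicator hm]
  congr 1
  ext1 p
  by_cases hp : p ∈ Icc (0 : ℝ) 1 ×ˢ (univ : Set (E d)) <;> simp [hp]

theorem exists_of_bogovskii_ne_zero {f θ : E d → ℝ} {x : E d} (hx : bogovskii f θ x ≠ 0) :
    ∃ s ∈ Icc (0 : ℝ) 1, ∃ y ∈ tsupport f, ∃ z ∈ tsupport θ, x = (1 - s) • y + s • z := by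
  by_contra! h
  refine hx (setIntegral_eq_zero_of_forall_eq_zero ?_)
  rintro ⟨s, w⟩ ⟨hs, -⟩
  rw [bogovskiiKernel_of_mem f θ x hs w]
  by_contra hne
  simp only [smul_eq_zero, mul_eq_zero, not_or] at hne
  exact h s hs _ (subset_tsupport _ hne.1.1) _ (subset_tsupport _ hne.1.2) (by module)

/-- The set of all segments joining two sets. -/
def segments (A B : Set (E d)) : Set (E d) :=
  (fun q : ℝ × E d × E d => (1 - q.1) • q.2.1 + q.1 • q.2.2) '' (Icc (0 : ℝ) 1 ×ˢ A ×ˢ B)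

theorem isCompact_segments {A B : Set (E d)} (hA : IsCompact A) (hB : IsCompact B) :
    IsCompact (segments A B) :=
  (isCompact_Icc.prod (hA.prod hB)).image (by fun_prop)

theorem tsupport_bogovskii_subset {f θ : E d → ℝ} (hf : HasCompactSupport f)
    (hθ : HasCompactSupport θ) :
    tsupport (bogovskii f θ) ⊆ segments (tsupport f) (tsupport θ) := by
  refine closure_minimal ?_ (isCompact_segments hf hθ).isClosed
  intro x hx
  obtain ⟨s, hs, y, hy, z, hz, rfl⟩ := exists_of_bogovskii_ne_zero hx
  exact ⟨(s, y, z), ⟨hs, hy, hz⟩, rfl⟩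

theorem hasCompactSupport_bogovskii {f θ : E d → ℝ} (hf : HasCompactSupport f)
    (hθ : HasCompactSupport θ) : HasCompactSupport (bogovskii f θ) :=
  (isCompact_segments hf hθ).of_isClosed_subset (isClosed_tsupport _)
    (tsupport_bogovskii_subset hf hθ)

/-- Both substitutions, `x = y + s • w` and `w = z - y`, are translations. No Jacobian appears, so
nothing degenerates as `s` tends to `0` or `1`. -/
theorem integral_smul_apply_eq {G : Type*} [NormedAddCommGroup G] [NormedSpace ℝ G]
    {f θ : E d → ℝ} (hf : IsTest f) (hθ : IsTest θ) {φ : E d → E d →L[ℝ] G}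
    (hφ : Continuous φ) (s : ℝ) :
    ∫ w, ∫ x, (f (x - s • w) * θ (x + (1 - s) • w)) • φ x w = ∫ y, ∫ z,
      (f y * θ z) • φ ((1 - s) • y + s • z) (z - y) := by
  have e2 : ∀ w : E d, ∫ x, (f (x - s • w) * θ (x + (1 - s) • w)) • φ x w =
      ∫ y, (f y * θ (y + w)) • φ (y + s • w) w := fun w => by
    rw [← integral_add_right_eq_self _ (s • w)]
    congr 1
    ext1 y
    rw [show y + s • w - s • w = y by module, show y + s • w + (1 - s) • w = y + w by module]
  simp only [e2]
  have h1 := hf.smooth.continuous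
  have h2 := hθ.smooth.continuous
  have h3 : Continuous (fun q : E d × E d => φ (q.2 + s • q.1) q.1) :=
    (hφ.comp (by fun_prop)).clm_apply continuous_fst
  have h4 : Continuous (fun q : E d × E d => f q.2 * θ (q.2 + q.1)) := by fun_prop
  rw [integral_integral_swap_of_hasCompactSupport]
  · congr 1
    ext1 y
    rw [← integral_sub_right_eq_self _ y]
    congr 1
    ext1 z
    rw [show y + (z - y) = z by module, show y + s • (z - y) = (1 - s) • y + s • z by module]
  · exact h4.smul h3
  · refine HasCompactSupport.intro
      ((hf.compact.isCompact.prod hθ.compact.isCompact).image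
        (f := fun q : E d × E d => (q.2 - q.1, q.1)) (by fun_prop)) ?_
    rintro ⟨w, y⟩ hq
    by_contra h
    simp only [Function.uncurry, smul_eq_zero, mul_eq_zero, not_or] at h
    exact hq ⟨(y, y + w), ⟨subset_tsupport _ h.1.1, subset_tsupport _ h.1.2⟩, by simp⟩

theorem integral_apply_bogovskii_eq {G : Type*} [NormedAddCommGroup G] [NormedSpace ℝ G]
    [CompleteSpace G] {f θ : E d → ℝ} (hf : IsTest f) (hθ : IsTest θ) {φ : E d → E d →L[ℝ] G}
    (hφ : Continuous φ) :
    ∫ x, φ x (bogovskii f θ x) =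
      ∫ s in Icc (0 : ℝ) 1, ∫ w, ∫ x, φ x (bogovskiiKernel f θ x (s, w)) := by
  obtain ⟨K, L, hK, hL, hKL⟩ := exists_isCompact_bogovskiiKernel hf.compact hθ.compact
  have hc : Continuous (fun q : E d × (ℝ × E d) => bogovskiiKernel f θ q.1 q.2) :=
    (contDiff_bogovskiiKernel hf.smooth hθ.smooth).continuous
  have hcs : ∀ p x, p ∉ L → bogovskiiKernel f θ x p = 0 := fun p x hp => by
    by_contra h
    exact hp (hKL x p h).2
  have hc2 : Continuous (fun q : E d × (ℝ × E d) => φ q.1 (bogovskiiKernel f θ q.1 q.2)) :=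
    (hφ.comp continuous_fst).clm_apply hc
  have hcomp : HasCompactSupport
      (fun q : E d × (ℝ × E d) => φ q.1 (bogovskiiKernel f θ q.1 q.2)) := by
    refine HasCompactSupport.intro (hK.prod hL) fun q hq => ?_
    by_contra h
    have h0 : bogovskiiKernel f θ q.1 q.2 ≠ 0 := fun h0 => h (by rw [h0, map_zero])
    exact hq ⟨(hKL _ _ h0).1, (hKL _ _ h0).2⟩
  have hμ : (volume : Measure (ℝ × E d)).restrict (Icc (0 : ℝ) 1 ×ˢ univ) =
      ((volume : Measure ℝ).restrict (Icc 0 1)).prod (volume : Measure (E d)) := by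
    rw [Measure.volume_eq_prod, ← Measure.prod_restrict, Measure.restrict_univ]
  have e1 : ∀ x, φ x (bogovskii f θ x) =
      ∫ p in Icc (0 : ℝ) 1 ×ˢ univ, φ x (bogovskiiKernel f θ x p) := fun x => by
    have h1 : Continuous (bogovskiiKernel f θ x) :=
      hc.comp (continuous_const.prodMk continuous_id)
    have h2 : HasCompactSupport (bogovskiiKernel f θ x) :=
      HasCompactSupport.intro hL fun p hp => hcs p x hp
    have h3 : Integrable (bogovskiiKernel f θ x) := h1.integrable_of_hasCompactSupport h2
    exact ((φ x).integral_comp_comm h3.integrableOn).symm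
  have hν : IsFiniteMeasureOnCompacts (((volume : Measure ℝ).restrict (Icc 0 1)).prod
      (volume : Measure (E d))) := by
    rw [← hμ]; infer_instance
  simp only [e1, hμ]
  have h4 : Integrable (fun q : E d × (ℝ × E d) => φ q.1 (bogovskiiKernel f θ q.1 q.2))
      ((volume : Measure (E d)).prod (((volume : Measure ℝ).restrict (Icc 0 1)).prod
      (volume : Measure (E d)))) :=
    hc2.integrable_of_hasCompactSupport hcomp
  exact (integral_integral_swap h4).trans (integral_prod
    (fun p : ℝ × E d => ∫ x, φ x (bogovskiiKernel f θ x p)) h4.integral_prod_right)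

/-- Integration against the Bogovskii field, in the variables `s`, `y` and `z`. -/
theorem integral_apply_bogovskii {G : Type*} [NormedAddCommGroup G] [NormedSpace ℝ G]
    [CompleteSpace G] {f θ : E d → ℝ} (hf : IsTest f) (hθ : IsTest θ) {φ : E d → E d →L[ℝ] G}
    (hφ : Continuous φ) :
    ∫ x, φ x (bogovskii f θ x) = ∫ s in Icc (0 : ℝ) 1, ∫ y, ∫ z,
      (f y * θ z) • φ ((1 - s) • y + s • z) (z - y) := by
  rw [integral_apply_bogovskii_eq hf hθ hφ]
  refine setIntegral_congr_fun measurableSet_Icc fun s hs => ?_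
  simp only [bogovskiiKernel_of_mem f θ _ hs, map_smul]
  exact integral_smul_apply_eq hf hθ hφ s

theorem integral_Icc_integral_swap {G : Type*} [NormedAddCommGroup G] [NormedSpace ℝ G]
    {H : ℝ → E d → E d → G} (hH : Continuous fun q : ℝ × E d × E d => H q.1 q.2.1 q.2.2)
    {K : Set (E d × E d)} (hK : IsCompact K) (h0 : ∀ s y z, (y, z) ∉ K → H s y z = 0) :
    ∫ s in Icc (0 : ℝ) 1, ∫ y, ∫ z, H s y z = ∫ y, ∫ z, ∫ s in Icc (0 : ℝ) 1, H s y z := by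
  have hi : Integrable (fun q : ℝ × E d × E d => H q.1 q.2.1 q.2.2)
      ((volume.restrict (Icc (0 : ℝ) 1)).prod (volume : Measure (E d × E d))) := by
    have h1 : IntegrableOn (fun q : ℝ × E d × E d => H q.1 q.2.1 q.2.2)
        (Icc (0 : ℝ) 1 ×ˢ univ) (volume : Measure (ℝ × E d × E d)) := by
      refine (hH.continuousOn.integrableOn_compact ((isCompact_Icc (a := (0 : ℝ)) (b := 1)).prod
        hK)).of_forall_sdiff_eq_zero (measurableSet_Icc.prod MeasurableSet.univ) ?_
      rintro ⟨s, y, z⟩ ⟨⟨hs, -⟩, h⟩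
      exact h0 s y z fun hk => h ⟨hs, hk⟩
    rwa [IntegrableOn, Measure.volume_eq_prod, ← Measure.prod_restrict,
      Measure.restrict_univ] at h1
  have hs : ∀ s, Integrable (fun q : E d × E d => H s q.1 q.2) := fun s =>
    Continuous.integrable_of_hasCompactSupport
      (hH.comp (continuous_const.prodMk continuous_id : Continuous fun q : E d × E d => (s, q)))
      (HasCompactSupport.intro hK fun q hq => h0 s q.1 q.2 hq)
  calc ∫ s in Icc (0 : ℝ) 1, ∫ y, ∫ z, H s y z
      = ∫ s in Icc (0 : ℝ) 1, ∫ q : E d × E d, H s q.1 q.2 := by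
        congr 1
        ext1 s
        exact (integral_prod _ (hs s)).symm
    _ = ∫ q : E d × E d, ∫ s in Icc (0 : ℝ) 1, H s q.1 q.2 :=
        integral_integral_swap hi
    _ = _ := integral_prod _ hi.integral_prod_right

/-- The divergence of the Bogovskii field, in weak form. -/
theorem integral_fderiv_bogovskii {f θ φ : E d → ℝ} (hf : IsTest f) (hθ : IsTest θ)
    (hφ : ContDiff ℝ 1 φ) (hf0 : ∫ x, f x = 0) (hθ1 : ∫ x, θ x = 1) :
    ∫ x, fderiv ℝ φ x (bogovskii f θ x) = - ∫ x, f x * φ x := by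
  have hc : Continuous (fderiv ℝ φ) := hφ.continuous_fderiv one_ne_zero
  have hcf := hf.smooth.continuous
  have hcθ := hθ.smooth.continuous
  have hcφ := hφ.continuous
  have hk : ∀ q : ℝ × E d × E d, HasDerivAt (fun s : ℝ => φ ((1 - s) • q.2.1 + s • q.2.2))
      (fderiv ℝ φ ((1 - q.1) • q.2.1 + q.1 • q.2.2) (q.2.2 - q.2.1)) q.1 := fun q => by
    have h1 : HasDerivAt (fun s : ℝ => (1 - s) • q.2.1 + s • q.2.2) (q.2.2 - q.2.1) q.1 := by
      have h2 := (((hasDerivAt_id q.1).const_sub 1).smul_const q.2.1).add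
        ((hasDerivAt_id q.1).smul_const q.2.2)
      rwa [show (-1 : ℝ) • q.2.1 + (1 : ℝ) • q.2.2 = q.2.2 - q.2.1 by module] at h2
    exact ((hφ.differentiable one_ne_zero _).hasFDerivAt).comp_hasDerivAt _ h1
  have hcc : Continuous fun q : ℝ × E d × E d =>
      fderiv ℝ φ ((1 - q.1) • q.2.1 + q.1 • q.2.2) (q.2.2 - q.2.1) :=
    (hc.comp (by fun_prop)).clm_apply (by fun_prop)
  -- Fundamental theorem of calculus for `φ` along the segment from `y` to `z`.
  have hyz : ∀ y z, ∫ s in Icc (0 : ℝ) 1,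
      fderiv ℝ φ ((1 - s) • y + s • z) (z - y) = φ z - φ y := fun y z => by
    rw [integral_Icc_eq_integral_Ioc, ← intervalIntegral.integral_of_le zero_le_one,
      intervalIntegral.integral_eq_sub_of_hasDerivAt
        (f := fun s : ℝ => φ ((1 - s) • y + s • z)) (fun s _ => hk (s, y, z))]
    · simp
    · exact (hcc.comp (by fun_prop : Continuous fun s : ℝ => (s, y, z))).intervalIntegrable _ _
  rw [integral_apply_bogovskii hf hθ hc]
  rw [integral_Icc_integral_swap (K := tsupport f ×ˢ tsupport θ)]
  · simp only [integral_smul, hyz]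
    simp only [smul_eq_mul, mul_sub]
    have i1 : Integrable fun z => θ z * φ z :=
      Continuous.integrable_of_hasCompactSupport (by fun_prop) (hθ.compact.mul_right)
    have i2 : Integrable θ := hcθ.integrable_of_hasCompactSupport hθ.compact
    have e : ∀ y, ∫ z, (f y * θ z * φ z - f y * θ z * φ y) =
        f y * (∫ z, θ z * φ z) - f y * φ y := fun y => by
      rw [integral_sub]
      · simp only [mul_assoc]
        rw [integral_const_mul, integral_const_mul, integral_mul_const, hθ1, one_mul]
      · simpa only [mul_assoc] using i1.const_mul (f y)
      · exact (i2.const_mul (f y)).mul_const (φ y)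
    simp only [e]
    -- The mean-zero condition removes the contribution of the endpoints `z`.
    rw [integral_sub, integral_mul_const, hf0, zero_mul, zero_sub]
    · exact (hcf.integrable_of_hasCompactSupport hf.compact).mul_const _
    · exact Continuous.integrable_of_hasCompactSupport (by fun_prop) (hf.compact.mul_right)
  · exact ((hcf.comp (by fun_prop)).mul (hcθ.comp (by fun_prop))).smul hcc
  · exact hf.compact.isCompact.prod hθ.compact.isCompact
  · intro s y z hyz
    by_contra h
    simp only [smul_eq_zero, mul_eq_zero, not_or] at h
    exact hyz ⟨subset_tsupport _ h.1.1, subset_tsupport _ h.1.2⟩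

/-! ### Weighted `L²` estimates for integrals over dilations -/

theorem ennreal_add_sq_le (x y : ℝ≥0∞) : (x + y) ^ 2 ≤ 2 * (x ^ 2 + y ^ 2) := by
  have h := ENNReal.rpow_add_le_mul_rpow_add_rpow x y (p := 2) (by norm_num)
  norm_num at h
  exact h

/-- Cauchy–Schwarz for the measure with density `k`, splitting `k` into two square roots. -/
theorem sq_lintegral_mul_le {α : Type*} [MeasurableSpace α] {μ : Measure α} {k a : α → ℝ≥0∞}
    (hk : Measurable k) (ha : Measurable a) :
    (∫⁻ x, k x * a x ∂μ) ^ 2 ≤ (∫⁻ x, k x ∂μ) * ∫⁻ x, k x * a x ^ 2 ∂μ := by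
  have h := ENNReal.lintegral_mul_le_Lp_mul_Lq μ Real.HolderConjugate.two_two
    (f := fun x => k x ^ (1 / 2 : ℝ)) (g := fun x => k x ^ (1 / 2 : ℝ) * a x)
    (by fun_prop) (by fun_prop)
  have e1 : ∀ x, k x ^ (1 / 2 : ℝ) * (k x ^ (1 / 2 : ℝ) * a x) = k x * a x := fun x => by
    rw [← mul_assoc, ← ENNReal.rpow_add_of_nonneg _ _ (by norm_num) (by norm_num)]
    norm_num
  have e2 : ∀ x, (k x ^ (1 / 2 : ℝ)) ^ (2 : ℝ) = k x := fun x => by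
    rw [← ENNReal.rpow_mul]; norm_num
  have e3 : ∀ x, (k x ^ (1 / 2 : ℝ) * a x) ^ (2 : ℝ) = k x * a x ^ 2 := fun x => by
    rw [ENNReal.mul_rpow_of_nonneg _ _ (by norm_num), e2]
    norm_num
  simp only [Pi.mul_apply, e1, e2, e3] at h
  calc (∫⁻ x, k x * a x ∂μ) ^ 2
      ≤ ((∫⁻ x, k x ∂μ) ^ (1 / 2 : ℝ) * (∫⁻ x, k x * a x ^ 2 ∂μ) ^ (1 / 2 : ℝ)) ^ 2 := by
        gcongr
    _ = _ := by
        rw [mul_pow, ← ENNReal.rpow_natCast, ← ENNReal.rpow_natCast, ← ENNReal.rpow_mul,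
          ← ENNReal.rpow_mul]
        norm_num

theorem lintegral_comp_smul_eq {g : E d → ℝ≥0∞} (hg : Measurable g) {r : ℝ} (hr : 0 < r) :
    ∫⁻ x, g (r • x) = ENNReal.ofReal ((r ^ d)⁻¹) * ∫⁻ x, g x := by
  have h := lintegral_map (μ := (volume : Measure (E d))) hg (measurable_const_smul r)
  rw [Measure.map_addHaar_smul _ hr.ne', lintegral_smul_measure] at h
  simp only [finrank_euclideanSpace, Fintype.card_fin] at h
  rw [← h, abs_of_pos (by positivity), smul_eq_mul]

/-- The weight in the small-time part of the Bogovskii estimate. -/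
noncomputable def lowWeight (s t : ℝ) : ℝ≥0∞ := ENNReal.ofReal ((1 + t) / (1 + s * t) ^ 2)

/-- The primitive in `s` is `(1 + t) s / (1 + s t)`, so the integral equals `(1 + t) / (2 + t)`. The
exponent `2` in the weight makes this bound uniform in `t`. -/
theorem lintegral_lowWeight_le {t : ℝ} (ht : 0 ≤ t) :
    ∫⁻ s in Icc (0 : ℝ) (1 / 2), lowWeight s t ≤ 1 := by
  have hpos : ∀ s ∈ Icc (0 : ℝ) (1 / 2), 0 < 1 + s * t := fun s hs => by
    have := mul_nonneg hs.1 ht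
    linarith
  have hcont : ContinuousOn (fun s : ℝ => (1 + t) / (1 + s * t) ^ 2) (Icc 0 (1 / 2)) :=
    ContinuousOn.div (by fun_prop) (by fun_prop) fun s hs => by have := hpos s hs; positivity
  have hI : ∫ s in (0 : ℝ)..(1 / 2), (1 + t) / (1 + s * t) ^ 2 =
      (1 + t) * ((1 / 2) / (1 + 1 / 2 * t)) := by
    rw [intervalIntegral.integral_eq_sub_of_hasDerivAt
      (f := fun s => (1 + t) * (s / (1 + s * t)))]
    · simp
    · intro s hs
      rw [uIcc_of_le (by norm_num)] at hs
      have h0 := (hpos s hs).ne'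
      have h1 : HasDerivAt (fun s : ℝ => 1 + s * t) t s := by
        simpa using ((hasDerivAt_id s).mul_const t).const_add 1
      have h2 := ((hasDerivAt_id s).div h1 h0).const_mul (1 + t)
      have h3 : (1 + t) / (1 + s * t) ^ 2 =
          (1 + t) * ((1 * (1 + s * t) - s * t) / (1 + s * t) ^ 2) := by ring
      rw [h3]
      exact h2
    · exact ContinuousOn.intervalIntegrable (by rwa [uIcc_of_le (by norm_num)])
  unfold lowWeight
  rw [← ofReal_integral_eq_lintegral_ofReal (hcont.integrableOn_Icc)]
  · rw [integral_Icc_eq_integral_Ioc, ← intervalIntegral.integral_of_le (by norm_num), hI,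
      ← ENNReal.ofReal_one]
    refine ENNReal.ofReal_le_ofReal ?_
    rw [← mul_div_assoc, div_le_one (by positivity)]
    linarith
  · filter_upwards [ae_restrict_mem measurableSet_Icc] with s hs
    have := hpos s hs
    positivity

/-- For `s ≤ 1/2` the dilation by `1 - s` costs at most a factor `2` in the numerator and only
decreases the denominator. This prepares the change of variables `ξ ↦ (1 - s) • ξ`. -/
theorem lowWeight_le {s t : ℝ} (hs : s ∈ Icc (0 : ℝ) (1 / 2)) (ht : 0 ≤ t) :
    lowWeight s t ≤ 2 * lowWeight s ((1 - s) * t) := by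
  obtain ⟨h0, h1⟩ := hs
  have h2 : 0 ≤ s * t := mul_nonneg h0 ht
  have h3 : 0 ≤ (1 - s) * t := mul_nonneg (by linarith) ht
  have h4 : 0 ≤ s * ((1 - s) * t) := mul_nonneg h0 h3
  have h5 : s * ((1 - s) * t) ≤ s * t := by
    refine mul_le_mul_of_nonneg_left ?_ h0
    nlinarith
  have h6 : 1 + t ≤ 2 * (1 + (1 - s) * t) := by nlinarith
  unfold lowWeight
  rw [← ENNReal.ofReal_ofNat 2, ← ENNReal.ofReal_mul (by norm_num)]
  refine ENNReal.ofReal_le_ofReal ?_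
  rw [← mul_div_assoc]
  gcongr

theorem measurable_lowWeight_left (ξ : E d) : Measurable fun s => lowWeight s ‖ξ‖ := by
  unfold lowWeight
  fun_prop

theorem measurable_lowWeight_right (s : ℝ) : Measurable fun ξ : E d => lowWeight s ‖ξ‖ := by
  unfold lowWeight
  fun_prop

theorem lintegral_lowWeight_mul_smul_le {a : E d → ℝ≥0∞} (ha : Measurable a) {s : ℝ}
    (hs : s ∈ Icc (0 : ℝ) (1 / 2)) :
    ∫⁻ ξ : E d, lowWeight s ‖ξ‖ * a ((1 - s) • ξ) ^ 2 ≤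
      2 ^ (d + 1) * ∫⁻ ξ : E d, lowWeight s ‖ξ‖ * a ξ ^ 2 := by
  have hs1 : (1 / 2 : ℝ) ≤ 1 - s := by linarith [hs.2]
  have hs0 : 0 < 1 - s := by linarith
  have hm : Measurable fun ξ : E d => lowWeight s ‖ξ‖ * a ξ ^ 2 :=
    (measurable_lowWeight_right s).mul (ha.pow_const 2)
  have h2 : (2 : ℝ≥0∞) ^ d = ENNReal.ofReal (((1 / 2) ^ d)⁻¹) := by
    rw [← inv_pow, ENNReal.ofReal_pow (by norm_num)]
    norm_num
  calc ∫⁻ ξ : E d, lowWeight s ‖ξ‖ * a ((1 - s) • ξ) ^ 2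
      ≤ ∫⁻ ξ : E d, 2 * (lowWeight s ‖(1 - s) • ξ‖ * a ((1 - s) • ξ) ^ 2) := by
        refine lintegral_mono fun ξ => ?_
        rw [norm_smul, Real.norm_of_nonneg hs0.le, ← mul_assoc]
        exact mul_le_mul_left (lowWeight_le hs (norm_nonneg ξ)) _
    _ = ENNReal.ofReal (((1 - s) ^ d)⁻¹) * ∫⁻ ξ : E d, 2 * (lowWeight s ‖ξ‖ * a ξ ^ 2) :=
        lintegral_comp_smul_eq (g := fun ξ => 2 * (lowWeight s ‖ξ‖ * a ξ ^ 2))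
          (hm.const_mul 2) hs0
    _ ≤ 2 ^ d * (2 * ∫⁻ ξ : E d, lowWeight s ‖ξ‖ * a ξ ^ 2) := by
        rw [lintegral_const_mul _ hm, h2]
        refine mul_le_mul_left (ENNReal.ofReal_le_ofReal ?_) _
        gcongr
    _ = _ := by rw [← mul_assoc, pow_succ]

/-- The small-time part of the Bogovskii estimate. -/
theorem lintegral_sq_lowWeight_le {a : E d → ℝ≥0∞} (ha : Measurable a) :
    ∫⁻ ξ : E d, (∫⁻ s in Icc (0 : ℝ) (1 / 2), lowWeight s ‖ξ‖ * a ((1 - s) • ξ)) ^ 2 ≤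
      2 ^ (d + 1) * ∫⁻ ξ, a ξ ^ 2 := by
  have hw : Measurable fun q : ℝ × E d => lowWeight q.1 ‖q.2‖ := by
    unfold lowWeight
    fun_prop
  have hw' : Measurable fun q : E d × ℝ => lowWeight q.2 ‖q.1‖ := by
    unfold lowWeight
    fun_prop
  have hm : Measurable fun q : E d × ℝ => lowWeight q.2 ‖q.1‖ * a ((1 - q.2) • q.1) ^ 2 :=
    hw'.mul ((ha.comp (by fun_prop)).pow_const 2)
  have hm2 : Measurable fun q : ℝ × E d => lowWeight q.1 ‖q.2‖ * a q.2 ^ 2 :=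
    hw.mul ((ha.comp (by fun_prop)).pow_const 2)
  have hm3 : Measurable fun s : ℝ => ∫⁻ ξ : E d, lowWeight s ‖ξ‖ * a ξ ^ 2 :=
    Measurable.lintegral_prod_right' (f := fun q : ℝ × E d => lowWeight q.1 ‖q.2‖ * a q.2 ^ 2) hm2
  -- Schur's test: Cauchy–Schwarz uses that the weight has mass at most one in `s`. After exchanging
  -- the integrals and undoing the dilation, whose Jacobian is at most `2 ^ d`, the same mass bound
  -- is used again.
  have h1 : ∀ ξ : E d,
      (∫⁻ s in Icc (0 : ℝ) (1 / 2), lowWeight s ‖ξ‖ * a ((1 - s) • ξ)) ^ 2 ≤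
      ∫⁻ s in Icc (0 : ℝ) (1 / 2), lowWeight s ‖ξ‖ * a ((1 - s) • ξ) ^ 2 := fun ξ =>
    (sq_lintegral_mul_le (measurable_lowWeight_left ξ) (ha.comp (by fun_prop))).trans
      ((mul_le_mul_left (lintegral_lowWeight_le (norm_nonneg ξ)) _).trans (one_mul _).le)
  have h2 : ∀ ξ : E d, ∫⁻ s in Icc (0 : ℝ) (1 / 2), lowWeight s ‖ξ‖ * a ξ ^ 2 ≤ a ξ ^ 2 :=
      fun ξ => by
    rw [lintegral_mul_const _ (measurable_lowWeight_left ξ)]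
    exact (mul_le_mul_left (lintegral_lowWeight_le (norm_nonneg ξ)) _).trans (one_mul _).le
  calc ∫⁻ ξ : E d, (∫⁻ s in Icc (0 : ℝ) (1 / 2), lowWeight s ‖ξ‖ * a ((1 - s) • ξ)) ^ 2
      ≤ ∫⁻ ξ : E d, ∫⁻ s in Icc (0 : ℝ) (1 / 2), lowWeight s ‖ξ‖ * a ((1 - s) • ξ) ^ 2 :=
        lintegral_mono h1
    _ = ∫⁻ s in Icc (0 : ℝ) (1 / 2), ∫⁻ ξ : E d, lowWeight s ‖ξ‖ * a ((1 - s) • ξ) ^ 2 :=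
        lintegral_lintegral_swap (f := fun (ξ : E d) (s : ℝ) =>
          lowWeight s ‖ξ‖ * a ((1 - s) • ξ) ^ 2) hm.aemeasurable
    _ ≤ ∫⁻ s in Icc (0 : ℝ) (1 / 2), 2 ^ (d + 1) * ∫⁻ ξ : E d, lowWeight s ‖ξ‖ * a ξ ^ 2 :=
        setLIntegral_mono' measurableSet_Icc fun s hs => lintegral_lowWeight_mul_smul_le ha hs
    _ = 2 ^ (d + 1) * ∫⁻ ξ : E d, ∫⁻ s in Icc (0 : ℝ) (1 / 2), lowWeight s ‖ξ‖ * a ξ ^ 2 := by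
        rw [lintegral_const_mul _ hm3]
        congr 1
        exact lintegral_lintegral_swap (f := fun (s : ℝ) (ξ : E d) =>
          lowWeight s ‖ξ‖ * a ξ ^ 2) hm2.aemeasurable
    _ ≤ 2 ^ (d + 1) * ∫⁻ ξ, a ξ ^ 2 := mul_le_mul_right (lintegral_mono h2) _

/-- The large-time part of the Bogovskii estimate. -/
theorem exists_lintegral_sq_high_le (d : ℕ) : ∃ C : ℝ≥0∞, C ≠ ⊤ ∧ ∀ (a : E d → ℝ≥0∞) (A : ℝ≥0∞),
    (∀ ξ, a ξ ≤ A) → ∫⁻ ξ : E d, (∫⁻ s in Icc (1 / 2 : ℝ) 1,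
      ENNReal.ofReal ((1 + ‖ξ‖) / (1 + s * ‖ξ‖) ^ (d + 2)) * a ((1 - s) • ξ)) ^ 2 ≤ C * A ^ 2 := by
  have hfin := finite_integral_one_add_norm (E := E d) (μ := volume) (r := d + 1) (by simp)
  refine ⟨(2 ^ (d + 2)) ^ 2 * ∫⁻ x : E d, ENNReal.ofReal ((1 + ‖x‖) ^ (-((d : ℝ) + 1))),
    ENNReal.mul_ne_top (by finiteness) hfin.ne, fun a A hA => ?_⟩
  calc _ ≤ ∫⁻ ξ : E d, (2 ^ (d + 2)) ^ 2 *
        ENNReal.ofReal ((1 + ‖ξ‖) ^ (-((d : ℝ) + 1))) * A ^ 2 := by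
        refine lintegral_mono fun ξ => ?_
        have h1 : ∫⁻ s in Icc (1 / 2 : ℝ) 1,
            ENNReal.ofReal ((1 + ‖ξ‖) / (1 + s * ‖ξ‖) ^ (d + 2)) * a ((1 - s) • ξ) ≤
            ∫⁻ s in Icc (1 / 2 : ℝ) 1,
              2 ^ (d + 2) * ENNReal.ofReal (((1 + ‖ξ‖) ^ (d + 1))⁻¹) * A := by
          refine setLIntegral_mono' measurableSet_Icc fun s hs => ?_
          refine mul_le_mul' ?_ (hA _)
          have h2 : (1 + ‖ξ‖) / 2 ≤ 1 + s * ‖ξ‖ := by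
            nlinarith [norm_nonneg ξ, hs.1]
          have h3 : (2 : ℝ≥0∞) ^ (d + 2) = ENNReal.ofReal (2 ^ (d + 2)) := by
            rw [ENNReal.ofReal_pow (by norm_num)]; norm_num
          rw [h3, ← ENNReal.ofReal_mul (by positivity)]
          refine ENNReal.ofReal_le_ofReal ?_
          calc (1 + ‖ξ‖) / (1 + s * ‖ξ‖) ^ (d + 2) ≤ (1 + ‖ξ‖) / ((1 + ‖ξ‖) / 2) ^ (d + 2) := by
                gcongr
            _ = _ := by
                rw [div_pow]
                field_simp
                ring
        have h4 : ∫⁻ s in Icc (1 / 2 : ℝ) 1,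
              2 ^ (d + 2) * ENNReal.ofReal (((1 + ‖ξ‖) ^ (d + 1))⁻¹) * A ≤
              2 ^ (d + 2) * ENNReal.ofReal (((1 + ‖ξ‖) ^ (d + 1))⁻¹) * A := by
          rw [setLIntegral_const]
          refine mul_le_of_le_one_right' ?_
          rw [Real.volume_Icc, ← ENNReal.ofReal_one]
          exact ENNReal.ofReal_le_ofReal (by norm_num)
        refine (pow_le_pow_left' (h1.trans h4) 2).trans ?_
        rw [mul_pow, mul_pow]
        refine mul_le_mul_left (mul_le_mul_right ?_ _) _
        rw [← ENNReal.ofReal_pow (by positivity)]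
        refine ENNReal.ofReal_le_ofReal ?_
        have h5 : (1 : ℝ) ≤ 1 + ‖ξ‖ := by linarith [norm_nonneg ξ]
        have h6 : (1 + ‖ξ‖) ^ (-((d : ℝ) + 1)) = ((1 + ‖ξ‖) ^ (d + 1))⁻¹ := by
          rw [Real.rpow_neg (by positivity)]
          norm_cast
        -- One of the two factors `(1 + ‖ξ‖) ^ (-(d + 1))` is bounded by one; the other is
        -- integrable because `d + 1 > d`.
        rw [h6, sq]
        exact mul_le_of_le_one_left (by positivity) (inv_le_one_of_one_le₀ (one_le_pow₀ h5))
    _ = _ := by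
        rw [lintegral_mul_const _ (by fun_prop), lintegral_const_mul _ (by fun_prop)]

/-- The estimate behind the `H¹` bound of the Bogovskii field. -/
theorem exists_lintegral_sq_le (d : ℕ) : ∃ C : ℝ≥0∞, C ≠ ⊤ ∧ ∀ (a b : E d → ℝ≥0∞) (A M : ℝ≥0∞),
    Measurable a → (∀ ξ, a ξ ≤ A) → M ≠ ⊤ →
    (∀ ξ, b ξ ≤ M * ENNReal.ofReal (((1 + ‖ξ‖) ^ (d + 2))⁻¹)) →
    ∫⁻ ξ : E d, (ENNReal.ofReal (1 + ‖ξ‖) *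
      ∫⁻ s in Icc (0 : ℝ) 1, a ((1 - s) • ξ) * b (s • ξ)) ^ 2 ≤
      C * M ^ 2 * ((∫⁻ ξ, a ξ ^ 2) + A ^ 2) := by
  obtain ⟨C, hC, h⟩ := exists_lintegral_sq_high_le d
  refine ⟨2 * (2 ^ (d + 1) + C), by finiteness, fun a b A M ha hA hM hb => ?_⟩
  have hpos : ∀ {s : ℝ}, 0 ≤ s → ∀ ξ : E d, (1 : ℝ) ≤ 1 + s * ‖ξ‖ := fun hs ξ => by
    have := mul_nonneg hs (norm_nonneg ξ)
    linarith
  -- The decay of `b` is used with two exponents. For `s ≤ 1/2` the choice `k = 2` produces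
  -- `lowWeight`; for `s ≥ 1/2` the full power `d + 2` leaves enough decay in `ξ` after one power is
  -- spent on the factor `1 + ‖ξ‖`.
  have hb' : ∀ (k : ℕ), k ≤ d + 2 → ∀ ξ : E d, ∀ s : ℝ, 0 ≤ s →
      ENNReal.ofReal (1 + ‖ξ‖) * (a ((1 - s) • ξ) * b (s • ξ)) ≤
      M * (ENNReal.ofReal ((1 + ‖ξ‖) / (1 + s * ‖ξ‖) ^ k) * a ((1 - s) • ξ)) :=
      fun k hk ξ s hs => by
    calc ENNReal.ofReal (1 + ‖ξ‖) * (a ((1 - s) • ξ) * b (s • ξ))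
        ≤ ENNReal.ofReal (1 + ‖ξ‖) * (a ((1 - s) • ξ) *
            (M * ENNReal.ofReal (((1 + s * ‖ξ‖) ^ k)⁻¹))) := by
          refine mul_le_mul_right (mul_le_mul_right ((hb _).trans ?_) _) _
          rw [norm_smul, Real.norm_of_nonneg hs]
          refine mul_le_mul_right (ENNReal.ofReal_le_ofReal ?_) _
          have := hpos hs ξ
          gcongr
      _ = _ := by
          rw [div_eq_mul_inv, ENNReal.ofReal_mul (by positivity)]
          ring
  have hlow : Measurable fun q : E d × ℝ => lowWeight q.2 ‖q.1‖ * a ((1 - q.2) • q.1) := by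
    refine Measurable.mul ?_ (ha.comp (by fun_prop))
    unfold lowWeight
    fun_prop
  have h1 : ∀ ξ : E d, ENNReal.ofReal (1 + ‖ξ‖) *
      (∫⁻ s in Icc (0 : ℝ) 1, a ((1 - s) • ξ) * b (s • ξ)) ≤
      M * ((∫⁻ s in Icc (0 : ℝ) (1 / 2), lowWeight s ‖ξ‖ * a ((1 - s) • ξ)) +
      ∫⁻ s in Icc (1 / 2 : ℝ) 1,
        ENNReal.ofReal ((1 + ‖ξ‖) / (1 + s * ‖ξ‖) ^ (d + 2)) * a ((1 - s) • ξ)) := fun ξ => by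
    rw [← lintegral_const_mul' _ _ ENNReal.ofReal_ne_top, mul_add,
      ← lintegral_const_mul' _ _ hM, ← lintegral_const_mul' _ _ hM,
      show Icc (0 : ℝ) 1 = Icc 0 (1 / 2) ∪ Icc (1 / 2) 1 from
        (Icc_union_Icc_eq_Icc (by norm_num) (by norm_num)).symm]
    refine (lintegral_union_le _ _ _).trans (add_le_add ?_ ?_)
    · exact setLIntegral_mono' measurableSet_Icc fun s hs => hb' 2 (by omega) ξ s hs.1
    · exact setLIntegral_mono' measurableSet_Icc fun s hs =>
        hb' (d + 2) le_rfl ξ s (le_trans (by norm_num) hs.1)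
  calc _ ≤ ∫⁻ ξ : E d, M ^ 2 * (2 * (
        (∫⁻ s in Icc (0 : ℝ) (1 / 2), lowWeight s ‖ξ‖ * a ((1 - s) • ξ)) ^ 2 +
        (∫⁻ s in Icc (1 / 2 : ℝ) 1,
        ENNReal.ofReal ((1 + ‖ξ‖) / (1 + s * ‖ξ‖) ^ (d + 2)) * a ((1 - s) • ξ)) ^ 2)) := by
        refine lintegral_mono fun ξ => (pow_le_pow_left' (h1 ξ) 2).trans ?_
        rw [mul_pow]
        exact mul_le_mul_right (ennreal_add_sq_le _ _) _
    _ = M ^ 2 * (2 * ((∫⁻ ξ : E d,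
        (∫⁻ s in Icc (0 : ℝ) (1 / 2), lowWeight s ‖ξ‖ * a ((1 - s) • ξ)) ^ 2) +
        ∫⁻ ξ : E d, (∫⁻ s in Icc (1 / 2 : ℝ) 1,
        ENNReal.ofReal ((1 + ‖ξ‖) / (1 + s * ‖ξ‖) ^ (d + 2)) * a ((1 - s) • ξ)) ^ 2)) := by
        rw [lintegral_const_mul' _ _ (by finiteness), lintegral_const_mul' _ _ (by finiteness),
          lintegral_add_left]
        exact (Measurable.lintegral_prod_right' (f := fun q : E d × ℝ =>
          lowWeight q.2 ‖q.1‖ * a ((1 - q.2) • q.1)) hlow).pow_const 2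
    _ ≤ M ^ 2 * (2 * (2 ^ (d + 1) * (∫⁻ ξ, a ξ ^ 2) + C * A ^ 2)) :=
        mul_le_mul_right (mul_le_mul_right (add_le_add (lintegral_sq_lowWeight_le ha)
          (h a A hA)) _) _
    _ ≤ M ^ 2 * (2 * ((2 ^ (d + 1) + C) * ((∫⁻ ξ, a ξ ^ 2) + A ^ 2))) := by
        refine mul_le_mul_right (mul_le_mul_right ?_ _) _
        rw [mul_add]
        refine add_le_add ?_ ?_
        · exact mul_le_mul_left le_self_add _
        · exact mul_le_mul_left le_add_self _
    _ = _ := by ring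

/-! ### Fourier transform of test functions and of the Bogovskii field -/

/-- A test function as a complex Schwartz function. -/
noncomputable def IsTest.toSchwartz {f : E d → ℝ} (hf : IsTest f) : SchwartzMap (E d) ℂ :=
  HasCompactSupport.toSchwartzMap (f := fun x => (f x : ℂ))
    (hf.compact.comp_left (g := fun t : ℝ => (t : ℂ)) Complex.ofReal_zero)
    (Complex.ofRealCLM.contDiff.comp hf.smooth)

/-- The Fourier transform of a real function. -/
noncomputable def realFourier (f : E d → ℝ) : E d → ℂ := 𝓕 fun x => (f x : ℂ)

theorem IsTest.fourier_toSchwartz {f : E d → ℝ} (hf : IsTest f) (ξ : E d) :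
    𝓕 hf.toSchwartz ξ = realFourier f ξ := rfl

theorem IsTest.continuous_realFourier {f : E d → ℝ} (hf : IsTest f) :
    Continuous (realFourier f) :=
  (𝓕 hf.toSchwartz).continuous

/-- Plancherel, restated with lower integrals so that the estimates above apply without
integrability side conditions. -/
theorem IsTest.lintegral_realFourier_sq {f : E d → ℝ} (hf : IsTest f) :
    ∫⁻ ξ, ‖realFourier f ξ‖ₑ ^ 2 = ∫⁻ x, ‖f x‖ₑ ^ 2 := by
  have key : ∀ g : SchwartzMap (E d) ℂ,
      ∫⁻ x, ‖g x‖ₑ ^ 2 = ENNReal.ofReal (∫ x, ‖g x‖ ^ 2) := fun g => by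
    rw [ofReal_integral_eq_lintegral_ofReal]
    · refine lintegral_congr fun x => ?_
      rw [ENNReal.ofReal_pow (norm_nonneg _), ofReal_norm]
    · exact (g.memLp 2).integrable_norm_pow (by norm_num)
    · exact Eventually.of_forall fun x => by positivity
  have h := key (𝓕 hf.toSchwartz)
  rw [SchwartzMap.integral_norm_sq_fourier, ← key] at h
  refine h.trans (lintegral_congr fun x => ?_)
  change ‖((f x : ℝ) : ℂ)‖ₑ ^ 2 = _
  rw [← ofReal_norm, ← ofReal_norm, Complex.norm_real]

theorem IsTest.fderiv_apply {f : E d → ℝ} (hf : IsTest f) (v : E d) :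
    IsTest fun x => fderiv ℝ f x v := by
  refine ⟨(hf.smooth.fderiv_right (m := ∞) (by simp)).clm_apply contDiff_const, ?_⟩
  exact (hf.compact.fderiv (𝕜 := ℝ)).comp_left (g := fun L : E d →L[ℝ] ℝ => L v) rfl

theorem IsTest.realFourier_fderiv {f : E d → ℝ} (hf : IsTest f) (v ξ : E d) :
    realFourier (fun x => fderiv ℝ f x v) ξ =
      (2 * Real.pi * Complex.I) * (⟪ξ, v⟫ : ℝ) * realFourier f ξ := by
  have h := congrArg (fun g : SchwartzMap (E d) ℂ => g ξ)
    (SchwartzMap.fourier_lineDerivOp_eq hf.toSchwartz v)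
  have ht : (fun x : E d => inner ℝ x v).HasTemperateGrowth :=
    ((innerSL ℝ).flip v).hasTemperateGrowth
  simp only [smul_apply, SchwartzMap.smulLeftCLM_apply_apply ht] at h
  rw [hf.fourier_toSchwartz] at h
  rw [mul_assoc, ← smul_eq_mul, ← Complex.real_smul, ← h]
  have e : (fun x => ((fderiv ℝ f x v : ℝ) : ℂ)) =
      fun x => (LineDeriv.lineDerivOp v hf.toSchwartz : SchwartzMap (E d) ℂ) x := by
    ext1 x
    rw [SchwartzMap.lineDerivOp_apply_eq_fderiv]
    have h1 := (Complex.ofRealCLM.hasFDerivAt).comp x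
      (hf.smooth.differentiable (by simp) x).hasFDerivAt
    have h2 : fderiv ℝ (hf.toSchwartz) x = _ := h1.fderiv
    rw [h2]
    rfl
  rw [realFourier, e]
  rfl

theorem IsTest.lintegral_fderiv_sq_le {f : E d → ℝ} (hf : IsTest f) (v : E d) :
    ∫⁻ x, ‖fderiv ℝ f x v‖ₑ ^ 2 ≤ ENNReal.ofReal (2 * Real.pi * ‖v‖) ^ 2 *
      ∫⁻ ξ : E d, (ENNReal.ofReal (1 + ‖ξ‖) * ‖realFourier f ξ‖ₑ) ^ 2 := by
  rw [← (hf.fderiv_apply v).lintegral_realFourier_sq, ← lintegral_const_mul' _ _ (by finiteness)]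
  refine lintegral_mono fun ξ => ?_
  rw [hf.realFourier_fderiv, ← mul_pow, enorm_mul, ← mul_assoc]
  refine pow_le_pow_left' (mul_le_mul_left ?_ _) 2
  rw [← ofReal_norm, ← ENNReal.ofReal_mul (by positivity)]
  refine ENNReal.ofReal_le_ofReal ?_
  have h1 : |⟪ξ, v⟫| ≤ ‖ξ‖ * ‖v‖ := abs_real_inner_le_norm ξ v
  have h2 : ‖(2 * Real.pi * Complex.I) * (⟪ξ, v⟫ : ℝ)‖ = 2 * Real.pi * |⟪ξ, v⟫| := by
    simp [abs_of_pos Real.pi_pos]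
  have h3 : |⟪ξ, v⟫| ≤ ‖v‖ * (1 + ‖ξ‖) := by nlinarith [norm_nonneg v]
  rw [h2, mul_assoc (2 * Real.pi)]
  exact mul_le_mul_of_nonneg_left h3 (by positivity)

theorem IsTest.lintegral_sq_le {f : E d → ℝ} (hf : IsTest f) :
    ∫⁻ x, ‖f x‖ₑ ^ 2 ≤ ∫⁻ ξ : E d, (ENNReal.ofReal (1 + ‖ξ‖) * ‖realFourier f ξ‖ₑ) ^ 2 := by
  rw [← hf.lintegral_realFourier_sq]
  refine lintegral_mono fun ξ => pow_le_pow_left' (le_mul_of_one_le_left' ?_) 2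
  rw [← ENNReal.ofReal_one]
  exact ENNReal.ofReal_le_ofReal (by linarith [norm_nonneg ξ])

theorem enorm_realFourier_le (f : E d → ℝ) (ξ : E d) :
    ‖realFourier f ξ‖ₑ ≤ ∫⁻ x, ‖f x‖ₑ := by
  rw [realFourier, Real.fourier_eq]
  refine (enorm_integral_le_lintegral_enorm _).trans (lintegral_mono fun x => le_of_eq ?_)
  rw [← ofReal_norm, ← ofReal_norm, Circle.norm_smul, Complex.norm_real]

/-- Cauchy–Schwarz against the indicator of `K`. It bounds the supremum of the Fourier transform by
the `L²` norm when the support is bounded. -/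
theorem sq_lintegral_enorm_le {f : E d → ℝ} (hf : Measurable f) {K : Set (E d)}
    (hK : MeasurableSet K) (h : ∀ x ∉ K, f x = 0) :
    (∫⁻ x, ‖f x‖ₑ) ^ 2 ≤ volume K * ∫⁻ x, ‖f x‖ₑ ^ 2 := by
  have h1 := sq_lintegral_mul_le (μ := (volume : Measure (E d))) (k := K.indicator fun _ => 1)
    (a := fun x => ‖f x‖ₑ) (measurable_const.indicator hK) (by fun_prop)
  rw [lintegral_indicator_const hK, one_mul] at h1
  have e : ∀ x, K.indicator (fun _ => (1 : ℝ≥0∞)) x * ‖f x‖ₑ = ‖f x‖ₑ := fun x => by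
    by_cases hx : x ∈ K <;> simp [hx, h]
  simp only [e] at h1
  refine h1.trans (mul_le_mul_right (lintegral_mono fun x => ?_) _)
  by_cases hx : x ∈ K <;> simp [hx]

theorem IsTest.exists_enorm_realFourier_le {f : E d → ℝ} (hf : IsTest f) : ∃ M : ℝ≥0∞, M ≠ ⊤ ∧
    ∀ ξ, ‖realFourier f ξ‖ₑ ≤ M * ENNReal.ofReal (((1 + ‖ξ‖) ^ (d + 2))⁻¹) := by
  obtain ⟨C, hC⟩ : ∃ C : ℝ, ∀ ξ, (1 + ‖ξ‖) ^ (d + 2) * ‖realFourier f ξ‖ ≤ C := by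
    refine ⟨2 ^ (d + 2) * (Finset.Iic (d + 2, 0)).sup
      (fun m => SchwartzMap.seminorm ℝ m.1 m.2) (𝓕 hf.toSchwartz), fun ξ => ?_⟩
    have h := SchwartzMap.one_add_le_sup_seminorm_apply (𝕜 := ℝ) (m := (d + 2, 0)) le_rfl le_rfl
      (𝓕 hf.toSchwartz) ξ
    rw [norm_iteratedFDeriv_zero] at h
    exact h
  refine ⟨ENNReal.ofReal C, ENNReal.ofReal_ne_top, fun ξ => ?_⟩
  rw [← ofReal_norm, ← ENNReal.ofReal_mul' (by positivity)]
  refine ENNReal.ofReal_le_ofReal ?_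
  rw [← div_eq_mul_inv, le_div_iff₀ (by positivity), mul_comm]
  exact hC ξ

theorem IsTest.coord_mul {f : E d → ℝ} (hf : IsTest f) (j : Fin d) :
    IsTest fun x => x j * f x :=
  ⟨ContDiff.mul (by fun_prop) hf.smooth, hf.compact.mul_left⟩

theorem IsTest.bogovskii_apply {f θ : E d → ℝ} (hf : IsTest f) (hθ : IsTest θ) (j : Fin d) :
    IsTest fun x => bogovskii f θ x j := by
  refine ⟨?_, (hasCompactSupport_bogovskii hf.compact hθ.compact).comp_left
    (g := fun v : E d => v j) rfl⟩
  have := contDiff_bogovskii hf hθ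
  fun_prop

theorem integral_fourierKernel (f g : E d → ℝ) (s : ℝ) (y ξ : E d) :
    ∫ z, (𝐞 (-⟪(1 - s) • y + s • z, ξ⟫) : ℂ) * ((f y : ℂ) * (g z : ℂ)) =
      (𝐞 (-⟪y, (1 - s) • ξ⟫) • (f y : ℂ)) * realFourier g (s • ξ) := by
  rw [realFourier, Real.fourier_eq, ← integral_const_mul]
  congr 1
  ext1 z
  rw [inner_add_left, neg_add, AddChar.map_add_eq_mul, Circle.coe_mul, Circle.smul_def,
    Circle.smul_def, smul_eq_mul, smul_eq_mul, inner_smul_left, inner_smul_left, inner_smul_right,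
    inner_smul_right]
  simp only [conj_trivial]
  ring

theorem continuous_fourierChar_inner {X : Type*} [TopologicalSpace X] {v : X → E d}
    (hv : Continuous v) (ξ : E d) : Continuous fun x => (𝐞 (-⟪v x, ξ⟫) : ℂ) :=
  continuous_subtype_val.comp (Real.continuous_fourierChar.comp (by fun_prop))

theorem IsTest.integrable_fourierChar_smul {f : E d → ℝ} (hf : IsTest f) (ξ : E d) :
    Integrable fun y => 𝐞 (-⟪y, ξ⟫) • (f y : ℂ) := by
  have h1 := continuous_fourierChar_inner (continuous_id (X := E d)) ξ
  have h2 := hf.smooth.continuous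
  refine Continuous.integrable_of_hasCompactSupport ?_ ?_
  · simp only [Circle.smul_def, smul_eq_mul]
    exact h1.mul (Complex.continuous_ofReal.comp h2)
  · refine hf.compact.mono fun y hy h => hy ?_
    simp [h]

theorem IsTest.integrable_fourierKernel {g : E d → ℝ} (hg : IsTest g) (c : ℂ) (s : ℝ)
    (y ξ : E d) :
    Integrable fun z => (𝐞 (-⟪(1 - s) • y + s • z, ξ⟫) : ℂ) * (c * (g z : ℂ)) := by
  have h1 := continuous_fourierChar_inner (v := fun z : E d => (1 - s) • y + s • z)
    (by fun_prop) ξ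
  have h2 := hg.smooth.continuous
  refine Continuous.integrable_of_hasCompactSupport ?_ ?_
  · exact h1.mul (continuous_const.mul (Complex.continuous_ofReal.comp h2))
  · refine hg.compact.mono fun y hy h => hy ?_
    simp [h]

/-- Integrating the field against the character gives a phase at `(1 - s) • y + s • z`, which
factors into a phase in `y` and one in `z`. Splitting the coordinate `z j - y j` then yields two
products of Fourier transforms. -/
theorem realFourier_bogovskii {f θ : E d → ℝ} (hf : IsTest f) (hθ : IsTest θ) (j : Fin d)
    (ξ : E d) : realFourier (fun x => bogovskii f θ x j) ξ = ∫ s in Icc (0 : ℝ) 1,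
      (realFourier f ((1 - s) • ξ) * realFourier (fun z => z j * θ z) (s • ξ) -
        realFourier (fun y => y j * f y) ((1 - s) • ξ) * realFourier θ (s • ξ)) := by
  have hφ : Continuous fun x : E d => (𝐞 (-⟪x, ξ⟫) : ℂ) •
      (Complex.ofRealCLM ∘L (EuclideanSpace.proj j : E d →L[ℝ] ℝ)) :=
    (continuous_fourierChar_inner continuous_id ξ).smul continuous_const
  have h := integral_apply_bogovskii hf hθ hφ
  have hl : realFourier (fun x => bogovskii f θ x j) ξ = ∫ x, ((𝐞 (-⟪x, ξ⟫) : ℂ) •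
      (Complex.ofRealCLM ∘L (EuclideanSpace.proj j : E d →L[ℝ] ℝ))) (bogovskii f θ x) := by
    rw [realFourier, Real.fourier_eq]
    rfl
  rw [hl, h]
  refine setIntegral_congr_fun measurableSet_Icc fun s _ => ?_
  have e : ∀ y z : E d, (f y * θ z) • ((𝐞 (-⟪(1 - s) • y + s • z, ξ⟫) : ℂ) •
      (Complex.ofRealCLM ∘L (EuclideanSpace.proj j : E d →L[ℝ] ℝ))) (z - y) =
      (𝐞 (-⟪(1 - s) • y + s • z, ξ⟫) : ℂ) * ((f y : ℂ) * ((z j * θ z : ℝ) : ℂ)) -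
      (𝐞 (-⟪(1 - s) • y + s • z, ξ⟫) : ℂ) * (((y j * f y : ℝ) : ℂ) * (θ z : ℂ)) :=
      fun y z => by
    change (f y * θ z) • ((𝐞 (-⟪(1 - s) • y + s • z, ξ⟫) : ℂ) • ((z j - y j : ℝ) : ℂ)) = _
    rw [Complex.real_smul, smul_eq_mul]
    push_cast
    ring
  simp only [e]
  have e2 : ∀ y : E d,
      ∫ z, ((𝐞 (-⟪(1 - s) • y + s • z, ξ⟫) : ℂ) * ((f y : ℂ) * ((z j * θ z : ℝ) : ℂ)) -
      (𝐞 (-⟪(1 - s) • y + s • z, ξ⟫) : ℂ) * (((y j * f y : ℝ) : ℂ) * (θ z : ℂ))) =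
      (𝐞 (-⟪y, (1 - s) • ξ⟫) • (f y : ℂ)) * realFourier (fun z => z j * θ z) (s • ξ) -
      (𝐞 (-⟪y, (1 - s) • ξ⟫) • ((y j * f y : ℝ) : ℂ)) * realFourier θ (s • ξ) := fun y => by
    rw [integral_sub ((hθ.coord_mul j).integrable_fourierKernel _ s y ξ)
      (hθ.integrable_fourierKernel _ s y ξ)]
    congr 1
    · exact integral_fourierKernel f (fun z => z j * θ z) s y ξ
    · exact integral_fourierKernel (fun y => y j * f y) θ s y ξ
  simp only [e2]
  rw [integral_sub ((hf.integrable_fourierChar_smul _).mul_const _)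
    (((hf.coord_mul j).integrable_fourierChar_smul _).mul_const _), integral_mul_const,
    integral_mul_const]
  rfl

theorem enorm_realFourier_bogovskii_le {f θ : E d → ℝ} (hf : IsTest f) (hθ : IsTest θ)
    (j : Fin d) (ξ : E d) : ‖realFourier (fun x => bogovskii f θ x j) ξ‖ₑ ≤
      (∫⁻ s in Icc (0 : ℝ) 1, ‖realFourier f ((1 - s) • ξ)‖ₑ *
        ‖realFourier (fun z => z j * θ z) (s • ξ)‖ₑ) +
      ∫⁻ s in Icc (0 : ℝ) 1, ‖realFourier (fun y => y j * f y) ((1 - s) • ξ)‖ₑ *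
        ‖realFourier θ (s • ξ)‖ₑ := by
  rw [realFourier_bogovskii hf hθ]
  refine (enorm_integral_le_lintegral_enorm _).trans ?_
  have h1 := hf.continuous_realFourier
  have h2 := (hθ.coord_mul j).continuous_realFourier
  have h3 : Measurable fun s : ℝ => ‖realFourier f ((1 - s) • ξ)‖ₑ :=
    ((h1.comp (by fun_prop)).enorm).measurable
  have h4 : Measurable fun s : ℝ => ‖realFourier (fun z => z j * θ z) (s • ξ)‖ₑ :=
    ((h2.comp (by fun_prop)).enorm).measurable
  have h5 : Measurable fun s : ℝ => ‖realFourier f ((1 - s) • ξ)‖ₑ *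
      ‖realFourier (fun z => z j * θ z) (s • ξ)‖ₑ := h3.mul h4
  rw [← lintegral_add_left h5]
  refine lintegral_mono fun s => (enorm_sub_le).trans ?_
  rw [enorm_mul, enorm_mul]

/-- The `H¹` bound of the Bogovskii field on the Fourier side. -/
theorem exists_lintegral_realFourier_bogovskii_le {θ : E d → ℝ} (hθ : IsTest θ) (R : ℝ) :
    ∃ C : ℝ≥0∞, C ≠ ⊤ ∧ ∀ (f : E d → ℝ), IsTest f → tsupport f ⊆ Metric.closedBall 0 R → ∀ j,
      ∫⁻ ξ : E d, (ENNReal.ofReal (1 + ‖ξ‖) *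
        ‖realFourier (fun x => bogovskii f θ x j) ξ‖ₑ) ^ 2 ≤ C * ∫⁻ x, ‖f x‖ₑ ^ 2 := by
  obtain ⟨C, hC, h⟩ := exists_lintegral_sq_le d
  choose M hM hMb using fun j => (hθ.coord_mul j).exists_enorm_realFourier_le
  obtain ⟨N, hN, hNb⟩ := hθ.exists_enorm_realFourier_le
  set V : ℝ≥0∞ := volume (Metric.closedBall (0 : E d) R) with hV
  have hVt : V ≠ ⊤ := measure_closedBall_lt_top.ne
  -- The bound obtained depends on the component; summing over components gives one constant for
  -- all.
  refine ⟨∑ j, 2 * (C * M j ^ 2 * (1 + V) + C * N ^ 2 * ((1 + V) * ENNReal.ofReal R ^ 2)),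
    ENNReal.sum_ne_top.2 fun j _ => by have := hM j; finiteness, fun f hf hfR j => ?_⟩
  set I : ℝ≥0∞ := ∫⁻ x, ‖f x‖ₑ ^ 2 with hI
  have hzero : ∀ x ∉ Metric.closedBall (0 : E d) R, f x = 0 := fun x hx =>
    image_eq_zero_of_notMem_tsupport fun h => hx (hfR h)
  have hA : (∫⁻ x, ‖f x‖ₑ) ^ 2 ≤ V * I :=
    sq_lintegral_enorm_le hf.smooth.continuous.measurable Metric.isClosed_closedBall.measurableSet
      hzero
  have hJ : ∫⁻ x, ‖x j * f x‖ₑ ^ 2 ≤ ENNReal.ofReal R ^ 2 * I := by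
    rw [hI, ← lintegral_const_mul' _ _ (by finiteness)]
    refine lintegral_mono fun x => ?_
    rw [← mul_pow]
    by_cases hx : x ∈ Metric.closedBall (0 : E d) R
    · rw [enorm_mul]
      refine pow_le_pow_left' (mul_le_mul_left ?_ _) 2
      rw [← ofReal_norm]
      refine ENNReal.ofReal_le_ofReal ((PiLp.norm_apply_le x j).trans ?_)
      simpa using hx
    · simp [hzero x hx]
  have hB : (∫⁻ x, ‖x j * f x‖ₑ) ^ 2 ≤ V * (ENNReal.ofReal R ^ 2 * I) :=
    (sq_lintegral_enorm_le (hf.coord_mul j).smooth.continuous.measurable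
      Metric.isClosed_closedBall.measurableSet fun x hx => by rw [hzero x hx, mul_zero]).trans
      (mul_le_mul_right hJ _)
  have h1 := h (fun ξ => ‖realFourier f ξ‖ₑ) (fun ξ => ‖realFourier (fun z => z j * θ z) ξ‖ₑ) _ _
    hf.continuous_realFourier.enorm.measurable (enorm_realFourier_le f) (hM j) (hMb j)
  have h2 := h (fun ξ => ‖realFourier (fun y => y j * f y) ξ‖ₑ) (fun ξ => ‖realFourier θ ξ‖ₑ) _ _
    (hf.coord_mul j).continuous_realFourier.enorm.measurable
    (enorm_realFourier_le fun y => y j * f y) hN hNb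
  rw [hf.lintegral_realFourier_sq] at h1
  rw [(hf.coord_mul j).lintegral_realFourier_sq] at h2
  have hmeas : ∀ {a b : E d → ℂ}, Continuous a → Continuous b →
      Measurable fun q : E d × ℝ => ‖a ((1 - q.2) • q.1)‖ₑ * ‖b (q.2 • q.1)‖ₑ := fun ha hb =>
    (((ha.comp (by fun_prop)).enorm).measurable).mul (((hb.comp (by fun_prop)).enorm).measurable)
  have hm1 := hmeas hf.continuous_realFourier (hθ.coord_mul j).continuous_realFourier
  have hpt := enorm_realFourier_bogovskii_le hf hθ j
  calc _ ≤ ∫⁻ ξ : E d, 2 * ((ENNReal.ofReal (1 + ‖ξ‖) *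
        ∫⁻ s in Icc (0 : ℝ) 1, ‖realFourier f ((1 - s) • ξ)‖ₑ *
          ‖realFourier (fun z => z j * θ z) (s • ξ)‖ₑ) ^ 2 +
        (ENNReal.ofReal (1 + ‖ξ‖) *
        ∫⁻ s in Icc (0 : ℝ) 1, ‖realFourier (fun y => y j * f y) ((1 - s) • ξ)‖ₑ *
          ‖realFourier θ (s • ξ)‖ₑ) ^ 2) := by
        refine lintegral_mono fun ξ =>
          (pow_le_pow_left' (mul_le_mul_right (hpt ξ) _) 2).trans ?_
        rw [mul_add]
        exact ennreal_add_sq_le _ _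
    _ = 2 * ((∫⁻ ξ : E d, (ENNReal.ofReal (1 + ‖ξ‖) *
        ∫⁻ s in Icc (0 : ℝ) 1, ‖realFourier f ((1 - s) • ξ)‖ₑ *
          ‖realFourier (fun z => z j * θ z) (s • ξ)‖ₑ) ^ 2) +
        ∫⁻ ξ : E d, (ENNReal.ofReal (1 + ‖ξ‖) *
        ∫⁻ s in Icc (0 : ℝ) 1, ‖realFourier (fun y => y j * f y) ((1 - s) • ξ)‖ₑ *
          ‖realFourier θ (s • ξ)‖ₑ) ^ 2) := by
        rw [lintegral_const_mul' _ _ (by finiteness), lintegral_add_left]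
        have := Measurable.lintegral_prod_right' (ν := volume.restrict (Icc (0 : ℝ) 1)) hm1
        exact Measurable.pow_const (Measurable.mul (by fun_prop) this) 2
    _ ≤ 2 * (C * M j ^ 2 * (I + V * I) +
        C * N ^ 2 * (ENNReal.ofReal R ^ 2 * I + V * (ENNReal.ofReal R ^ 2 * I))) := by
        refine mul_le_mul_right (add_le_add (h1.trans ?_) (h2.trans ?_)) _
        · exact mul_le_mul_right (add_le_add_right hA _) _
        · exact mul_le_mul_right (add_le_add hJ hB) _
    _ = (2 * (C * M j ^ 2 * (1 + V) + C * N ^ 2 * ((1 + V) * ENNReal.ofReal R ^ 2))) * I := by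
        ring
    _ ≤ _ := mul_le_mul_left (Finset.single_le_sum (f := fun j =>
        2 * (C * M j ^ 2 * (1 + V) + C * N ^ 2 * ((1 + V) * ENNReal.ofReal R ^ 2)))
        (fun _ _ => zero_le) (Finset.mem_univ j)) _

/-- The `H¹` bound of the Bogovskii field. -/
theorem exists_lintegral_bogovskii_le {θ : E d → ℝ} (hθ : IsTest θ) (R : ℝ) :
    ∃ C : ℝ≥0∞, C ≠ ⊤ ∧ ∀ (f : E d → ℝ), IsTest f → tsupport f ⊆ Metric.closedBall 0 R → ∀ j,
      ∫⁻ x, ‖bogovskii f θ x j‖ₑ ^ 2 ≤ C * ∫⁻ x, ‖f x‖ₑ ^ 2 ∧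
      ∀ v, ∫⁻ x, ‖fderiv ℝ (fun x => bogovskii f θ x j) x v‖ₑ ^ 2 ≤
        ENNReal.ofReal (2 * Real.pi * ‖v‖) ^ 2 * (C * ∫⁻ x, ‖f x‖ₑ ^ 2) := by
  obtain ⟨C, hC, h⟩ := exists_lintegral_realFourier_bogovskii_le hθ R
  refine ⟨C, hC, fun f hf hR j => ?_⟩
  have ht := hf.bogovskii_apply hθ j
  exact ⟨ht.lintegral_sq_le.trans (h f hf hR j), fun v =>
    (ht.lintegral_fderiv_sq_le v).trans (mul_le_mul_right (h f hf hR j) _)⟩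

/-! ### The space `H¹(Ω)`: completeness and test functions as elements -/

theorem inner_gradient_eq (φ : E d → ℝ) (x v : E d) : ⟪v, gradient φ x⟫ = fderiv ℝ φ x v := by
  rw [real_inner_comm]
  exact InnerProductSpace.toDual_symm_apply

theorem gradient_apply (φ : E d → ℝ) (x : E d) (i : Fin d) :
    gradient φ x i = fderiv ℝ φ x (EuclideanSpace.single i 1) := by
  rw [← inner_gradient_eq, EuclideanSpace.inner_single_left]
  simp

theorem IsTest.memLp {φ : E d → ℝ} (hφ : IsTest φ) (Ω : Set (E d)) : MemLp φ 2 (vol Ω) :=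
  memLp_test hφ.smooth hφ.compact

theorem IsTest.memLp_gradient {φ : E d → ℝ} (hφ : IsTest φ) (Ω : Set (E d)) :
    MemLp (gradient φ) 2 (vol Ω) :=
  memLp_gradient_test hφ.smooth hφ.compact

theorem IsTest.memLp_smul_const {φ : E d → ℝ} (hφ : IsTest φ) (Ω : Set (E d)) (v : E d) :
    MemLp (fun x => φ x • v) 2 (vol Ω) :=
  ((hφ.smooth.continuous.smul continuous_const).memLp_of_hasCompactSupport
    (hφ.compact.smul_right)).restrict Ω

theorem isWeakGradient_iff {Ω : Set (E d)} {u : L2 Ω} {G : L2Vec Ω} :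
    IsWeakGradient Ω u G ↔ ∀ φ : E d → ℝ, IsTest φ → tsupport φ ⊆ Ω → ∀ v : E d,
      ∫ x in Ω, u x * fderiv ℝ φ x v = -∫ x in Ω, φ x * ⟪v, G x⟫ := by
  have key : ∀ φ : E d → ℝ, IsTest φ → ((∫ x in Ω, u x • gradient φ x = -∫ x in Ω, φ x • G x) ↔
      ∀ v : E d, ∫ x in Ω, u x * fderiv ℝ φ x v = -∫ x in Ω, φ x * ⟪v, G x⟫) := fun φ hφ => by
    have i1 : Integrable (fun x => u x • gradient φ x) (vol Ω) :=
      memLp_one_iff_integrable.1 ((hφ.memLp_gradient Ω).smul (Lp.memLp u))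
    have i2 : Integrable (fun x => φ x • G x) (vol Ω) :=
      memLp_one_iff_integrable.1 ((Lp.memLp G).smul (hφ.memLp Ω))
    have e1 : ∀ v, ⟪v, ∫ x in Ω, u x • gradient φ x⟫ = ∫ x in Ω, u x * fderiv ℝ φ x v := fun v => by
      rw [← integral_inner i1]
      simp only [inner_smul_right, inner_gradient_eq]
    have e2 : ∀ v, ⟪v, ∫ x in Ω, φ x • G x⟫ = ∫ x in Ω, φ x * ⟪v, G x⟫ := fun v => by
      rw [← integral_inner i2]
      simp only [inner_smul_right]
    constructor
    · intro h v
      rw [← e1, h, inner_neg_right, e2]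
    · intro h
      refine ext_inner_left ℝ fun v => ?_
      rw [e1, inner_neg_right, e2, h v]
  exact ⟨fun h φ hφ hs => (key φ hφ).1 (h φ hφ.smooth hφ.compact hs),
    fun h φ h1 h2 hs => (key φ ⟨h1, h2⟩).2 (h φ ⟨h1, h2⟩ hs)⟩

/-- Tested against a fixed direction `v`, the definition of the weak gradient equates two inner
products in `L²`. Each such condition is closed, and `H1 Ω` is their intersection. -/
theorem isClosed_H1 (Ω : Set (E d)) :
    IsClosed (H1 Ω : Set (WithLp 2 (L2 Ω × L2Vec Ω))) := by
  have h : (H1 Ω : Set (WithLp 2 (L2 Ω × L2Vec Ω))) = ⋂ (φ : E d → ℝ) (hφ : IsTest φ)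
      (_ : tsupport φ ⊆ Ω) (v : E d), {w |
        ⟪((hφ.fderiv_apply v).memLp Ω).toLp _, w.fst⟫ =
        -⟪(hφ.memLp_smul_const Ω v).toLp _, w.snd⟫} := by
    ext w
    simp only [mem_iInter, mem_ofPred_eq, SetLike.mem_coe]
    change IsWeakGradient Ω w.fst w.snd ↔ _
    rw [isWeakGradient_iff]
    refine forall_congr' fun φ => forall_congr' fun hφ => forall_congr' fun hs =>
      forall_congr' fun v => ?_
    rw [L2.inner_def, L2.inner_def]
    refine Eq.congr (integral_congr_ae ?_) (congrArg _ (integral_congr_ae ?_))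
    · filter_upwards [((hφ.fderiv_apply v).memLp Ω).coeFn_toLp] with x hx
      rw [hx]
      rfl
    · filter_upwards [(hφ.memLp_smul_const Ω v).coeFn_toLp] with x hx
      rw [hx]
      simp [inner_smul_left]
  rw [h]
  refine isClosed_iInter fun φ => isClosed_iInter fun hφ => isClosed_iInter fun _ =>
    isClosed_iInter fun v => isClosed_eq ?_ ?_
  · exact continuous_const.inner (WithLp.fstL 2 ℝ (L2 Ω) (L2Vec Ω)).continuous
  · exact (continuous_const.inner (WithLp.sndL 2 ℝ (L2 Ω) (L2Vec Ω)).continuous).neg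

instance completeSpace_H1 (Ω : Set (E d)) : CompleteSpace (H1 Ω) :=
  (isClosed_H1 Ω).completeSpace_coe

/-- The integral of a directional derivative of a compactly supported function vanishes. -/
theorem integral_fderiv_apply_eq_zero {f : E d → ℝ} (hf : ContDiff ℝ 1 f)
    (hc : HasCompactSupport f) (v : E d) : ∫ x, fderiv ℝ f x v = 0 := by
  have h1 : Continuous fun x => fderiv ℝ f x v :=
    (hf.continuous_fderiv one_ne_zero).clm_apply continuous_const
  have h2 : HasCompactSupport fun x => fderiv ℝ f x v :=
    (hc.fderiv (𝕜 := ℝ)).comp_left (g := fun L : E d →L[ℝ] ℝ => L v) rfl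
  have h := integral_mul_fderiv_eq_neg_fderiv_mul_of_integrable (μ := (volume : Measure (E d)))
    (f := fun _ : E d => (1 : ℝ)) (g := f) (v := v) (by simp)
    (by simpa using h1.integrable_of_hasCompactSupport h2)
    (by simpa using hf.continuous.integrable_of_hasCompactSupport hc)
    (by simp) (fun x _ => hf.differentiable one_ne_zero x)
  simpa using h

theorem IsTest.mul {f g : E d → ℝ} (hf : IsTest f) (hg : ContDiff ℝ ∞ g) :
    IsTest fun x => f x * g x :=
  ⟨hf.smooth.mul hg, hf.compact.mul_right⟩

theorem fderiv_mul_apply {f g : E d → ℝ} (hf : ContDiff ℝ ∞ f) (hg : ContDiff ℝ ∞ g)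
    (x v : E d) : fderiv ℝ (fun x => f x * g x) x v =
      f x * fderiv ℝ g x v + g x * fderiv ℝ f x v := by
  rw [fderiv_fun_mul (hf.differentiable (by simp) x) (hg.differentiable (by simp) x)]
  rfl

theorem setIntegral_eq_integral_of_tsupport_subset {Ω : Set (E d)} {φ g : E d → ℝ}
    (hs : tsupport φ ⊆ Ω) (h : ∀ x, φ x = 0 → x ∉ tsupport φ → g x = 0) :
    ∫ x in Ω, g x = ∫ x, g x :=
  setIntegral_eq_integral_of_forall_compl_eq_zero fun x hx =>
    h x (image_eq_zero_of_notMem_tsupport fun h => hx (hs h)) fun h => hx (hs h)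

theorem fderiv_eq_zero_of_notMem_tsupport {φ : E d → ℝ} {x : E d} (hx : x ∉ tsupport φ) :
    fderiv ℝ φ x = 0 := by
  by_contra h
  exact hx (tsupport_fderiv_subset ℝ (subset_tsupport _ h))

/-- Integration by parts: the product of the two test functions has compact support, so the integral
of its derivative is zero. -/
theorem isWeakGradient_toLp {φ : E d → ℝ} (hφ : IsTest φ) (Ω : Set (E d)) :
    IsWeakGradient Ω ((hφ.memLp Ω).toLp φ) ((hφ.memLp_gradient Ω).toLp _) := by
  rw [isWeakGradient_iff]
  intro η hη hs v
  have e1 : ∫ x in Ω, (hφ.memLp Ω).toLp φ x * fderiv ℝ η x v = ∫ x, φ x * fderiv ℝ η x v := by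
    rw [← setIntegral_eq_integral_of_tsupport_subset hs]
    · refine integral_congr_ae ?_
      filter_upwards [(hφ.memLp Ω).coeFn_toLp] with x hx
      rw [hx]
    · intro x _ hx
      simp [fderiv_eq_zero_of_notMem_tsupport hx]
  have e2 : ∫ x in Ω, η x * ⟪v, (hφ.memLp_gradient Ω).toLp (gradient φ) x⟫ =
      ∫ x, η x * fderiv ℝ φ x v := by
    rw [← setIntegral_eq_integral_of_tsupport_subset hs]
    · refine integral_congr_ae ?_
      filter_upwards [(hφ.memLp_gradient Ω).coeFn_toLp] with x hx
      rw [hx, inner_gradient_eq]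
    · intro x hx _
      simp [hx]
  have h0 := integral_fderiv_apply_eq_zero ((hφ.mul hη.smooth).smooth.of_le (by simp))
    (hφ.mul hη.smooth).compact v
  simp only [fderiv_mul_apply hφ.smooth hη.smooth] at h0
  rw [integral_add] at h0
  · rw [e1, e2]
    linarith
  · exact (((hη.fderiv_apply v).mul hφ.smooth).smooth.continuous.integrable_of_hasCompactSupport
      ((hη.fderiv_apply v).mul hφ.smooth).compact).congr
      (Eventually.of_forall fun x => mul_comm _ _)
  · exact (hη.mul (hφ.fderiv_apply v).smooth).smooth.continuous.integrable_of_hasCompactSupport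
      (hη.mul (hφ.fderiv_apply v).smooth).compact

/-- A test function as an element of `H¹(Ω)`. -/
noncomputable def IsTest.toH1 {φ : E d → ℝ} (hφ : IsTest φ) (Ω : Set (E d)) : H1 Ω :=
  ⟨WithLp.toLp 2 ((hφ.memLp Ω).toLp φ, (hφ.memLp_gradient Ω).toLp _), isWeakGradient_toLp hφ Ω⟩

theorem IsTest.toL2_toH1 {φ : E d → ℝ} (hφ : IsTest φ) (Ω : Set (E d)) :
    H1.toL2 (hφ.toH1 Ω) = (hφ.memLp Ω).toLp φ := rfl

theorem IsTest.grad_toH1 {φ : E d → ℝ} (hφ : IsTest φ) (Ω : Set (E d)) :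
    H1.grad (hφ.toH1 Ω) = (hφ.memLp_gradient Ω).toLp _ := rfl

/-- The weak gradient as a continuous linear map. -/
noncomputable def gradL (Ω : Set (E d)) : H1 Ω →L[ℝ] L2Vec Ω :=
  WithLp.sndL 2 ℝ (L2 Ω) (L2Vec Ω) ∘L (H1 Ω).subtypeL

/-- The divergence as a continuous linear map. -/
noncomputable def divL (Ω : Set (E d)) : H1Vec Ω →L[ℝ] L2 Ω :=
  ∑ i, ((EuclideanSpace.proj i : E d →L[ℝ] ℝ).compLpL 2 (vol Ω) ∘L gradL Ω) ∘L
    PiLp.proj 2 (fun _ : Fin d => H1 Ω) i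

theorem divL_apply {Ω : Set (E d)} (ψ : H1Vec Ω) : divL Ω ψ = divergence ψ := by
  simp only [divL, divergence, sum_apply]
  rfl

/-- The divergence of an `H¹` field, as a function. -/
theorem divergence_ae {Ω : Set (E d)} (ψ : H1Vec Ω) :
    divergence ψ =ᵐ[vol Ω] fun x => ∑ i, H1.grad (ψ i) x i := by
  refine (Lp.coeFn_finsetSum _ _).trans ?_
  have h : ∀ᵐ x ∂(vol Ω), ∀ i, (EuclideanSpace.proj i : E d →L[ℝ] ℝ).compLp (H1.grad (ψ i)) x =
      H1.grad (ψ i) x i :=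
    ae_all_iff.2 fun i => ContinuousLinearMap.coeFn_compLp _ _
  filter_upwards [h] with x hx
  simp [hx]

theorem H1.norm_sq {Ω : Set (E d)} (u : H1 Ω) :
    ‖u‖ ^ 2 = ‖H1.toL2 u‖ ^ 2 + ‖H1.grad u‖ ^ 2 :=
  WithLp.prod_norm_sq_eq_of_L2 (u : WithLp 2 (L2 Ω × L2Vec Ω))

theorem norm_toLp_sq {F : Type*} [NormedAddCommGroup F] {μ : Measure (E d)} {g : E d → F}
    (hg : MemLp g 2 μ) : ‖hg.toLp g‖ ^ 2 = (∫⁻ x, ‖g x‖ₑ ^ 2 ∂μ).toReal := by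
  rw [Lp.norm_toLp, ← ENNReal.toReal_pow]
  congr 1
  have h := eLpNorm_nnreal_pow_eq_lintegral (f := g) (μ := μ) (p := 2) two_ne_zero
  simpa using h

theorem H1.ext {Ω : Set (E d)} {u v : H1 Ω} (h1 : H1.toL2 u = H1.toL2 v)
    (h2 : H1.grad u = H1.grad v) : u = v :=
  Subtype.ext (WithLp.ofLp_injective 2 (Prod.ext h1 h2))

theorem isTest_zero : IsTest fun _ : E d => (0 : ℝ) := ⟨contDiff_const, HasCompactSupport.zero⟩

theorem IsTest.add {f g : E d → ℝ} (hf : IsTest f) (hg : IsTest g) : IsTest fun x => f x + g x :=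
  ⟨hf.smooth.add hg.smooth, hf.compact.add hg.compact⟩

theorem IsTest.const_mul {f : E d → ℝ} (hf : IsTest f) (c : ℝ) : IsTest fun x => c * f x :=
  ⟨contDiff_const.mul hf.smooth, hf.compact.mul_left⟩

theorem isTest_zero_toH1 (Ω : Set (E d)) : (isTest_zero (d := d)).toH1 Ω = 0 := by
  refine H1.ext (Lp.ext ?_) (Lp.ext ?_)
  · rw [IsTest.toL2_toH1]
    filter_upwards [(isTest_zero.memLp Ω).coeFn_toLp, Lp.coeFn_zero ℝ 2 (vol Ω)] with x h1 h2
    rw [h1]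
    exact h2.symm
  · rw [IsTest.grad_toH1]
    filter_upwards [(isTest_zero.memLp_gradient Ω).coeFn_toLp,
      Lp.coeFn_zero (E d) 2 (vol Ω)] with x h1 h2
    rw [h1]
    exact (by simp [gradient] : gradient (fun _ : E d => (0 : ℝ)) x = 0).trans h2.symm

theorem IsTest.toH1_add {f g : E d → ℝ} (hf : IsTest f) (hg : IsTest g) (Ω : Set (E d)) :
    (hf.add hg).toH1 Ω = hf.toH1 Ω + hg.toH1 Ω := by
  refine H1.ext (MemLp.toLp_add (hf.memLp Ω) (hg.memLp Ω)) ?_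
  refine Eq.trans ?_ (MemLp.toLp_add (hf.memLp_gradient Ω) (hg.memLp_gradient Ω))
  rw [IsTest.grad_toH1]
  refine MemLp.toLp_congr _ _ (Eventually.of_forall fun x => ?_)
  simp only [Pi.add_apply, gradient]
  rw [fderiv_fun_add (hf.smooth.differentiable (by simp) x)
    (hg.smooth.differentiable (by simp) x), map_add]

theorem IsTest.toH1_const_mul {f : E d → ℝ} (hf : IsTest f) (c : ℝ) (Ω : Set (E d)) :
    (hf.const_mul c).toH1 Ω = c • hf.toH1 Ω := by
  refine H1.ext (MemLp.toLp_const_smul c (hf.memLp Ω)) ?_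
  refine Eq.trans ?_ (MemLp.toLp_const_smul c (hf.memLp_gradient Ω))
  rw [IsTest.grad_toH1]
  refine MemLp.toLp_congr _ _ (Eventually.of_forall fun x => ?_)
  simp only [Pi.smul_apply, gradient]
  rw [fderiv_const_mul (hf.smooth.differentiable (by simp) x)]
  simp

/-! ### The space `H₀¹(Ω)` and its vanishing trace -/

/-- The test functions supported in `Ω`, as a subspace of `H¹(Ω)`. -/
def testH1 (Ω : Set (E d)) : Submodule ℝ (H1 Ω) where
  carrier := {u | ∃ (φ : E d → ℝ) (hφ : IsTest φ), tsupport φ ⊆ Ω ∧ hφ.toH1 Ω = u}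
  zero_mem' := ⟨_, isTest_zero, by simp [tsupport], isTest_zero_toH1 Ω⟩
  add_mem' := by
    rintro _ _ ⟨φ, hφ, h1, rfl⟩ ⟨η, hη, h2, rfl⟩
    exact ⟨_, hφ.add hη, (tsupport_add φ η).trans (union_subset h1 h2), hφ.toH1_add hη Ω⟩
  smul_mem' := by
    rintro c _ ⟨φ, hφ, h1, rfl⟩
    exact ⟨_, hφ.const_mul c, (tsupport_mul_subset_right (f := fun _ => c)).trans h1,
      hφ.toH1_const_mul c Ω⟩

/-- The closure `H₀¹(Ω)` of the test functions supported in `Ω`. -/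
noncomputable def H10 (Ω : Set (E d)) : Submodule ℝ (H1 Ω) := (testH1 Ω).topologicalClosure

theorem tendsto_eLpNorm_toLp_sub {F : Type*} [NormedAddCommGroup F] {μ : Measure (E d)}
    {f : ℕ → E d → F} (hf : ∀ k, MemLp (f k) 2 μ) {u : Lp F 2 μ}
    (h : Tendsto (fun k => (hf k).toLp (f k)) atTop (𝓝 u)) :
    Tendsto (fun k => eLpNorm (fun x => f k x - u x) 2 μ) atTop (𝓝 0) := by
  rw [Lp.tendsto_Lp_iff_tendsto_eLpNorm'] at h
  refine h.congr fun k => eLpNorm_congr_ae ?_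
  filter_upwards [(hf k).coeFn_toLp] with x hx
  simp [hx]

/-- The approximating test functions are supported in the open set `Ω`, so they vanish identically
on its frontier. -/
theorem hasTrace_of_mem_H10 {Ω : Set (E d)} (hΩ : IsOpen Ω) {u : H1 Ω} (hu : u ∈ H10 Ω) :
    HasTrace u fun _ => 0 := by
  obtain ⟨w, hw, hlim⟩ := mem_closure_iff_seq_limit.1 hu
  choose φ hφ hs hφw using hw
  obtain rfl : (fun k => (hφ k).toH1 Ω) = w := funext hφw
  refine ⟨MemLp.zero, φ, fun k => (hφ k).smooth, ?_, ?_, ?_⟩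
  · refine tendsto_eLpNorm_toLp_sub (fun k => (hφ k).memLp Ω) ?_
    exact (((WithLp.fstL 2 ℝ (L2 Ω) (L2Vec Ω) ∘L (H1 Ω).subtypeL).continuous.tendsto u).comp hlim)
  · refine tendsto_eLpNorm_toLp_sub (fun k => (hφ k).memLp_gradient Ω) ?_
    exact (((gradL Ω).continuous.tendsto u).comp hlim)
  · refine tendsto_const_nhds.congr fun k => ?_
    symm
    rw [← eLpNorm_zero (α := E d) (ε := ℝ) (p := 2) (μ := surface Ω)]
    refine eLpNorm_congr_ae ?_
    filter_upwards [ae_restrict_mem isClosed_frontier.measurableSet] with x hx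
    have : x ∉ tsupport (φ k) := fun h => by
      have := hs k h
      rw [hΩ.frontier_eq] at hx
      exact hx.2 this
    simp [image_eq_zero_of_notMem_tsupport this]

/-- The fields with components in `H₀¹(Ω)`. -/
def H10Vec (Ω : Set (E d)) : Submodule ℝ (H1Vec Ω) where
  carrier := {ψ | ∀ i, ψ i ∈ H10 Ω}
  zero_mem' := fun _ => (H10 Ω).zero_mem
  add_mem' := fun h1 h2 i => (H10 Ω).add_mem (h1 i) (h2 i)
  smul_mem' := fun c _ h i => (H10 Ω).smul_mem c (h i)

instance completeSpace_H10Vec (Ω : Set (E d)) : CompleteSpace (H10Vec Ω) := by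
  have h : IsClosed (H10Vec Ω : Set (H1Vec Ω)) := by
    have e : (H10Vec Ω : Set (H1Vec Ω)) =
        ⋂ i, (PiLp.proj 2 (fun _ : Fin d => H1 Ω) i : H1Vec Ω →L[ℝ] H1 Ω) ⁻¹' (H10 Ω) := by
      ext ψ
      simp only [mem_iInter]
      rfl
    rw [e]
    exact isClosed_iInter fun i => (Submodule.isClosed_topologicalClosure _).preimage
      (ContinuousLinearMap.continuous _)
  exact h.completeSpace_coe

theorem H10Vec_le_testSpace {Ω : Set (E d)} (hΩ : IsOpen Ω) (Γ₁ Γ₂ : Set (E d)) :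
    H10Vec Ω ≤ testSpace Ω Γ₁ Γ₂ := fun ψ hψ =>
  ⟨fun _ => 0, fun i => hasTrace_of_mem_H10 hΩ (hψ i), by simp, by simp⟩

/-! ### Solving the divergence equation on a star patch -/

theorem exists_isTest_integral_eq_one {U : Set (E d)} {z : E d} (hU : U ∈ 𝓝 z) :
    ∃ θ : E d → ℝ, IsTest θ ∧ tsupport θ ⊆ U ∧ ∫ x, θ x = 1 := by
  obtain ⟨r, hr, hrU⟩ := Metric.nhds_basis_closedBall.mem_iff.1 hU
  let b : ContDiffBump z := ⟨r / 2, r, half_pos hr, half_lt_self hr⟩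
  refine ⟨b.normed volume, ⟨b.contDiff_normed (n := ⊤), b.hasCompactSupport_normed⟩, ?_,
    b.integral_normed⟩
  rwa [b.tsupport_normed_eq]

/-- Integrating the weak identity `integral_fderiv_bogovskii` by parts shows that both sides have
the same integral against every test function. -/
theorem sum_fderiv_bogovskii_ae {f θ : E d → ℝ} (hf : IsTest f) (hθ : IsTest θ)
    (hf0 : ∫ x, f x = 0) (hθ1 : ∫ x, θ x = 1) :
    ∀ᵐ x : E d, ∑ i, fderiv ℝ (fun x => bogovskii f θ x i) x (EuclideanSpace.single i 1) = f x := by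
  have ht := hf.bogovskii_apply hθ
  have hs : ∀ i, IsTest fun x =>
      fderiv ℝ (fun x => bogovskii f θ x i) x (EuclideanSpace.single i 1) := fun i =>
    (ht i).fderiv_apply _
  refine ae_eq_of_integral_contDiff_smul_eq ?_ hf.smooth.continuous.locallyIntegrable ?_
  · refine Continuous.locallyIntegrable ?_
    exact continuous_finsetSum _ fun i _ => (hs i).smooth.continuous
  · intro η hη hc
    have hη' : IsTest η := ⟨hη, hc⟩
    have h1 := integral_fderiv_bogovskii hf hθ (hη.of_le (by simp)) hf0 hθ1
    have e : ∀ x, fderiv ℝ η x (bogovskii f θ x) =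
        ∑ i, bogovskii f θ x i * fderiv ℝ η x (EuclideanSpace.single i 1) := fun x => by
      conv_lhs => rw [← (EuclideanSpace.basisFun (Fin d) ℝ).sum_repr (bogovskii f θ x), map_sum]
      simp
    have hi : ∀ i, Integrable fun x =>
        bogovskii f θ x i * fderiv ℝ η x (EuclideanSpace.single i 1) := fun i =>
      ((ht i).mul (hη'.fderiv_apply _).smooth).smooth.continuous.integrable_of_hasCompactSupport
        ((ht i).mul (hη'.fderiv_apply _).smooth).compact
    have hi2 : ∀ i, Integrable fun x => η x *
        fderiv ℝ (fun x => bogovskii f θ x i) x (EuclideanSpace.single i 1) := fun i =>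
      (hη'.mul (hs i).smooth).smooth.continuous.integrable_of_hasCompactSupport
        (hη'.mul (hs i).smooth).compact
    have hz : ∀ i, ∫ x, η x *
        fderiv ℝ (fun x => bogovskii f θ x i) x (EuclideanSpace.single i 1) =
        - ∫ x, bogovskii f θ x i * fderiv ℝ η x (EuclideanSpace.single i 1) := fun i => by
      have h0 := integral_fderiv_apply_eq_zero ((hη'.mul (ht i).smooth).smooth.of_le (by simp))
        (hη'.mul (ht i).smooth).compact (EuclideanSpace.single i 1)
      simp only [fderiv_mul_apply hη (ht i).smooth] at h0
      rw [integral_add (hi2 i) (hi i)] at h0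
      linarith
    simp only [e] at h1
    rw [integral_finsetSum _ fun i _ => hi i] at h1
    simp only [smul_eq_mul, Finset.mul_sum]
    rw [integral_finsetSum _ fun i _ => hi2 i]
    simp only [hz, Finset.sum_neg_distrib, h1, neg_neg]
    exact integral_congr_ae (Eventually.of_forall fun x => mul_comm _ _)

theorem enorm_sq_eq_sum (v : E d) : ‖v‖ₑ ^ 2 = ∑ k, ‖v k‖ₑ ^ 2 := by
  have h : ∀ {F : Type} [NormedAddCommGroup F] (w : F), ‖w‖ₑ ^ 2 = ENNReal.ofReal (‖w‖ ^ 2) :=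
    fun w => by rw [ENNReal.ofReal_pow (norm_nonneg _), ofReal_norm]
  simp only [h, EuclideanSpace.norm_sq_eq]
  exact ENNReal.ofReal_sum_of_nonneg fun i _ => by positivity

/-- `U` is an open subset of `Ω` all of whose points see a fixed ball inside `Ω`. -/
structure IsStarPatch (Ω U : Set (E d)) : Prop where
  isOpen : IsOpen U
  subset : U ⊆ Ω
  exists_ball : ∃ z : E d, ∃ δ > 0, segments U (Metric.ball z δ) ⊆ Ω

/-- Smooth mean-zero functions with support in a star patch are divergences, with bounds. -/
theorem IsStarPatch.exists_bogovskii {Ω U : Set (E d)} (hΩ : Bornology.IsBounded Ω)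
    (hU : IsStarPatch Ω U) : ∃ C > 0, ∀ (f : E d → ℝ) (hf : IsTest f), tsupport f ⊆ U →
      ∫ x, f x = 0 → ∃ ψ ∈ H10Vec Ω, divergence ψ = (hf.memLp Ω).toLp f ∧
        ‖ψ‖ ≤ C * ‖(hf.memLp Ω).toLp f‖ := by
  obtain ⟨z, δ, hδ, hseg⟩ := hU.exists_ball
  obtain ⟨θ, hθ, hθs, hθ1⟩ := exists_isTest_integral_eq_one (Metric.ball_mem_nhds z hδ)
  obtain ⟨R, hR⟩ := hΩ.subset_closedBall 0
  obtain ⟨C, hC, hb⟩ := exists_lintegral_bogovskii_le hθ R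
  set D : ℝ≥0∞ := ∑ _i : Fin d,
    (C + ∑ k : Fin d, ENNReal.ofReal (2 * Real.pi * ‖(EuclideanSpace.single k 1 : E d)‖) ^ 2 * C)
    with hD
  have hDt : D ≠ ⊤ := ENNReal.sum_ne_top.2 fun _ _ =>
    ENNReal.add_ne_top.2 ⟨hC, ENNReal.sum_ne_top.2 fun _ _ => by finiteness⟩
  -- `D` bounds the squared `H¹` norm, summed over components and derivative directions. Adding one
  -- keeps the constant positive even if `D = 0`.
  refine ⟨√D.toReal + 1, by positivity, fun f hf hfU hf0 => ?_⟩
  have ht := hf.bogovskii_apply hθ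
  refine ⟨WithLp.toLp 2 fun i => (ht i).toH1 Ω, fun i => ?_, ?_, ?_⟩
  · refine Submodule.le_topologicalClosure _ ⟨_, ht i, ?_, rfl⟩
    -- The field lives on segments joining the support of `f` to that of `θ`, hence to the ball seen
    -- by the patch; these may leave `U` but not `Ω`.
    refine (closure_mono ?_).trans ((tsupport_bogovskii_subset hf.compact hθ.compact).trans ?_)
    · intro x hx h
      exact hx (by simp [h])
    · rintro _ ⟨⟨s, y, w⟩, ⟨hs, hy, hw⟩, rfl⟩
      exact hseg ⟨(s, y, w), ⟨hs, hfU hy, hθs hw⟩, rfl⟩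
  · refine Lp.ext ?_
    have h1 : ∀ᵐ x ∂(vol Ω), ∀ i, H1.grad ((ht i).toH1 Ω) x =
        gradient (fun x => bogovskii f θ x i) x :=
      ae_all_iff.2 fun i => ((ht i).memLp_gradient Ω).coeFn_toLp
    filter_upwards [divergence_ae (WithLp.toLp 2 fun i => (ht i).toH1 Ω),
      ae_restrict_of_ae (sum_fderiv_bogovskii_ae hf hθ hf0 hθ1), (hf.memLp Ω).coeFn_toLp, h1]
      with x hx1 hx2 hx3 hx4
    rw [hx1, hx3, ← hx2]
    refine Finset.sum_congr rfl fun i _ => ?_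
    rw [← gradient_apply, ← hx4 i]
  · have hfΩ : ∫⁻ x in Ω, ‖f x‖ₑ ^ 2 = ∫⁻ x, ‖f x‖ₑ ^ 2 :=
      setLIntegral_eq_of_support_subset fun x hx => hU.subset (hfU (subset_tsupport _ fun h =>
        hx (by simp [h])))
    have hft : ∫⁻ x, ‖f x‖ₑ ^ 2 ≠ ⊤ := by
      have h1 : MemLp f 2 volume := hf.smooth.continuous.memLp_of_hasCompactSupport hf.compact
      have h2 := eLpNorm_nnreal_pow_eq_lintegral (f := f) (μ := volume) (p := 2) two_ne_zero
      have h3 := ENNReal.pow_ne_top (n := 2) h1.2.ne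
      have h4 : ∫⁻ x, ‖f x‖ₑ ^ 2 = eLpNorm f 2 volume ^ 2 := by simpa using h2.symm
      rwa [h4]
    have hsq : ‖(WithLp.toLp 2 fun i => (ht i).toH1 Ω : H1Vec Ω)‖ ^ 2 ≤
        D.toReal * ‖(hf.memLp Ω).toLp f‖ ^ 2 := by
      have hb' := hb f hf (hfU.trans (hU.subset.trans hR))
      have e : ∀ i, ‖(ht i).toH1 Ω‖ ^ 2 ≤ ((C + ∑ k : Fin d,
          ENNReal.ofReal (2 * Real.pi * ‖(EuclideanSpace.single k 1 : E d)‖) ^ 2 * C) *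
          ∫⁻ x, ‖f x‖ₑ ^ 2).toReal := fun i => by
        rw [H1.norm_sq, IsTest.toL2_toH1, IsTest.grad_toH1, norm_toLp_sq, norm_toLp_sq]
        have i1 : ∫⁻ x in Ω, ‖bogovskii f θ x i‖ₑ ^ 2 ≤ C * ∫⁻ x, ‖f x‖ₑ ^ 2 :=
          (setLIntegral_le_lintegral _ _).trans (hb' i).1
        have i2 : ∫⁻ x in Ω, ‖gradient (fun x => bogovskii f θ x i) x‖ₑ ^ 2 ≤ (∑ k : Fin d,
            ENNReal.ofReal (2 * Real.pi * ‖(EuclideanSpace.single k 1 : E d)‖) ^ 2 * C) *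
            ∫⁻ x, ‖f x‖ₑ ^ 2 := by
          refine (setLIntegral_le_lintegral _ _).trans ?_
          simp only [enorm_sq_eq_sum, gradient_apply]
          rw [lintegral_finsetSum _ fun k _ =>
            ((ht i).fderiv_apply _).smooth.continuous.enorm.measurable.pow_const 2, Finset.sum_mul]
          refine Finset.sum_le_sum fun k _ => ?_
          rw [mul_assoc]
          exact (hb' i).2 _
        have hDt' : (∑ k : Fin d, ENNReal.ofReal
            (2 * Real.pi * ‖(EuclideanSpace.single k 1 : E d)‖) ^ 2 * C) ≠ ⊤ :=
          ENNReal.sum_ne_top.2 fun _ _ => by finiteness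
        rw [add_mul, ENNReal.toReal_add (by finiteness) (by finiteness)]
        exact add_le_add (ENNReal.toReal_mono (by finiteness) i1)
          (ENNReal.toReal_mono (by finiteness) i2)
      rw [PiLp.norm_sq_eq_of_L2, norm_toLp_sq, hfΩ, ← ENNReal.toReal_mul, hD, Finset.sum_mul,
        ENNReal.toReal_sum]
      · exact Finset.sum_le_sum fun i _ => e i
      · intro i _
        exact ENNReal.mul_ne_top (ENNReal.add_ne_top.2
          ⟨hC, ENNReal.sum_ne_top.2 fun _ _ => by finiteness⟩) hft
    rw [← pow_le_pow_iff_left₀ (norm_nonneg _) (by positivity) two_ne_zero]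
    refine hsq.trans ?_
    rw [mul_pow]
    refine mul_le_mul_of_nonneg_right ?_ (by positivity)
    nlinarith [Real.sq_sqrt (ENNReal.toReal_nonneg (a := D)), Real.sqrt_nonneg D.toReal]

/-- The mean-zero test functions supported in `U`, as a subspace of `L²(Ω)`. -/
noncomputable def meanZeroTest (Ω U : Set (E d)) : Submodule ℝ (L2 Ω) where
  carrier := {g | ∃ (f : E d → ℝ) (hf : IsTest f), tsupport f ⊆ U ∧ ∫ x, f x = 0 ∧
    (hf.memLp Ω).toLp f = g}
  zero_mem' := ⟨_, isTest_zero, by simp [tsupport], by simp,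
    congrArg H1.toL2 (isTest_zero_toH1 Ω)⟩
  add_mem' := by
    rintro _ _ ⟨f, hf, h1, h2, rfl⟩ ⟨g, hg, h3, h4, rfl⟩
    refine ⟨_, hf.add hg, (tsupport_add f g).trans (union_subset h1 h3), ?_,
      MemLp.toLp_add (hf.memLp Ω) (hg.memLp Ω)⟩
    rw [integral_add (hf.smooth.continuous.integrable_of_hasCompactSupport hf.compact)
      (hg.smooth.continuous.integrable_of_hasCompactSupport hg.compact), h2, h4, add_zero]
  smul_mem' := by
    rintro c _ ⟨f, hf, h1, h2, rfl⟩
    refine ⟨_, hf.const_mul c, (tsupport_mul_subset_right (f := fun _ => c)).trans h1, ?_,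
      MemLp.toLp_const_smul c (hf.memLp Ω)⟩
    rw [integral_const_mul, h2, mul_zero]

theorem setIntegral_eq_integral_of_tsupport {Ω U : Set (E d)} {f : E d → ℝ} (hfU : tsupport f ⊆ U)
    (hU : U ⊆ Ω) : ∫ x in Ω, f x = ∫ x, f x :=
  setIntegral_eq_integral_of_tsupport_subset (hfU.trans hU) fun _ h _ => h

/-- By the double orthogonal complement it suffices that every `q` orthogonal to the mean-zero test
functions is orthogonal to `f`. Such a `q` is almost everywhere constant on `U`, and `f` vanishes
off `U` with integral zero. -/
theorem mem_closure_meanZeroTest {Ω U : Set (E d)} (hΩ : Bornology.IsBounded Ω) (hUo : IsOpen U)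
    (hU : U ⊆ Ω) {f : L2 Ω} (hf : ∀ᵐ x ∂(vol Ω), x ∉ U → f x = 0) (hf0 : ∫ x in Ω, f x = 0) :
    f ∈ (meanZeroTest Ω U).topologicalClosure := by
  have : IsFiniteMeasure (vol Ω) := ⟨by
    rw [Measure.restrict_apply_univ]
    exact hΩ.measure_lt_top⟩
  rw [← Submodule.orthogonal_orthogonal_eq_closure, Submodule.mem_orthogonal]
  intro q hq
  rw [Submodule.mem_orthogonal] at hq
  have hL1 : ∀ g : L2 Ω, Integrable g (vol Ω) := fun g => (Lp.memLp g).integrable (by norm_num)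
  have hqf : ∀ (φ : E d → ℝ) (hφ : IsTest φ),
      ⟪(hφ.memLp Ω).toLp φ, q⟫ = ∫ x in Ω, φ x * q x := fun φ hφ => by
    rw [L2.inner_def]
    refine integral_congr_ae ?_
    filter_upwards [(hφ.memLp Ω).coeFn_toLp] with x hx
    rw [hx]
    simp [mul_comm]
  obtain ⟨c, hc⟩ : ∃ c : ℝ, ∀ᵐ x ∂(vol Ω), x ∈ U → q x - c = 0 := by
    rcases U.eq_empty_or_nonempty with rfl | ⟨z, hz⟩
    · exact ⟨0, by simp⟩
    obtain ⟨θ, hθ, hθU, hθ1⟩ := exists_isTest_integral_eq_one (hUo.mem_nhds hz)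
    refine ⟨∫ x in Ω, θ x * q x, ?_⟩
    have hqc : Integrable (fun x => q x - ∫ x in Ω, θ x * q x) (vol Ω) :=
      (hL1 q).sub (integrable_const _)
    refine hUo.ae_eq_zero_of_integral_contDiff_smul_eq_zero
      (hqc.locallyIntegrable.locallyIntegrableOn U) fun φ h1 h2 hφU => ?_
    have hφ : IsTest φ := ⟨h1, h2⟩
    have hint : ∀ η : E d → ℝ, IsTest η → Integrable (fun x => η x * q x) (vol Ω) := fun η hη =>
      memLp_one_iff_integrable.1 ((Lp.memLp q).mul (hη.memLp Ω))
    have hφi : Integrable φ := h1.continuous.integrable_of_hasCompactSupport h2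
    have hθi : Integrable θ := hθ.smooth.continuous.integrable_of_hasCompactSupport hθ.compact
    -- An arbitrary test function `φ` is made mean-zero by subtracting `(∫ φ) θ`. Orthogonality then
    -- says that `q` minus the constant `∫ θ q` annihilates `φ`.
    have hχ := hφ.add (hθ.const_mul (-∫ x, φ x))
    have h3 := hq _ ⟨_, hχ, (tsupport_add _ _).trans (union_subset hφU
      ((tsupport_mul_subset_right (f := fun _ => -∫ x, φ x)).trans hθU)), ?_, rfl⟩
    swap
    · rw [integral_add hφi (hθi.const_mul _), integral_const_mul, hθ1]
      ring
    rw [hqf _ hχ] at h3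
    have e : ∀ x, (φ x + (-∫ x, φ x) * θ x) * q x = φ x * q x + (-∫ x, φ x) * (θ x * q x) :=
      fun x => by ring
    simp only [e] at h3
    rw [integral_add (hint φ hφ) ((hint θ hθ).const_mul _), integral_const_mul] at h3
    simp only [smul_eq_mul, mul_sub]
    rw [integral_sub (hint φ hφ) (hφi.restrict.mul_const _), integral_mul_const,
      setIntegral_eq_integral_of_tsupport hφU hU]
    linarith
  rw [L2.inner_def]
  calc ∫ x in Ω, ⟪q x, f x⟫ = ∫ x in Ω, c * f x := by
        refine integral_congr_ae ?_
        filter_upwards [hf, hc] with x h1 h2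
        by_cases hx : x ∈ U
        · rw [sub_eq_zero.1 (h2 hx)]
          simp [mul_comm]
        · simp [h1 hx]
    _ = 0 := by rw [integral_const_mul, hf0, mul_zero]

noncomputable instance normedAddCommGroupH10Vec (Ω : Set (E d)) :
    NormedAddCommGroup (H10Vec Ω) :=
  Submodule.normedAddCommGroup _

noncomputable instance normedSpaceH10Vec (Ω : Set (E d)) : NormedSpace ℝ (H10Vec Ω) :=
  Submodule.normedSpace _

/-- The range of the divergence on `H₀¹` fields. -/
noncomputable def divRange (Ω : Set (E d)) : Submodule ℝ (L2 Ω) :=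
  (H10Vec Ω).map (divL Ω : H1Vec Ω →ₗ[ℝ] L2 Ω)

/-- Controlled solvability of `T y = k` on a subspace extends to its closure. -/
theorem exists_eq_of_mem_topologicalClosure {Y H : Type*} [NormedAddCommGroup Y] [NormedSpace ℝ Y]
    [CompleteSpace Y] [NormedAddCommGroup H] [NormedSpace ℝ H] (T : Y →L[ℝ] H) {K : Submodule ℝ H}
    {C : ℝ} (hC : 0 < C) (hK : ∀ k ∈ K, ∃ y, T y = k ∧ ‖y‖ ≤ C * ‖k‖) {k : H}
    (hk : k ∈ K.topologicalClosure) : ∃ y, T y = k := by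
  let g : NormedAddGroupHom Y H :=
    { toFun := T
      map_add' := map_add T
      bound' := ⟨‖T‖, T.le_opNorm⟩ }
  have h1 : g.SurjectiveOnWith K.toAddSubgroup C := hK
  -- Successive approximation: the remainders are solved with bounds, and completeness of `Y` makes
  -- the sum of the corrections converge.
  obtain ⟨y, hy, -⟩ := controlled_closure_of_complete hC one_pos h1 k hk
  exact ⟨y, hy⟩

theorem IsStarPatch.mem_divRange {Ω U : Set (E d)} (hΩ : Bornology.IsBounded Ω)
    (hU : IsStarPatch Ω U) {f : L2 Ω} (hf : ∀ᵐ x ∂(vol Ω), x ∉ U → f x = 0)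
    (hf0 : ∫ x in Ω, f x = 0) : f ∈ divRange Ω := by
  obtain ⟨C, hC, h⟩ := hU.exists_bogovskii hΩ
  obtain ⟨ψ, hψ⟩ := exists_eq_of_mem_topologicalClosure
    (Y := H10Vec Ω) (H := L2 Ω) (divL Ω ∘L (H10Vec Ω).subtypeL) hC (K := meanZeroTest Ω U) (by
      rintro _ ⟨φ, hφ, hφU, hφ0, rfl⟩
      obtain ⟨ψ, hψ, hdiv, hn⟩ := h φ hφ hφU hφ0
      exact ⟨⟨ψ, hψ⟩, (divL_apply ψ).trans hdiv, hn⟩)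
    (mem_closure_meanZeroTest hΩ hU.isOpen hU.subset hf hf0)
  exact ⟨ψ, ψ.2, hψ⟩

/-! ### Star patches around every point of the closure -/

theorem IsLocalDefiningFunction.differentiableAt {Ω U : Set (E d)} {x : E d} {ρ : E d → ℝ}
    (h : IsLocalDefiningFunction Ω x U ρ) {y : E d} (hy : y ∈ U) : DifferentiableAt ℝ ρ y :=
  (h.smooth.contDiffAt (h.isOpen.mem_nhds hy)).differentiableAt (by simp)

theorem IsLocalDefiningFunction.contDiffOn_gradient {Ω U : Set (E d)} {x : E d} {ρ : E d → ℝ}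
    (h : IsLocalDefiningFunction Ω x U ρ) : ContDiffOn ℝ ∞ (gradient ρ) U :=
  (InnerProductSpace.toDual ℝ (E d)).symm.contDiff.comp_contDiffOn
    (h.smooth.fderiv_of_isOpen h.isOpen (by simp))

theorem IsLocalDefiningFunction.hasDerivAt_line {Ω U : Set (E d)} {x : E d} {ρ : E d → ℝ}
    (h : IsLocalDefiningFunction Ω x U ρ) {y v : E d} {s : ℝ} (hy : y + s • v ∈ U) :
    HasDerivAt (fun s : ℝ => ρ (y + s • v)) ⟪v, gradient ρ (y + s • v)⟫ s := by
  rw [inner_gradient_eq]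
  have h1 : HasDerivAt (fun s : ℝ => y + s • v) v s := by
    simpa using ((hasDerivAt_id s).smul_const v).const_add y
  exact (h.differentiableAt hy).hasFDerivAt.comp_hasDerivAt s h1

theorem exists_isStarPatch_of_mem {Ω : Set (E d)} (hΩ : IsOpen Ω) {x : E d} (hx : x ∈ Ω) :
    ∃ r > 0, IsStarPatch Ω (Metric.ball x r ∩ Ω) := by
  obtain ⟨r, hr, hrΩ⟩ := Metric.isOpen_iff.1 hΩ x hx
  refine ⟨r, hr, Metric.isOpen_ball.inter hΩ, inter_subset_right, x, r, hr, ?_⟩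
  rintro _ ⟨⟨s, y, w⟩, ⟨hs, hy, hw⟩, rfl⟩
  exact hrΩ (convex_ball x r hy.1 hw (by linarith [hs.2]) hs.1 (by simp))

/-- Points of `Ω` near `x` see a small ball centred at `x - t • e`, where `e` is the normalized
gradient. Along a segment from such a point into that ball the defining function is strictly
decreasing, so it stays negative. -/
theorem exists_isStarPatch_of_mem_frontier {Ω : Set (E d)} (hΩ : IsBoundedSmoothDomain Ω)
    {x : E d} (hx : x ∈ frontier Ω) : ∃ r > 0, IsStarPatch Ω (Metric.ball x r ∩ Ω) := by
  obtain ⟨U, ρ, h⟩ := hΩ.smooth_boundary x hx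
  set N := gradient ρ x with hN
  have hN0 : 0 < ‖N‖ := norm_pos_iff.2 (h.gradient_ne_zero x h.mem)
  have hev : ∀ᶠ y in 𝓝 x, y ∈ U ∧ ‖gradient ρ y - N‖ < ‖N‖ / 4 := by
    refine Filter.Eventually.and (h.isOpen.mem_nhds h.mem) ?_
    have hc : ContinuousAt (gradient ρ) x :=
      h.contDiffOn_gradient.continuousOn.continuousAt (h.isOpen.mem_nhds h.mem)
    have h1 := (hc.sub (continuousAt_const (y := N))).norm
    refine h1.eventually_lt continuousAt_const ?_
    simpa [hN] using hN0
  obtain ⟨r, hr, hball⟩ := Metric.eventually_nhds_iff_ball.1 hev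
  -- On the ball of radius `r` the gradient differs from `N` by less than `‖N‖ / 4`. With `t = r /
  -- 4` and radii `t / 4`, all segments stay in that ball.
  set t := r / 4 with ht
  have ht0 : 0 < t := by positivity
  set e := ‖N‖⁻¹ • N with he
  have he1 : ‖e‖ = 1 := by rw [he, norm_smul, norm_inv, norm_norm, inv_mul_cancel₀ hN0.ne']
  have hNe : ⟪e, N⟫ = ‖N‖ := by
    rw [he, inner_smul_left, real_inner_self_eq_norm_sq]
    simp only [conj_trivial]
    field_simp
  refine ⟨t / 4, by positivity, Metric.isOpen_ball.inter hΩ.isOpen, inter_subset_right,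
    x - t • e, t / 4, by positivity, ?_⟩
  rintro _ ⟨⟨s, y, w⟩, ⟨hs, hy, hw⟩, rfl⟩
  change 0 ≤ s ∧ s ≤ 1 at hs
  change (1 - s) • y + s • w ∈ Ω
  have hy1 : ‖y - x‖ < t / 4 := by simpa [dist_eq_norm] using hy.1
  have hw1 : ‖w - (x - t • e)‖ < t / 4 := by simpa [dist_eq_norm] using hw
  set a := (w - (x - t • e)) - (y - x) with ha
  have hwy : w - y = a - t • e := by rw [ha]; abel
  have ha1 : ‖a‖ ≤ t / 2 := (norm_sub_le _ _).trans (by linarith)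
  have hte : ‖t • e‖ = t := by rw [norm_smul, he1, Real.norm_of_nonneg ht0.le, mul_one]
  have hmem : ∀ τ ∈ Icc (0 : ℝ) 1, y + τ • (w - y) ∈ Metric.ball x r := fun τ hτ => by
    have h1 : y ∈ Metric.ball x r := by
      rw [mem_ball_iff_norm]; linarith
    have h2 : w ∈ Metric.ball x r := by
      rw [mem_ball_iff_norm]
      have : w - x = (w - (x - t • e)) - t • e := by abel
      rw [this]
      exact (norm_sub_le _ _).trans_lt (by linarith)
    rw [show y + τ • (w - y) = (1 - τ) • y + τ • w by module]
    exact convex_ball x r h1 h2 (by linarith [hτ.2]) hτ.1 (by simp)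
  rw [show (1 - s) • y + s • w = y + s • (w - y) by module]
  refine (h.mem_iff _ (hball _ (hmem s hs)).1).2 ?_
  have hρy : ρ y < 0 := by
    refine (h.mem_iff y ?_).1 hy.2
    have := (hball _ (hmem 0 ⟨le_rfl, zero_le_one⟩)).1
    simpa using this
  rcases hs.1.eq_or_lt with h0 | h0
  · simpa [← h0] using hρy
  have hd : ∀ τ ∈ Icc (0 : ℝ) 1, HasDerivAt (fun τ : ℝ => ρ (y + τ • (w - y)))
      ⟪w - y, gradient ρ (y + τ • (w - y))⟫ τ := fun τ hτ =>
    h.hasDerivAt_line (hball _ (hmem τ hτ)).1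
  obtain ⟨c, hc, hce⟩ := exists_hasDerivAt_eq_slope (fun τ : ℝ => ρ (y + τ • (w - y)))
    (fun τ => ⟪w - y, gradient ρ (y + τ • (w - y))⟫) h0
    (fun τ hτ => (hd τ ⟨hτ.1, hτ.2.trans hs.2⟩).continuousAt.continuousWithinAt)
    (fun τ hτ => hd τ ⟨hτ.1.le, hτ.2.le.trans hs.2⟩)
  -- The slope is at most `t‖N‖ (1/2 - 1 + 3/8) = -t‖N‖/8`: the terms come from `a`, from `-t • e`,
  -- and from the variation of the gradient.
  have hneg : ⟪w - y, gradient ρ (y + c • (w - y))⟫ < 0 := by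
    have h1 := (hball _ (hmem c ⟨hc.1.le, hc.2.le.trans hs.2⟩)).2
    set g := gradient ρ (y + c • (w - y))
    have e0 : ⟪w - y, N⟫ = ⟪a, N⟫ - t * ‖N‖ := by
      rw [hwy, inner_sub_left, real_inner_smul_left, hNe]
    have e1 : ⟪w - y, g⟫ = ⟪a, N⟫ - t * ‖N‖ + ⟪w - y, g - N⟫ := by
      rw [inner_sub_right, e0]
      ring
    have e2 : ⟪a, N⟫ ≤ t / 2 * ‖N‖ :=
      (real_inner_le_norm _ _).trans (mul_le_mul_of_nonneg_right ha1 hN0.le)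
    have e3 : ‖w - y‖ ≤ 3 * t / 2 := by
      rw [hwy]
      exact (norm_sub_le _ _).trans (by linarith)
    have e4 : ⟪w - y, g - N⟫ ≤ 3 * t / 2 * (‖N‖ / 4) :=
      (real_inner_le_norm _ _).trans (mul_le_mul e3 h1.le (norm_nonneg _) (by positivity))
    have := mul_pos ht0 hN0
    linarith
  rw [hce, sub_zero] at hneg
  have h2 := (div_neg_iff.1 hneg).resolve_left fun h3 => absurd h3.2 (by linarith)
  have h3 := h2.1
  simp only [zero_smul, add_zero] at h3
  linarith

theorem exists_isStarPatch {Ω : Set (E d)} (hΩ : IsBoundedSmoothDomain Ω) {x : E d}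
    (hx : x ∈ closure Ω) : ∃ r > 0, IsStarPatch Ω (Metric.ball x r ∩ Ω) := by
  by_cases h : x ∈ Ω
  · exact exists_isStarPatch_of_mem hΩ.isOpen h
  · exact exists_isStarPatch_of_mem_frontier hΩ (by
      rw [hΩ.isOpen.frontier_eq]
      exact ⟨hx, h⟩)

/-! ### Gluing: all mean-zero functions are divergences -/

/-- `f` is the divergence of an `H₀¹` field. -/
def IsDiv (Ω : Set (E d)) (f : E d → ℝ) : Prop :=
  ∃ h : MemLp f 2 (vol Ω), h.toLp f ∈ divRange Ω

theorem IsDiv.add {Ω : Set (E d)} {f g : E d → ℝ} (hf : IsDiv Ω f) (hg : IsDiv Ω g) :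
    IsDiv Ω (f + g) := by
  obtain ⟨h1, h2⟩ := hf
  obtain ⟨h3, h4⟩ := hg
  refine ⟨h1.add h3, ?_⟩
  rw [MemLp.toLp_add h1 h3]
  exact (divRange Ω).add_mem h2 h4

theorem IsDiv.const_smul {Ω : Set (E d)} {f : E d → ℝ} (hf : IsDiv Ω f) (c : ℝ) :
    IsDiv Ω (c • f) := by
  obtain ⟨h1, h2⟩ := hf
  refine ⟨h1.const_smul c, ?_⟩
  rw [MemLp.toLp_const_smul c h1]
  exact (divRange Ω).smul_mem c h2

theorem IsDiv.sub {Ω : Set (E d)} {f g : E d → ℝ} (hf : IsDiv Ω f) (hg : IsDiv Ω g) :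
    IsDiv Ω (f - g) := by
  have := hf.add (hg.const_smul (-1))
  rwa [neg_one_smul, ← sub_eq_add_neg] at this

theorem IsStarPatch.isDiv {Ω U : Set (E d)} (hΩ : Bornology.IsBounded Ω) (hU : IsStarPatch Ω U)
    {f : E d → ℝ} (hf : MemLp f 2 (vol Ω)) (hfU : ∀ x ∉ U, f x = 0) (hf0 : ∫ x in Ω, f x = 0) :
    IsDiv Ω f := by
  refine ⟨hf, hU.mem_divRange hΩ ?_ ?_⟩
  · filter_upwards [hf.coeFn_toLp] with x hx hxU
    rw [hx, hfU x hxU]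
  · rw [integral_congr_ae hf.coeFn_toLp, hf0]

/-- The normalized indicator function of a set. -/
noncomputable def avg (U : Set (E d)) : E d → ℝ := U.indicator fun _ => (volume.real U)⁻¹

theorem memLp_avg {Ω U : Set (E d)} (hΩ : Bornology.IsBounded Ω) (hU : IsOpen U) :
    MemLp (avg U) 2 (vol Ω) := by
  have : IsFiniteMeasure (vol Ω) := ⟨by
    rw [Measure.restrict_apply_univ]
    exact hΩ.measure_lt_top⟩
  exact (memLp_const _).indicator hU.measurableSet

theorem integral_avg {Ω U : Set (E d)} (hΩ : Bornology.IsBounded Ω) (hU : IsOpen U) (hUΩ : U ⊆ Ω)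
    (hne : U.Nonempty) : ∫ x in Ω, avg U x = 1 := by
  rw [avg, integral_indicator hU.measurableSet, Measure.restrict_restrict hU.measurableSet,
    inter_eq_left.2 hUΩ, setIntegral_const, smul_eq_mul]
  refine mul_inv_cancel₀ ?_
  rw [Measure.real, ENNReal.toReal_ne_zero]
  exact ⟨(hU.measure_pos _ hne).ne', (hΩ.subset hUΩ).measure_lt_top.ne⟩

/-- Within one patch the mass of `f` can be moved onto any open `V`: the difference is mean-zero and
vanishes off `U`. -/
theorem IsStarPatch.isDiv_sub_avg {Ω U V : Set (E d)} (hΩ : Bornology.IsBounded Ω)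
    (hU : IsStarPatch Ω U) (hV : IsOpen V) (hVU : V ⊆ U) (hne : V.Nonempty)
    {f : E d → ℝ} (hf : MemLp f 2 (vol Ω)) (hfU : ∀ x ∉ U, f x = 0) :
    IsDiv Ω (f - (∫ x in Ω, f x) • avg V) := by
  have : IsFiniteMeasure (vol Ω) := ⟨by
    rw [Measure.restrict_apply_univ]
    exact hΩ.measure_lt_top⟩
  have hm := memLp_avg (Ω := Ω) hΩ hV
  refine hU.isDiv hΩ (hf.sub (hm.const_smul _)) ?_ ?_
  · intro x hx
    simp [hfU x hx, avg, indicator_of_notMem fun h => hx (hVU h)]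
  · simp only [Pi.sub_apply, Pi.smul_apply, smul_eq_mul]
    rw [integral_sub (hf.integrable (by norm_num)) ((hm.integrable (by norm_num)).const_mul _),
      integral_const_mul, integral_avg hΩ hV (hVU.trans hU.subset) hne, mul_one, sub_self]

theorem IsStarPatch.isDiv_avg_sub_avg {Ω U V : Set (E d)} (hΩ : Bornology.IsBounded Ω)
    (hU : IsStarPatch Ω U) (hV : IsOpen V) (hVU : V ⊆ U) (hne : V.Nonempty) :
    IsDiv Ω (avg U - avg V) := by
  have h := hU.isDiv_sub_avg hΩ hV hVU hne (memLp_avg hΩ hU.isOpen)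
    (fun x hx => by simp [avg, hx])
  rwa [integral_avg hΩ hU.isOpen hU.subset (hne.mono hVU), one_smul] at h

/-- Averages over two overlapping patches are both compared with the average over the intersection.
For patches far apart, the patches comparable with `V` and those not comparable would otherwise have
unions that are open, cover `Ω` and both meet it. Connectedness gives a common point, hence two
overlapping patches of opposite kind, which is absurd. -/
theorem isDiv_avg_sub_avg {Ω : Set (E d)} (hΩ : IsBoundedSmoothDomain Ω) {U V : Set (E d)}
    (hU : IsStarPatch Ω U) (hV : IsStarPatch Ω V) (hUne : U.Nonempty) (hVne : V.Nonempty) :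
    IsDiv Ω (avg U - avg V) := by
  have hb := hΩ.isBounded
  have meet : ∀ {U V : Set (E d)}, IsStarPatch Ω U → IsStarPatch Ω V → (U ∩ V).Nonempty →
      IsDiv Ω (avg U - avg V) := fun {U V} hU hV hne => by
    have h1 := hU.isDiv_avg_sub_avg hb (hU.isOpen.inter hV.isOpen) inter_subset_left hne
    have h2 := hV.isDiv_avg_sub_avg hb (hU.isOpen.inter hV.isOpen) inter_subset_right hne
    simpa using h1.sub h2
  by_contra hcon
  obtain ⟨x, -, ⟨W, ⟨hW, hWd⟩, hxW⟩, ⟨W', ⟨hW', hWd'⟩, hxW'⟩⟩ :=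
    hΩ.isConnected.isPreconnected
      (⋃₀ {W | IsStarPatch Ω W ∧ IsDiv Ω (avg W - avg V)})
      (⋃₀ {W | IsStarPatch Ω W ∧ ¬ IsDiv Ω (avg W - avg V)})
      (isOpen_sUnion fun W hW => hW.1.isOpen) (isOpen_sUnion fun W hW => hW.1.isOpen)
      (by
        intro x hx
        obtain ⟨r, hr, hp⟩ := exists_isStarPatch_of_mem hΩ.isOpen hx
        have hxm : x ∈ Metric.ball x r ∩ Ω := ⟨Metric.mem_ball_self hr, hx⟩
        by_cases hd : IsDiv Ω (avg (Metric.ball x r ∩ Ω) - avg V)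
        · exact Or.inl ⟨_, ⟨hp, hd⟩, hxm⟩
        · exact Or.inr ⟨_, ⟨hp, hd⟩, hxm⟩)
      (by
        obtain ⟨y, hy⟩ := hVne
        exact ⟨y, hV.subset hy, V, ⟨hV, meet hV hV (by simpa using ⟨y, hy⟩)⟩, hy⟩)
      (by
        obtain ⟨y, hy⟩ := hUne
        exact ⟨y, hU.subset hy, U, ⟨hU, hcon⟩, hy⟩)
  refine hWd' ?_
  have h := (meet hW' hW ⟨x, hxW', hxW⟩).add hWd
  simpa using h

/-- Every mean-zero function in `L²(Ω)` is the divergence of an `H₀¹` field. -/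
theorem isDiv_of_integral_eq_zero {Ω : Set (E d)} (hΩ : IsBoundedSmoothDomain Ω) {f : E d → ℝ}
    (hf : MemLp f 2 (vol Ω)) (hf0 : ∫ x in Ω, f x = 0) : IsDiv Ω f := by
  have hb := hΩ.isBounded
  have hfin : IsFiniteMeasure (vol Ω) := ⟨by
    rw [Measure.restrict_apply_univ]
    exact hb.measure_lt_top⟩
  obtain ⟨x₀, hx₀⟩ := hΩ.isConnected.nonempty
  obtain ⟨r₀, hr₀, hp₀⟩ := exists_isStarPatch_of_mem hΩ.isOpen hx₀
  set V := Metric.ball x₀ r₀ ∩ Ω with hV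
  have hVne : V.Nonempty := ⟨x₀, Metric.mem_ball_self hr₀, hx₀⟩
  choose! r hr hp using fun (x : E d) (hx : x ∈ closure Ω) => exists_isStarPatch hΩ hx
  obtain ⟨t, ht, htc⟩ := hb.isCompact_closure.elim_nhds_subcover (fun x => Metric.ball x (r x))
    fun x hx => Metric.ball_mem_nhds x (hr x hx)
  -- Induction on the number of patches: the part of `g` on the new patch `U` is removed, its mass
  -- is collected in `avg U` and then moved to the fixed reference patch `V`.
  have key : ∀ s : Finset (E d), (∀ x ∈ s, x ∈ closure Ω) → ∀ g : E d → ℝ, MemLp g 2 (vol Ω) →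
      (∀ x, x ∉ ⋃ y ∈ s, Metric.ball y (r y) ∩ Ω → g x = 0) →
      IsDiv Ω (g - (∫ x in Ω, g x) • avg V) := by
    intro s
    induction s using Finset.induction_on with
    | empty =>
      intro _ g _ hg0
      have : g = 0 := funext fun x => hg0 x (by simp)
      subst this
      -- The zero function is obtained as `avg V - avg V`.
      have h := hp₀.isDiv_avg_sub_avg hb hp₀.isOpen subset_rfl hVne
      simpa using h
    | insert y s _ ih =>
      intro hs g hg hg0
      have hy := hs y (Finset.mem_insert_self y s)
      set U := Metric.ball y (r y) ∩ Ω with hU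
      have hUp : IsStarPatch Ω U := hp y hy
      have hUm := hUp.isOpen.measurableSet
      have hUne : U.Nonempty :=
        mem_closure_iff.1 hy _ Metric.isOpen_ball (Metric.mem_ball_self (hr y hy))
      have h1 := hUp.isDiv_sub_avg hb hUp.isOpen subset_rfl hUne (hg.indicator hUm)
        (fun x hx => by simp [hx])
      have h2 := ih (fun x hx => hs x (Finset.mem_insert_of_mem hx)) (Uᶜ.indicator g)
        (hg.indicator hUm.compl) (fun x hx => by
          by_cases hxU : x ∈ U
          · simp [hxU]
          · rw [indicator_of_mem (by simpa using hxU)]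
            refine hg0 x ?_
            simp only [Finset.mem_insert, iUnion_iUnion_eq_or_left, mem_union, not_or]
            exact ⟨hxU, hx⟩)
      have h3 := (isDiv_avg_sub_avg hΩ hUp hp₀ hUne hVne).const_smul (∫ x in Ω, U.indicator g x)
      have hsum : (∫ x in Ω, U.indicator g x) + ∫ x in Ω, Uᶜ.indicator g x = ∫ x in Ω, g x := by
        rw [← integral_add ((hg.indicator hUm).integrable (by norm_num))
          ((hg.indicator hUm.compl).integrable (by norm_num))]
        refine integral_congr_ae (Eventually.of_forall fun x => ?_)
        exact congrFun (indicator_self_add_compl U g) x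
      have h4 := (h1.add h2).add h3
      convert h4 using 1
      rw [← hsum]
      funext x
      simp only [Pi.sub_apply, Pi.add_apply, Pi.smul_apply, smul_eq_mul]
      have hx : U.indicator g x + Uᶜ.indicator g x = g x :=
        congrFun (indicator_self_add_compl U g) x
      linear_combination -hx
  -- The covering argument needs vanishing at every point off the patches, so `f` is first set to
  -- zero outside `Ω`.
  have hg := hf.indicator hΩ.isOpen.measurableSet
  have h0 : ∫ x in Ω, Ω.indicator f x = 0 := by
    rw [setIntegral_indicator hΩ.isOpen.measurableSet, inter_self, hf0]
  have h := key t (fun x hx => ht x hx) (Ω.indicator f) hg fun x hx => by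
    refine indicator_of_notMem (fun hxΩ => hx ?_) _
    obtain ⟨y, hy, hxy⟩ := mem_iUnion₂.1 (htc (subset_closure hxΩ))
    exact mem_iUnion₂.2 ⟨y, hy, hxy, hxΩ⟩
  rw [h0, zero_smul, sub_zero] at h
  obtain ⟨h1, h2⟩ := h
  refine ⟨hf, ?_⟩
  convert h2 using 1
  refine MemLp.toLp_congr _ _ ?_
  filter_upwards [ae_restrict_mem hΩ.isOpen.measurableSet] with x hx
  simp [hx]

/-! ### Slicing in a coordinate direction and graph measures -/

/-- The point of `ℝ^(n+1)` with `i`-th coordinate `t` and remaining coordinates `y`. -/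
noncomputable def slicePoint (i : Fin (n + 1)) (t : ℝ) (y : Fin n → ℝ) : E (n + 1) :=
  WithLp.toLp 2 (i.insertNth t y)

/-- The projection forgetting the `i`-th coordinate. -/
noncomputable def sliceProj (i : Fin (n + 1)) (x : E (n + 1)) : Fin n → ℝ :=
  fun j => x (i.succAbove j)

theorem sliceProj_slicePoint (i : Fin (n + 1)) (t : ℝ) (y : Fin n → ℝ) :
    sliceProj i (slicePoint i t y) = y := by
  funext j
  simp [sliceProj, slicePoint]

theorem slicePoint_apply_self (i : Fin (n + 1)) (t : ℝ) (y : Fin n → ℝ) :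
    slicePoint i t y i = t := by
  simp [slicePoint]

theorem slicePoint_eq_add (i : Fin (n + 1)) (t : ℝ) (y : Fin n → ℝ) :
    slicePoint i t y = slicePoint i 0 y + t • EuclideanSpace.single i 1 := by
  ext j
  rcases Fin.eq_self_or_eq_succAbove i j with rfl | ⟨k, rfl⟩ <;> simp [slicePoint]

theorem hasDerivAt_slicePoint (i : Fin (n + 1)) (t : ℝ) (y : Fin n → ℝ) :
    HasDerivAt (fun t => slicePoint i t y) (EuclideanSpace.single i 1) t := by
  have e : (fun t => slicePoint i t y) = fun t => slicePoint i 0 y + t • EuclideanSpace.single i 1 :=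
    funext fun t => slicePoint_eq_add i t y
  rw [e]
  simpa using ((hasDerivAt_id t).smul_const (EuclideanSpace.single i (1 : ℝ))).const_add
    (slicePoint i 0 y)

theorem measurePreserving_slicePoint (i : Fin (n + 1)) :
    MeasurePreserving (fun q : ℝ × (Fin n → ℝ) => slicePoint i q.1 q.2)
      (volume.prod volume) volume :=
  (PiLp.volume_preserving_toLp (Fin (n + 1))).comp
    (volume_preserving_piFinSuccAbove (fun _ => ℝ) i).symm

theorem measurableEmbedding_slicePoint (i : Fin (n + 1)) :
    MeasurableEmbedding (fun q : ℝ × (Fin n → ℝ) => slicePoint i q.1 q.2) :=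
  (MeasurableEquiv.toLp 2 (Fin (n + 1) → ℝ)).measurableEmbedding.comp
    (MeasurableEquiv.piFinSuccAbove (fun _ => ℝ) i).symm.measurableEmbedding

theorem integral_eq_integral_slice (i : Fin (n + 1)) {F : E (n + 1) → ℝ} (hF : Integrable F) :
    ∫ x, F x = ∫ y, ∫ t, F (slicePoint i t y) := by
  rw [← (measurePreserving_slicePoint i).integral_comp (measurableEmbedding_slicePoint i)]
  exact integral_prod_symm _
    ((measurePreserving_slicePoint i).integrable_comp_emb (measurableEmbedding_slicePoint i) |>.2 hF)

theorem lipschitzWith_sliceProj (i : Fin (n + 1)) : LipschitzWith 1 (sliceProj i) := by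
  refine LipschitzWith.of_dist_le_mul fun x y => ?_
  rw [NNReal.coe_one, one_mul, dist_pi_le_iff dist_nonneg]
  intro j
  rw [dist_eq_norm]
  exact PiLp.norm_apply_le (x - y) (i.succAbove j)

/-- The open box with centre `x₀` and radius `r`. -/
def box (x₀ : E d) (r : ℝ) : Set (E d) := {x | ∀ j, |x j - x₀ j| < r}

theorem isOpen_box (x₀ : E d) (r : ℝ) : IsOpen (box x₀ r) := by
  simp only [box, ofPred_forall]
  exact isOpen_iInter_of_finite fun j => isOpen_lt (by fun_prop) continuous_const

theorem mem_box_self (x₀ : E d) {r : ℝ} (hr : 0 < r) : x₀ ∈ box x₀ r := fun j => by simpa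

/-- The upper end of the slices of `A` in the box. -/
noncomputable def sliceEnd (i : Fin (n + 1)) (a : ℝ) (A : Set (E (n + 1))) (y : Fin n → ℝ) : ℝ :=
  a + (volume {t : ℝ | slicePoint i t y ∈ A}).toReal

/-- The end is defined through the length of the slice, so its measurability is part of Fubini's
theorem and no implicit function is needed. -/
theorem measurable_sliceEnd (i : Fin (n + 1)) (a : ℝ) {A : Set (E (n + 1))}
    (hA : MeasurableSet A) : Measurable (sliceEnd i a A) := by
  have h1 : MeasurableSet ((fun q : ℝ × (Fin n → ℝ) => slicePoint i q.1 q.2) ⁻¹' A) :=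
    (measurableEmbedding_slicePoint i).measurable hA
  exact (measurable_measure_prodMk_right h1).ennreal_toReal.const_add a

/-- `A` is a part of the box whose slices in the `i`-th direction are initial segments. -/
structure IsLowerPart (i : Fin (n + 1)) (x₀ : E (n + 1)) (r : ℝ) (A : Set (E (n + 1))) : Prop where
  measurableSet : MeasurableSet A
  subset : A ⊆ box x₀ r
  lower : ∀ y s t, x₀ i - r < s → s ≤ t → slicePoint i t y ∈ A → slicePoint i s y ∈ A

theorem IsLowerPart.slice_subset {i : Fin (n + 1)} {x₀ : E (n + 1)} {r : ℝ} {A : Set (E (n + 1))}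
    (hA : IsLowerPart i x₀ r A) (y : Fin n → ℝ) :
    {t : ℝ | slicePoint i t y ∈ A} ⊆ Ioo (x₀ i - r) (x₀ i + r) := fun t ht => by
  have h := hA.subset ht i
  rw [slicePoint_apply_self, abs_lt] at h
  constructor <;> linarith

/-- A nonempty slice is an initial segment ending at its supremum, and its length identifies that
supremum with `sliceEnd`. An empty slice has length zero, and both intervals are then empty. -/
theorem IsLowerPart.slice_between {i : Fin (n + 1)} {x₀ : E (n + 1)} {r : ℝ} {A : Set (E (n + 1))}
    (hA : IsLowerPart i x₀ r A) (y : Fin n → ℝ) :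
    Ioo (x₀ i - r) (sliceEnd i (x₀ i - r) A y) ⊆ {t : ℝ | slicePoint i t y ∈ A} ∧
    {t : ℝ | slicePoint i t y ∈ A} ⊆ Ioc (x₀ i - r) (sliceEnd i (x₀ i - r) A y) := by
  set a := x₀ i - r with ha
  set S := {t : ℝ | slicePoint i t y ∈ A} with hS
  have hsub := hA.slice_subset y
  rcases S.eq_empty_or_nonempty with h0 | hne
  · simp [sliceEnd, ← hS, h0]
  have hbdd : BddAbove S := ⟨x₀ i + r, fun t ht => (hsub ht).2.le⟩
  have h1 : Ioo a (sSup S) ⊆ S := fun t ht => by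
    obtain ⟨s, hs, hts⟩ := exists_lt_of_lt_csSup hne ht.2
    exact hA.lower y t s ht.1 hts.le hs
  have h2 : S ⊆ Ioc a (sSup S) := fun t ht => ⟨(hsub ht).1, le_csSup hbdd ht⟩
  have h3 : volume S = ENNReal.ofReal (sSup S - a) := by
    refine le_antisymm ?_ ?_
    · rw [← Real.volume_Ioc]; exact measure_mono h2
    · rw [← Real.volume_Ioo]; exact measure_mono h1
  have h4 : a ≤ sSup S := by
    obtain ⟨t, ht⟩ := hne
    exact (h2 ht).1.le.trans (h2 ht).2
  have h5 : sliceEnd i a A y = sSup S := by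
    rw [sliceEnd, ← hS, h3, ENNReal.toReal_ofReal (by linarith)]
    ring
  rw [h5]
  exact ⟨h1, h2⟩

/-- Integration along slices: the integral of `∂ᵢ f` over a lower part of a box. -/
theorem IsLowerPart.integral_fderiv {i : Fin (n + 1)} {x₀ : E (n + 1)} {r : ℝ}
    {A : Set (E (n + 1))} (hA : IsLowerPart i x₀ r A) {f : E (n + 1) → ℝ} (hf : IsTest f)
    (hfr : tsupport f ⊆ box x₀ r) :
    ∫ x in A, fderiv ℝ f x (EuclideanSpace.single i 1) =
      ∫ y, f (slicePoint i (sliceEnd i (x₀ i - r) A y) y) := by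
  have hft := hf.fderiv_apply (EuclideanSpace.single i 1)
  have hint : Integrable fun x => fderiv ℝ f x (EuclideanSpace.single i 1) :=
    hft.smooth.continuous.integrable_of_hasCompactSupport hft.compact
  rw [← integral_indicator hA.measurableSet,
    integral_eq_integral_slice i (hint.indicator hA.measurableSet)]
  congr 1
  ext1 y
  set a := x₀ i - r with ha
  set b := sliceEnd i a A y with hb
  obtain ⟨h1, h2⟩ := hA.slice_between y
  rw [← ha, ← hb] at h1 h2
  have hab : a ≤ b := by
    rw [hb, sliceEnd]
    linarith [ENNReal.toReal_nonneg (a := volume {t : ℝ | slicePoint i t y ∈ A})]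
  have hae : {t : ℝ | slicePoint i t y ∈ A} =ᵐ[volume] Ioc a b :=
    (LE.le.eventuallyLE h2).antisymm
      ((Ioo_ae_eq_Ioc.symm.le).trans (LE.le.eventuallyLE h1))
  have hms : MeasurableSet {t : ℝ | slicePoint i t y ∈ A} :=
    ((measurableEmbedding_slicePoint i).measurable hA.measurableSet).preimage
      (measurable_prodMk_right (y := y))
  have e1 : (fun t => A.indicator (fun x => fderiv ℝ f x (EuclideanSpace.single i 1))
      (slicePoint i t y)) = {t : ℝ | slicePoint i t y ∈ A}.indicator fun t =>
      fderiv ℝ f (slicePoint i t y) (EuclideanSpace.single i 1) := rfl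
  have hd : ∀ t, HasDerivAt (fun t => f (slicePoint i t y))
      (fderiv ℝ f (slicePoint i t y) (EuclideanSpace.single i 1)) t := fun t =>
    (hf.smooth.differentiable (by simp) _).hasFDerivAt.comp_hasDerivAt t
      (hasDerivAt_slicePoint i t y)
  have hcont : Continuous fun t => fderiv ℝ f (slicePoint i t y) (EuclideanSpace.single i 1) :=
    hft.smooth.continuous.comp
      (continuous_iff_continuousAt.2 fun t => (hasDerivAt_slicePoint i t y).continuousAt)
  -- The lower end lies on a face of the open box, outside the support of `f`, so only the upper end
  -- contributes.
  have h0 : f (slicePoint i a y) = 0 := by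
    refine image_eq_zero_of_notMem_tsupport fun h => ?_
    have := hfr h i
    rw [slicePoint_apply_self, ha, abs_lt] at this
    linarith
  rw [e1, integral_indicator hms, setIntegral_congr_set hae,
    ← intervalIntegral.integral_of_le hab,
    intervalIntegral.integral_eq_sub_of_hasDerivAt (fun t _ => hd t)
      (hcont.intervalIntegrable _ _), h0, sub_zero]

/-- Along the slice, points just below the end belong to `A`, while points just above it are in the
box but not in `A`. -/
theorem IsLowerPart.mem_closure {i : Fin (n + 1)} {x₀ : E (n + 1)} {r : ℝ}
    {A : Set (E (n + 1))} (hA : IsLowerPart i x₀ r A) {y : Fin n → ℝ}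
    (h : slicePoint i (sliceEnd i (x₀ i - r) A y) y ∈ box x₀ r) :
    slicePoint i (sliceEnd i (x₀ i - r) A y) y ∈ closure A ∩ closure (box x₀ r \ A) := by
  set a := x₀ i - r with ha
  set b := sliceEnd i a A y with hb
  obtain ⟨h1, h2⟩ := hA.slice_between y
  rw [← ha, ← hb] at h1 h2
  have hbi := h i
  rw [slicePoint_apply_self, abs_lt] at hbi
  have hc : Continuous fun t => slicePoint i t y :=
    continuous_iff_continuousAt.2 fun t => (hasDerivAt_slicePoint i t y).continuousAt
  have hab : a < b := by linarith
  constructor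
  · refine mem_closure_of_tendsto ((hc.tendsto b).mono_left (nhdsWithin_le_nhds (s := Iio b))) ?_
    filter_upwards [Ioo_mem_nhdsLT hab] with t ht using h1 ht
  · refine mem_closure_of_tendsto ((hc.tendsto b).mono_left (nhdsWithin_le_nhds (s := Ioi b))) ?_
    filter_upwards [self_mem_nhdsWithin,
      nhdsWithin_le_nhds (hc.continuousAt.preimage_mem_nhds ((isOpen_box x₀ r).mem_nhds h))]
      with t ht ht2
    exact ⟨ht2, fun h3 => absurd (h2 h3).2 (not_le.2 ht)⟩

theorem exists_box_subset {x₀ : E d} {S : Set (E d)} (hS : S ∈ 𝓝 x₀) :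
    ∃ r > 0, box x₀ r ⊆ S := by
  have h1 : (fun y : Fin d → ℝ => (WithLp.toLp 2 y : E d)) ⁻¹' S ∈ 𝓝 (WithLp.ofLp x₀) :=
    (PiLp.continuous_toLp 2 fun _ : Fin d => ℝ).continuousAt.preimage_mem_nhds (by simpa using hS)
  obtain ⟨r, hr, h⟩ := Metric.mem_nhds_iff.1 h1
  refine ⟨r, hr, fun x hx => ?_⟩
  have h2 : WithLp.ofLp x ∈ Metric.ball (WithLp.ofLp x₀) r := by
    rw [Metric.mem_ball, dist_pi_lt_iff hr]
    exact fun j => hx j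
  exact h h2

theorem convex_box (x₀ : E d) (r : ℝ) : Convex ℝ (box x₀ r) := by
  intro x hx y hy a b ha hb hab j
  exact convex_ball (x₀ j) r (hx j) (hy j) ha hb hab

theorem slicePoint_mem_box {i : Fin (n + 1)} {x₀ : E (n + 1)} {r s t : ℝ} {y : Fin n → ℝ}
    (hs : x₀ i - r < s) (hst : s ≤ t) (ht : slicePoint i t y ∈ box x₀ r) :
    slicePoint i s y ∈ box x₀ r := by
  intro j
  have h := ht j
  rcases Fin.eq_self_or_eq_succAbove i j with rfl | ⟨k, rfl⟩
  · rw [slicePoint_apply_self, abs_lt] at h ⊢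
    constructor <;> linarith
  · simpa [slicePoint] using h

/-- The graph map of the upper boundary of a lower part. -/
noncomputable def graphMap (i : Fin (n + 1)) (a : ℝ) (A : Set (E (n + 1))) (y : Fin n → ℝ) :
    E (n + 1) := slicePoint i (sliceEnd i a A y) y

theorem measurable_graphMap (i : Fin (n + 1)) (a : ℝ) {A : Set (E (n + 1))}
    (hA : MeasurableSet A) : Measurable (graphMap i a A) :=
  (measurableEmbedding_slicePoint i).measurable.comp
    ((measurable_sliceEnd i a hA).prodMk measurable_id)

/-- The measure on the upper boundary of a lower part given by Lebesgue measure on its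
projection. -/
noncomputable def graphMeasure (i : Fin (n + 1)) (x₀ : E (n + 1)) (r : ℝ)
    (A : Set (E (n + 1))) : Measure (E (n + 1)) :=
  ((volume : Measure (Fin n → ℝ)).restrict (graphMap i (x₀ i - r) A ⁻¹' box x₀ r)).map
    (graphMap i (x₀ i - r) A)

theorem sliceProj_mem_ball {i : Fin (n + 1)} {x₀ x : E (n + 1)} {r : ℝ} (hr : 0 < r)
    (hx : x ∈ box x₀ r) : sliceProj i x ∈ Metric.ball (sliceProj i x₀) r := by
  rw [Metric.mem_ball, dist_pi_lt_iff hr]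
  exact fun j => hx (i.succAbove j)

theorem isFiniteMeasure_graphMeasure (i : Fin (n + 1)) (x₀ : E (n + 1)) {r : ℝ} (hr : 0 < r)
    (A : Set (E (n + 1))) : IsFiniteMeasure (graphMeasure i x₀ r A) := by
  have h : IsFiniteMeasure ((volume : Measure (Fin n → ℝ)).restrict
      (graphMap i (x₀ i - r) A ⁻¹' box x₀ r)) := by
    refine ⟨?_⟩
    rw [Measure.restrict_apply_univ]
    refine (measure_mono fun y hy => ?_).trans_lt
      (measure_ball_lt_top (x := sliceProj i x₀) (r := r))
    have h1 := sliceProj_mem_ball (i := i) hr hy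
    rwa [graphMap, sliceProj_slicePoint] at h1
  exact Measure.isFiniteMeasure_map _ _

theorem integral_graphMeasure {i : Fin (n + 1)} {x₀ : E (n + 1)} {r : ℝ}
    {A : Set (E (n + 1))} (hA : MeasurableSet A) {f : E (n + 1) → ℝ} (hf : Continuous f)
    (hfr : tsupport f ⊆ box x₀ r) :
    ∫ x, f x ∂graphMeasure i x₀ r A = ∫ y, f (graphMap i (x₀ i - r) A y) := by
  have hG := measurable_graphMap i (x₀ i - r) hA
  rw [graphMeasure, integral_map hG.aemeasurable hf.aestronglyMeasurable]
  refine setIntegral_eq_integral_of_forall_compl_eq_zero fun y hy => ?_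
  exact image_eq_zero_of_notMem_tsupport fun h => hy (hfr h)

/-- Forgetting a coordinate is `1`-Lipschitz into `Fin n → ℝ` with the supremum norm, where the
`n`-dimensional Hausdorff measure is Lebesgue measure. The projected area is therefore at most the
surface measure. -/
theorem graphMeasure_le_surface {i : Fin (n + 1)} {x₀ : E (n + 1)} {r : ℝ}
    {A Ω : Set (E (n + 1))} (hA : IsLowerPart i x₀ r A)
    (hΩ : box x₀ r ∩ closure A ∩ closure (box x₀ r \ A) ⊆ frontier Ω) :
    graphMeasure i x₀ r A ≤ surface Ω := by
  have hG := measurable_graphMap i (x₀ i - r) hA.measurableSet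
  refine Measure.le_iff.2 fun s hs => ?_
  rw [graphMeasure, Measure.map_apply hG hs, Measure.restrict_apply (hG hs),
    Measure.restrict_apply hs]
  have h1 : graphMap i (x₀ i - r) A ⁻¹' s ∩ graphMap i (x₀ i - r) A ⁻¹' box x₀ r ⊆
      sliceProj i '' (s ∩ frontier Ω) := by
    rintro y ⟨hy1, hy2⟩
    refine ⟨graphMap i (x₀ i - r) A y, ⟨hy1, hΩ ?_⟩, sliceProj_slicePoint _ _ _⟩
    have := hA.mem_closure hy2
    exact ⟨⟨hy2, this.1⟩, this.2⟩
  refine (measure_mono h1).trans ?_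
  have h2 := (lipschitzWith_sliceProj i).hausdorffMeasure_image_le (d := n) (by positivity)
    (s ∩ frontier Ω)
  have h3 : (Measure.hausdorffMeasure (n : ℝ) : Measure (Fin n → ℝ)) = volume := by
    simpa using hausdorffMeasure_pi_real (ι := Fin n)
  rw [h3] at h2
  simpa using h2

/-! ### Defining functions at boundary points -/

theorem IsLocalDefiningFunction.of_mem {Ω U : Set (E d)} {x y : E d} {ρ : E d → ℝ}
    (h : IsLocalDefiningFunction Ω x U ρ) (hy : y ∈ U) : IsLocalDefiningFunction Ω y U ρ :=
  ⟨h.isOpen, hy, h.smooth, h.gradient_ne_zero, h.mem_iff⟩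

theorem IsLocalDefiningFunction.eq_zero {Ω U : Set (E d)} {x y : E d} {ρ : E d → ℝ}
    (h : IsLocalDefiningFunction Ω x U ρ) (hΩ : IsOpen Ω) (hy : y ∈ U) (hyf : y ∈ frontier Ω) :
    ρ y = 0 := by
  rw [hΩ.frontier_eq] at hyf
  refine le_antisymm ?_ (not_lt.1 fun h1 => hyf.2 ((h.mem_iff y hy).2 h1))
  by_contra! h1
  have h2 : ∀ᶠ z in 𝓝 y, z ∈ U ∧ 0 < ρ z :=
    Filter.Eventually.and (h.isOpen.mem_nhds hy) ((h.differentiableAt hy).continuousAt.eventually_const_lt h1)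
  obtain ⟨z, ⟨hz1, hz2⟩, hz3⟩ := mem_closure_iff_nhds.1 hyf.1 _ h2
  exact absurd ((h.mem_iff z hz1).1 hz3) hz2.not_gt

/-- Moving in a direction of negative slope of a defining function leads into the domain. -/
theorem IsLocalDefiningFunction.eventually_mem {Ω U : Set (E d)} {x v : E d} {ρ : E d → ℝ}
    (h : IsLocalDefiningFunction Ω x U ρ) (hx : ρ x = 0) (hv : ⟪v, gradient ρ x⟫ < 0) :
    ∀ᶠ t in 𝓝[>] (0 : ℝ), x + t • v ∈ Ω := by
  have h1 : HasDerivAt (fun s : ℝ => ρ (x + s • v)) ⟪v, gradient ρ x⟫ 0 := by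
    simpa using h.hasDerivAt_line (y := x) (v := v) (s := 0) (by simpa using h.mem)
  have hc : ContinuousAt (fun t : ℝ => x + t • v) 0 := by fun_prop
  have h2 : ∀ᶠ t in 𝓝 (0 : ℝ), x + t • v ∈ U :=
    hc.preimage_mem_nhds (by simpa using h.isOpen.mem_nhds h.mem)
  have h3 := h1.tendsto_slope_zero_right
  filter_upwards [h3.eventually_lt_const hv, nhdsWithin_le_nhds h2, self_mem_nhdsWithin]
    with t ht htU ht0
  rw [h.mem_iff _ htU]
  simp only [zero_add, zero_smul, add_zero, hx, sub_zero, smul_eq_mul] at ht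
  exact neg_of_mul_neg_right ht (inv_nonneg.2 (le_of_lt ht0))

theorem IsLocalDefiningFunction.eventually_notMem {Ω U : Set (E d)} {x v : E d} {ρ : E d → ℝ}
    (h : IsLocalDefiningFunction Ω x U ρ) (hx : ρ x = 0) (hv : 0 < ⟪v, gradient ρ x⟫) :
    ∀ᶠ t in 𝓝[>] (0 : ℝ), x + t • v ∉ closure Ω := by
  have h1 : HasDerivAt (fun s : ℝ => ρ (x + s • v)) ⟪v, gradient ρ x⟫ 0 := by
    simpa using h.hasDerivAt_line (y := x) (v := v) (s := 0) (by simpa using h.mem)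
  have hc : ContinuousAt (fun t : ℝ => x + t • v) 0 := by fun_prop
  have h2 : ∀ᶠ t in 𝓝 (0 : ℝ), x + t • v ∈ U :=
    hc.preimage_mem_nhds (by simpa using h.isOpen.mem_nhds h.mem)
  have h3 := h1.tendsto_slope_zero_right
  filter_upwards [h3.eventually_const_lt hv, nhdsWithin_le_nhds h2, self_mem_nhdsWithin]
    with t ht htU ht0 hcl
  simp only [zero_add, zero_smul, add_zero, hx, sub_zero, smul_eq_mul] at ht
  have h4 : 0 < ρ (x + t • v) := pos_of_mul_pos_right ht (inv_nonneg.2 (le_of_lt ht0))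
  have h5 : ∀ᶠ z in 𝓝 (x + t • v), z ∈ U ∧ 0 < ρ z :=
    Filter.Eventually.and (h.isOpen.mem_nhds htU) ((h.differentiableAt htU).continuousAt.eventually_const_lt h4)
  obtain ⟨z, ⟨hz1, hz2⟩, hz3⟩ := mem_closure_iff_nhds.1 hcl _ h5
  exact absurd ((h.mem_iff z hz1).1 hz3) hz2.not_gt

/-- The gradients of two local defining functions are parallel on the boundary. -/
theorem IsLocalDefiningFunction.inner_gradient_eq_zero {Ω U V : Set (E d)} {x w : E d}
    {ρ σ : E d → ℝ} (h : IsLocalDefiningFunction Ω x U ρ) (h' : IsLocalDefiningFunction Ω x V σ)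
    (hΩ : IsOpen Ω) (hx : x ∈ frontier Ω) (hw : ⟪w, gradient σ x⟫ = 0) :
    ⟪w, gradient ρ x⟫ = 0 := by
  have key : ∀ w : E d, ⟪w, gradient σ x⟫ = 0 → ⟪w, gradient ρ x⟫ ≤ 0 := by
    intro w hw
    by_contra! hpos
    have hs : 0 < ⟪gradient σ x, gradient σ x⟫ :=
      real_inner_self_pos.2 (h'.gradient_ne_zero x h'.mem)
    have hc : Tendsto (fun c : ℝ => ⟪w - c • gradient σ x, gradient ρ x⟫) (𝓝[>] 0)
        (𝓝 ⟪w, gradient ρ x⟫) := by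
      have : Continuous fun c : ℝ => ⟪w - c • gradient σ x, gradient ρ x⟫ := by fun_prop
      simpa using (this.tendsto 0).mono_left (nhdsWithin_le_nhds (s := Ioi 0))
    -- Tilting `w` slightly against the gradient of `σ` makes it point into `Ω` by the test with
    -- `σ`, while by continuity it still points out of the closure by the test with `ρ`.
    obtain ⟨c, hc1, hc2⟩ := ((hc.eventually_const_lt hpos).and self_mem_nhdsWithin).exists
    have h1 : ⟪w - c • gradient σ x, gradient σ x⟫ < 0 := by
      rw [inner_sub_left, hw, real_inner_smul_left, zero_sub]
      exact neg_neg_of_pos (mul_pos hc2 hs)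
    obtain ⟨t, ht1, ht2⟩ := ((h'.eventually_mem (h'.eq_zero hΩ h'.mem hx) h1).and
      (h.eventually_notMem (h.eq_zero hΩ h.mem hx) hc1)).exists
    exact ht2 (subset_closure ht1)
  refine le_antisymm (key w hw) ?_
  have h1 := key (-w) (by rw [inner_neg_left, hw, neg_zero])
  rw [inner_neg_left] at h1
  linarith

/-! ### The local divergence theorem -/

theorem tsupport_fderiv_apply_subset (f : E d → ℝ) (v : E d) :
    tsupport (fun x => fderiv ℝ f x v) ⊆ tsupport f :=
  closure_minimal (fun x hx => by
    by_contra h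
    exact hx (by simp [fderiv_eq_zero_of_notMem_tsupport h])) (isClosed_tsupport f)

theorem IsTest.integrable {f : E d → ℝ} (hf : IsTest f) : Integrable f :=
  hf.smooth.continuous.integrable_of_hasCompactSupport hf.compact

theorem IsTest.sum {ι : Type*} {s : Finset ι} {f : ι → E d → ℝ} (hf : ∀ j ∈ s, IsTest (f j)) :
    IsTest fun x => ∑ j ∈ s, f j x := by
  classical
  induction s using Finset.induction_on with
  | empty => simpa using isTest_zero
  | insert j s hj ih =>
    simp only [Finset.sum_insert hj]
    exact (hf j (Finset.mem_insert_self _ _)).add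
      (ih fun k hk => hf k (Finset.mem_insert_of_mem hk))

/-- The product of a test function and a function that is smooth near its support. -/
theorem IsTest.mul_of_contDiffOn {f g : E d → ℝ} (hf : IsTest f) {U : Set (E d)} (hU : IsOpen U)
    (hg : ContDiffOn ℝ ∞ g U) (hfU : tsupport f ⊆ U) : IsTest fun x => f x * g x := by
  refine ⟨contDiff_iff_contDiffAt.2 fun x => ?_, hf.compact.mul_right⟩
  by_cases hx : x ∈ U
  · exact hf.smooth.contDiffAt.mul (hg.contDiffAt (hU.mem_nhds hx))
  · have h1 : (fun x => f x * g x) =ᶠ[𝓝 x] fun _ => 0 := by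
      filter_upwards [(isClosed_tsupport f).isOpen_compl.mem_nhds fun h => hx (hfU h)] with y hy
      rw [image_eq_zero_of_notMem_tsupport hy, zero_mul]
    exact contDiffAt_const.congr_of_eventuallyEq h1

/-- The divergence theorem for smooth fields tangential to the level sets of a defining
function. -/
theorem IsLocalDefiningFunction.integral_div_eq_zero {Ω U : Set (E d)} {x₀ : E d} {ρ : E d → ℝ}
    (h : IsLocalDefiningFunction Ω x₀ U ρ) (hΩ : IsOpen Ω) {v : Fin d → E d → ℝ}
    (hv : ∀ j, IsTest (v j)) (hvU : ∀ j, tsupport (v j) ⊆ U)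
    (hvρ : ∀ x ∈ U, ∑ j, v j x * gradient ρ x j = 0) :
    ∫ x in Ω, ∑ j, fderiv ℝ (v j) x (EuclideanSpace.single j 1) = 0 := by
  set D : E d → ℝ := fun x => ∑ j, fderiv ℝ (v j) x (EuclideanSpace.single j 1) with hD
  have hDt : IsTest D := IsTest.sum fun j _ => (hv j).fderiv_apply _
  have hD0 : ∀ x ∉ U, D x = 0 := fun x hx => Finset.sum_eq_zero fun j _ => by
    simp [fderiv_eq_zero_of_notMem_tsupport fun h => hx (hvU j h)]
  -- These cutoffs vanish on `U` outside `Ω` and tend to one inside. As functions of `ρ` their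
  -- gradients are orthogonal to `v`, so the divergence of `v η` is exactly `D η`, and there is no
  -- boundary layer term in the limit.
  set η : ℕ → E d → ℝ := fun k x => Real.smoothTransition (-(k * ρ x)) with hη
  have hηs : ∀ k, ContDiffOn ℝ ∞ (η k) U := fun k =>
    (Real.smoothTransition.contDiff (n := ⊤)).comp_contDiffOn
      (contDiffOn_const.mul h.smooth).neg
  have hprod : ∀ k j, IsTest fun x => v j x * η k x := fun k j =>
    (hv j).mul_of_contDiffOn h.isOpen (hηs k) (hvU j)
  have hzero : ∀ k, ∫ x, D x * η k x = 0 := fun k => by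
    have e : (fun x => D x * η k x) = fun x => ∑ j, fderiv ℝ (fun x => v j x * η k x) x
        (EuclideanSpace.single j 1) := by
      funext x
      by_cases hx : x ∈ U
      · set s := deriv Real.smoothTransition (-(k * ρ x)) with hs
        have h1 : HasFDerivAt (η k) (s • -((k : ℝ) • fderiv ℝ ρ x)) x := by
          have h2 : HasDerivAt Real.smoothTransition s (-(k * ρ x)) :=
            ((Real.smoothTransition.contDiff (n := 1)).differentiable (by simp) _).hasDerivAt
          exact h2.comp_hasFDerivAt x ((h.differentiableAt hx).hasFDerivAt.const_mul (k : ℝ)).neg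
        have h3 : ∀ j, fderiv ℝ (fun x => v j x * η k x) x (EuclideanSpace.single j 1) =
            fderiv ℝ (v j) x (EuclideanSpace.single j 1) * η k x -
              s * k * (v j x * gradient ρ x j) := fun j => by
          rw [(((hv j).smooth.differentiable (by simp) x).hasFDerivAt.fun_mul h1).fderiv,
            gradient_apply]
          simp only [add_apply, smul_apply, neg_apply, smul_eq_mul]
          ring
        rw [Finset.sum_congr rfl fun j _ => h3 j, Finset.sum_sub_distrib, ← Finset.mul_sum,
          hvρ x hx, ← Finset.sum_mul, mul_zero, sub_zero]
      · rw [hD0 x hx, zero_mul]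
        refine (Finset.sum_eq_zero fun j _ => ?_).symm
        rw [fderiv_eq_zero_of_notMem_tsupport, zero_apply]
        exact fun h => hx (hvU j (tsupport_mul_subset_left h))
    rw [e, integral_finsetSum]
    · exact Finset.sum_eq_zero fun j _ =>
        integral_fderiv_apply_eq_zero ((hprod k j).smooth.of_le (by simp)) (hprod k j).compact _
    · exact fun j _ => ((hprod k j).fderiv_apply _).integrable
  have hlim : Tendsto (fun k => ∫ x, D x * η k x) atTop (𝓝 (∫ x, Ω.indicator D x)) := by
    refine tendsto_integral_of_dominated_convergence (fun x => |D x|) ?_ hDt.integrable.abs ?_ ?_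
    · intro k
      have h1 : IsTest fun x => ∑ j, fderiv ℝ (v j) x (EuclideanSpace.single j 1) * η k x :=
        IsTest.sum fun j _ => ((hv j).fderiv_apply _).mul_of_contDiffOn h.isOpen (hηs k)
          ((tsupport_fderiv_apply_subset _ _).trans (hvU j))
      simp only [← Finset.sum_mul] at h1
      exact h1.smooth.continuous.aestronglyMeasurable
    · refine fun k => Eventually.of_forall fun x => ?_
      rw [Real.norm_eq_abs, abs_mul, abs_of_nonneg (Real.smoothTransition.nonneg _)]
      exact mul_le_of_le_one_right (abs_nonneg _) (Real.smoothTransition.le_one _)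
    · refine Eventually.of_forall fun x => ?_
      by_cases hx : x ∈ U
      · by_cases hxΩ : x ∈ Ω
        · rw [indicator_of_mem hxΩ]
          have h1 := (h.mem_iff x hx).1 hxΩ
          obtain ⟨K, hK⟩ := exists_nat_gt (1 / -ρ x)
          refine tendsto_const_nhds.congr' ?_
          filter_upwards [eventually_ge_atTop K] with k hk
          have h2 : (1 : ℝ) ≤ -(k * ρ x) := by
            have h3 : 1 / -ρ x ≤ k := hK.le.trans (by exact_mod_cast hk)
            rw [div_le_iff₀ (by linarith)] at h3
            linarith
          simp only [hη]
          rw [Real.smoothTransition.one_of_one_le h2, mul_one]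
        · rw [indicator_of_notMem hxΩ]
          have h1 : 0 ≤ ρ x := not_lt.1 fun h1 => hxΩ ((h.mem_iff x hx).2 h1)
          refine tendsto_const_nhds.congr fun k => ?_
          simp only [hη]
          rw [Real.smoothTransition.zero_of_nonpos (by
            have := mul_nonneg (Nat.cast_nonneg (α := ℝ) k) h1; linarith), mul_zero]
      · have h1 : Ω.indicator D x = 0 := by
          by_cases hxΩ : x ∈ Ω <;> simp [hxΩ, hD0 x hx]
        rw [h1]
        simp [hD0 x hx]
  simp only [hzero] at hlim
  rw [← integral_indicator hΩ.measurableSet]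
  exact (tendsto_nhds_unique hlim tendsto_const_nhds)

theorem exists_gradient_apply_ne_zero {ρ : E d → ℝ} {x : E d} (h : gradient ρ x ≠ 0) :
    ∃ i, gradient ρ x i ≠ 0 := by
  by_contra! h1
  exact h (by ext i; simpa using h1 i)

/-- The sign `s` allows both orientations of the boundary relative to the `i`-th axis; in either
case `s * ρ` has positive derivative along the slice. -/
theorem mul_slicePoint_le_mul_slicePoint {Ω U : Set (E (n + 1))} {x₀ : E (n + 1)} {ρ : E (n + 1) → ℝ}
    (h : IsLocalDefiningFunction Ω x₀ U ρ) {i : Fin (n + 1)} {r : ℝ} (hrU : box x₀ r ⊆ U)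
    {s : ℝ} (hs : ∀ x ∈ box x₀ r, 0 < s * gradient ρ x i) {y : Fin n → ℝ} {t t' : ℝ}
    (ht : x₀ i - r < t) (htt : t ≤ t') (ht' : slicePoint i t' y ∈ box x₀ r) :
    s * ρ (slicePoint i t y) ≤ s * ρ (slicePoint i t' y) := by
  have hd : ∀ τ ∈ Icc t t', HasDerivAt (fun τ => s * ρ (slicePoint i τ y))
      (s * gradient ρ (slicePoint i τ y) i) τ := fun τ hτ => by
    have h1 := slicePoint_mem_box (ht.trans_le hτ.1) hτ.2 ht'
    rw [gradient_apply]
    exact ((h.differentiableAt (hrU h1)).hasFDerivAt.comp_hasDerivAt τ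
      (hasDerivAt_slicePoint i τ y)).const_mul s
  have hm : MonotoneOn (fun τ => s * ρ (slicePoint i τ y)) (Icc t t') :=
    monotoneOn_of_deriv_nonneg (convex_Icc t t')
      (fun τ hτ => (hd τ hτ).continuousAt.continuousWithinAt)
      (fun τ hτ => (hd τ (interior_subset hτ)).differentiableAt.differentiableWithinAt)
      (fun τ hτ => by
        have hτ' := interior_subset hτ
        rw [(hd τ hτ').deriv]
        exact (hs _ (slicePoint_mem_box (ht.trans_le hτ'.1) hτ'.2 ht')).le)
  exact hm ⟨le_rfl, htt⟩ ⟨htt, le_rfl⟩ htt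

/-- In a suitable box around a boundary point, the integral over `Ω` of a partial derivative is a
boundary integral. -/
theorem IsLocalDefiningFunction.exists_boundary_measure {Ω U : Set (E (n + 1))} {x₀ : E (n + 1)}
    {ρ : E (n + 1) → ℝ} (h : IsLocalDefiningFunction Ω x₀ U ρ) (hΩ : IsOpen Ω) :
    ∃ (i : Fin (n + 1)) (r s : ℝ) (ν : Measure (E (n + 1))), 0 < r ∧ box x₀ r ⊆ U ∧
      (∀ x ∈ box x₀ r, gradient ρ x i ≠ 0) ∧ IsFiniteMeasure ν ∧ ν ≤ surface Ω ∧
      ∀ f, IsTest f → tsupport f ⊆ box x₀ r →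
        ∫ x in Ω, fderiv ℝ f x (EuclideanSpace.single i 1) = s * ∫ x, f x ∂ν := by
  obtain ⟨i, hi⟩ := exists_gradient_apply_ne_zero (h.gradient_ne_zero x₀ h.mem)
  have hcont : ContinuousAt (fun x => gradient ρ x i) x₀ :=
    (EuclideanSpace.proj i : E (n + 1) →L[ℝ] ℝ).continuous.continuousAt.comp
      (h.contDiffOn_gradient.continuousOn.continuousAt (h.isOpen.mem_nhds h.mem))
  have hmono : ∀ s : ℝ, 0 < s * gradient ρ x₀ i → ∃ r > 0, box x₀ r ⊆ U ∧
      ∀ x ∈ box x₀ r, 0 < s * gradient ρ x i := fun s hs => by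
    obtain ⟨r, hr, h1⟩ := exists_box_subset (Filter.Eventually.and (h.isOpen.mem_nhds h.mem)
      ((hcont.const_mul s).eventually_const_lt hs))
    exact ⟨r, hr, fun x hx => (h1 hx).1, fun x hx => (h1 hx).2⟩
  -- If the partial derivative is negative, `Ω` lies on the upper side, so the lower part is its
  -- complement in the box. The sign `-1` arises because the integral of the derivative over the
  -- whole space is zero. In the other case the lower part is `Ω` itself.
  rcases lt_or_gt_of_ne hi with hneg | hpos
  · obtain ⟨r, hr, hrU, hs⟩ := hmono (-1) (by linarith)
    have hA : IsLowerPart i x₀ r (box x₀ r \ Ω) := by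
      refine ⟨(isOpen_box x₀ r).measurableSet.diff hΩ.measurableSet, sdiff_subset, ?_⟩
      intro y t t' ht htt ht'
      have h1 := slicePoint_mem_box ht htt ht'.1
      refine ⟨h1, fun h2 => ht'.2 ?_⟩
      rw [h.mem_iff _ (hrU h1)] at h2
      rw [h.mem_iff _ (hrU ht'.1)]
      have := mul_slicePoint_le_mul_slicePoint h hrU hs ht htt ht'.1
      linarith
    refine ⟨i, r, -1, graphMeasure i x₀ r (box x₀ r \ Ω), hr, hrU,
      fun x hx h0 => by simpa [h0] using hs x hx, isFiniteMeasure_graphMeasure i x₀ hr _,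
      graphMeasure_le_surface hA ?_, fun f hf hfr => ?_⟩
    · rintro x ⟨⟨_, hx1⟩, hx2⟩
      rw [frontier_eq_closure_inter_closure]
      refine ⟨closure_mono ?_ hx2, closure_mono (fun z hz => hz.2) hx1⟩
      exact fun z hz => by_contra fun h1 => hz.2 ⟨hz.1, h1⟩
    · rw [integral_graphMeasure hA.measurableSet hf.smooth.continuous hfr]
      have h1 := hA.integral_fderiv hf hfr
      have h2 : ∫ x, fderiv ℝ f x (EuclideanSpace.single i 1) = 0 :=
        integral_fderiv_apply_eq_zero (hf.smooth.of_le (by simp)) hf.compact _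
      have h3 := integral_add_compl hΩ.measurableSet
        (hf.fderiv_apply (EuclideanSpace.single i 1)).integrable
      have h4 : ∫ x in Ωᶜ, fderiv ℝ f x (EuclideanSpace.single i 1) =
          ∫ x in box x₀ r \ Ω, fderiv ℝ f x (EuclideanSpace.single i 1) := by
        refine setIntegral_eq_of_subset_of_forall_sdiff_eq_zero hΩ.measurableSet.compl
          (fun z hz => hz.2) fun x hx => ?_
        rw [fderiv_eq_zero_of_notMem_tsupport fun h => hx.2 ⟨hfr h, hx.1⟩, zero_apply]
      rw [h2, h4, h1] at h3
      simp only [graphMap]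
      linarith
  · obtain ⟨r, hr, hrU, hs⟩ := hmono 1 (by linarith)
    have hA : IsLowerPart i x₀ r (box x₀ r ∩ Ω) := by
      refine ⟨(isOpen_box x₀ r).measurableSet.inter hΩ.measurableSet, inter_subset_left, ?_⟩
      intro y t t' ht htt ht'
      have h1 := slicePoint_mem_box ht htt ht'.1
      refine ⟨h1, ?_⟩
      have h2 := ht'.2
      rw [h.mem_iff _ (hrU ht'.1)] at h2
      rw [h.mem_iff _ (hrU h1)]
      have := mul_slicePoint_le_mul_slicePoint h hrU hs ht htt ht'.1
      linarith
    refine ⟨i, r, 1, graphMeasure i x₀ r (box x₀ r ∩ Ω), hr, hrU,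
      fun x hx h0 => by simpa [h0] using hs x hx, isFiniteMeasure_graphMeasure i x₀ hr _,
      graphMeasure_le_surface hA ?_, fun f hf hfr => ?_⟩
    · rintro x ⟨⟨_, hx1⟩, hx2⟩
      rw [frontier_eq_closure_inter_closure]
      exact ⟨closure_mono (fun z hz => hz.2) hx1,
        closure_mono (fun z hz h1 => hz.2 ⟨hz.1, h1⟩) hx2⟩
    · rw [integral_graphMeasure hA.measurableSet hf.smooth.continuous hfr, one_mul]
      refine Eq.trans ?_ (hA.integral_fderiv hf hfr)
      refine setIntegral_eq_of_subset_of_forall_sdiff_eq_zero hΩ.measurableSet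
        inter_subset_right fun x hx => ?_
      rw [fderiv_eq_zero_of_notMem_tsupport fun h => hx.2 ⟨hfr h, hx.1⟩, zero_apply]

/-- Subtracting from `χ v` a suitable multiple `w` of the `i`-th unit vector leaves a field
tangential to the level sets of `ρ`, which has zero total divergence. Only the integral of `∂ᵢ w`
remains, and it is a boundary integral. Solving for `w` gives the density `b`, proportional to the
gradient of `ρ` and thus parallel to the exterior normal. -/
theorem IsLocalDefiningFunction.exists_integral_div_eq {n : ℕ} {Ω U : Set (E (n + 1))}
    {x₀ : E (n + 1)} {ρ : E (n + 1) → ℝ} (h : IsLocalDefiningFunction Ω x₀ U ρ)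
    (hΩ : IsBoundedSmoothDomain Ω) :
    ∃ Q : Set (E (n + 1)), IsOpen Q ∧ x₀ ∈ Q ∧ ∃ ν : Measure (E (n + 1)), IsFiniteMeasure ν ∧
      ν ≤ surface Ω ∧ ∀ χ, IsTest χ → tsupport χ ⊆ Q → ∃ b : Fin (n + 1) → E (n + 1) → ℝ,
        (∀ j, IsTest (b j)) ∧
        (∀ y ∈ frontier Ω, ∀ w, ⟪exteriorNormal Ω y, w⟫ = 0 → ∑ j, b j y * w j = 0) ∧
        ∀ v : Fin (n + 1) → E (n + 1) → ℝ, (∀ j, ContDiff ℝ ∞ (v j)) →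
          ∫ x in Ω, ∑ j, fderiv ℝ (fun x => χ x * v j x) x (EuclideanSpace.single j 1) =
            ∑ j, ∫ x, b j x * v j x ∂ν := by
  obtain ⟨i, r, s, ν, hr, hrU, hi, hν, hνs, hint⟩ := h.exists_boundary_measure hΩ.isOpen
  refine ⟨box x₀ r, isOpen_box x₀ r, mem_box_self x₀ hr, ν, hν, hνs, fun χ hχ hχr => ?_⟩
  set q : Fin (n + 1) → E (n + 1) → ℝ := fun j x => gradient ρ x j / gradient ρ x i with hq
  have hqs : ∀ j, ContDiffOn ℝ ∞ (q j) (box x₀ r) := fun j => by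
    have h1 : ∀ j, ContDiffOn ℝ ∞ (fun x => gradient ρ x j) (box x₀ r) := fun j =>
      (EuclideanSpace.proj j : E (n + 1) →L[ℝ] ℝ).contDiff.comp_contDiffOn
        (h.contDiffOn_gradient.mono hrU)
    exact (h1 j).div (h1 i) hi
  have hc : ∀ j, IsTest fun x => χ x * q j x := fun j =>
    hχ.mul_of_contDiffOn (isOpen_box x₀ r) (hqs j) hχr
  refine ⟨fun j x => s * (χ x * q j x), fun j => (hc j).const_mul s, ?_, ?_⟩
  · intro y hy w hw
    by_cases hyr : y ∈ box x₀ r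
    · obtain ⟨V, σ, hσ, hn⟩ := exteriorNormal_spec hΩ hy
      -- The exterior normal is built from some other defining function `σ`; parallel gradients
      -- transfer orthogonality to `ρ`.
      have h0 : ⟪w, gradient σ y⟫ = 0 := by
        have h1 : ‖gradient σ y‖⁻¹ ≠ 0 :=
          inv_ne_zero (norm_ne_zero_iff.2 (hσ.gradient_ne_zero y hσ.mem))
        rw [hn, real_inner_smul_left, real_inner_comm] at hw
        exact (mul_eq_zero.1 hw).resolve_left h1
      have h1 := (h.of_mem (hrU hyr)).inner_gradient_eq_zero hσ hΩ.isOpen hy h0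
      have h2 : ∑ j, gradient ρ y j * w j = 0 := by
        rw [← h1, PiLp.inner_apply]
        simp
      have h3 : ∀ j, s * (χ y * q j y) * w j =
          s * χ y / gradient ρ y i * (gradient ρ y j * w j) := fun j => by
        simp only [hq]; ring
      rw [Finset.sum_congr rfl fun j _ => h3 j, ← Finset.mul_sum, h2, mul_zero]
    · refine Finset.sum_eq_zero fun j _ => ?_
      simp [image_eq_zero_of_notMem_tsupport fun h => hyr (hχr h)]
  · intro v hv
    set w : E (n + 1) → ℝ := fun x => ∑ j, χ x * q j x * v j x with hw
    have hwt : IsTest w := IsTest.sum fun j _ => (hc j).mul (hv j)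
    have hwr : tsupport w ⊆ box x₀ r := by
      refine Subset.trans (closure_minimal (fun x hx => ?_) (isClosed_tsupport χ)) hχr
      by_contra h1
      exact hx (by simp [hw, image_eq_zero_of_notMem_tsupport h1])
    -- The tangential remainder: `w` is removed from the `i`-th component only.
    set u : Fin (n + 1) → E (n + 1) → ℝ :=
      fun j x => χ x * v j x + (if j = i then -1 else 0) * w x with hu
    have hut : ∀ j, IsTest (u j) := fun j => (hχ.mul (hv j)).add (hwt.const_mul _)
    have hur : ∀ j, tsupport (u j) ⊆ box x₀ r := fun j => by
      refine (tsupport_add _ _).trans (union_subset ?_ ?_)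
      · exact (tsupport_mul_subset_left).trans hχr
      · exact (tsupport_mul_subset_right).trans hwr
    have h' : IsLocalDefiningFunction Ω x₀ (box x₀ r) ρ :=
      ⟨isOpen_box x₀ r, mem_box_self x₀ hr, h.smooth.mono hrU,
        fun y hy => h.gradient_ne_zero y (hrU hy), fun y hy => h.mem_iff y (hrU hy)⟩
    have h0 := h'.integral_div_eq_zero hΩ.isOpen hut hur fun x hx => by
      have h1 : ∀ j, u j x * gradient ρ x j = χ x * v j x * gradient ρ x j -
          (if j = i then w x * gradient ρ x i else 0) := fun j => by
        simp only [hu]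
        split_ifs with hj
        · rw [hj]; ring
        · ring
      rw [Finset.sum_congr rfl fun j _ => h1 j, Finset.sum_sub_distrib, Finset.sum_ite_eq']
      simp only [Finset.mem_univ, if_true, hw, Finset.sum_mul, hq]
      rw [← Finset.sum_sub_distrib]
      refine Finset.sum_eq_zero fun j _ => ?_
      have := hi x hx
      field_simp
      ring
    have hdu : ∀ x, ∑ j, fderiv ℝ (u j) x (EuclideanSpace.single j 1) =
        (∑ j, fderiv ℝ (fun x => χ x * v j x) x (EuclideanSpace.single j 1)) -
          fderiv ℝ w x (EuclideanSpace.single i 1) := fun x => by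
      have h1 : ∀ j, fderiv ℝ (u j) x (EuclideanSpace.single j 1) =
          fderiv ℝ (fun x => χ x * v j x) x (EuclideanSpace.single j 1) -
          (if j = i then fderiv ℝ w x (EuclideanSpace.single i 1) else 0) := fun j => by
        have hd1 := (hχ.mul (hv j)).smooth.differentiable (by simp) x
        have hd2 := hwt.smooth.differentiable (by simp) x
        simp only [hu]
        rw [fderiv_fun_add hd1 (hd2.const_mul _), fderiv_const_mul hd2]
        split_ifs with hj
        · rw [hj]; simp [sub_eq_add_neg]
        · simp
      rw [Finset.sum_congr rfl fun j _ => h1 j, Finset.sum_sub_distrib, Finset.sum_ite_eq']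
      simp
    have hI1 : IsTest fun x =>
        ∑ j, fderiv ℝ (fun x => χ x * v j x) x (EuclideanSpace.single j 1) :=
      IsTest.sum fun j _ => (hχ.mul (hv j)).fderiv_apply _
    simp only [hdu] at h0
    rw [integral_sub hI1.integrable.integrableOn (hwt.fderiv_apply _).integrable.integrableOn,
      hint w hwt hwr, sub_eq_zero] at h0
    rw [h0, hw, integral_finsetSum]
    · rw [Finset.mul_sum]
      refine Finset.sum_congr rfl fun j _ => ?_
      rw [← integral_const_mul]
      congr 1
      ext1 x
      ring
    · intro j _
      have := (hc j).mul (hv j)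
      exact this.smooth.continuous.integrable_of_hasCompactSupport this.compact

/-- The divergence theorem near a point, with an unspecified density of the boundary measure. -/
theorem exists_integral_div_eq {Ω : Set (E d)} (hΩ : IsBoundedSmoothDomain Ω) {x₀ : E d}
    (hx₀ : x₀ ∈ closure Ω) :
    ∃ Q : Set (E d), IsOpen Q ∧ x₀ ∈ Q ∧ ∃ ν : Measure (E d), IsFiniteMeasure ν ∧
      ν ≤ surface Ω ∧ ∀ χ, IsTest χ → tsupport χ ⊆ Q → ∃ b : Fin d → E d → ℝ,
        (∀ j, IsTest (b j)) ∧
        (∀ y ∈ frontier Ω, ∀ w, ⟪exteriorNormal Ω y, w⟫ = 0 → ∑ j, b j y * w j = 0) ∧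
        ∀ v : Fin d → E d → ℝ, (∀ j, ContDiff ℝ ∞ (v j)) →
          ∫ x in Ω, ∑ j, fderiv ℝ (fun x => χ x * v j x) x (EuclideanSpace.single j 1) =
            ∑ j, ∫ x, b j x * v j x ∂ν := by
  by_cases hx : x₀ ∈ Ω
  -- At an interior point the cutoff field has compact support in `Ω`, so the zero measure serves.
  · refine ⟨Ω, hΩ.isOpen, hx, 0, inferInstance, Measure.zero_le _, fun χ hχ hχΩ =>
      ⟨fun _ _ => 0, fun _ => isTest_zero, by simp, fun v hv => ?_⟩⟩
    have h1 := fun j => hχ.mul (hv j)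
    rw [integral_finsetSum _ fun j _ => ((h1 j).fderiv_apply _).integrable.integrableOn]
    simp only [integral_zero_measure]
    refine Finset.sum_congr rfl fun j _ => ?_
    rw [setIntegral_eq_integral_of_forall_compl_eq_zero,
      integral_fderiv_apply_eq_zero ((h1 j).smooth.of_le (by simp)) (h1 j).compact]
    intro x hx
    rw [fderiv_eq_zero_of_notMem_tsupport, zero_apply]
    exact fun h => hx (hχΩ (tsupport_mul_subset_left h))
  · have hxf : x₀ ∈ frontier Ω := by rw [hΩ.isOpen.frontier_eq]; exact ⟨hx₀, hx⟩
    obtain ⟨U, ρ, h⟩ := hΩ.smooth_boundary x₀ hxf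
    cases d with
    | zero => exact (exists_gradient_apply_ne_zero (h.gradient_ne_zero x₀ h.mem)).choose.elim0
    | succ n => exact h.exists_integral_div_eq hΩ

/-! ### The divergence theorem for traces -/

theorem tendsto_integral_mul {μ : Measure (E d)} {b u : E d → ℝ} {a : ℕ → E d → ℝ}
    (hb : MemLp b 2 μ) (hu : MemLp u 2 μ) (ha : ∀ k, Continuous (a k))
    (h : Tendsto (fun k => eLpNorm (fun x => a k x - u x) 2 μ) atTop (𝓝 0)) :
    Tendsto (fun k => ∫ x, b x * a k x ∂μ) atTop (𝓝 (∫ x, b x * u x ∂μ)) := by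
  have hm : ∀ k, AEStronglyMeasurable (fun x => a k x - u x) μ := fun k =>
    (ha k).aestronglyMeasurable.sub hu.1
  have hbu : Integrable (fun x => b x * u x) μ := hb.integrable_mul hu
  refine tendsto_integral_of_L1 _ hbu.1 ?_ ?_
  · filter_upwards [h.eventually_lt_const (by norm_num : (0 : ℝ≥0∞) < ⊤)] with k hk
    have h1 : Integrable (fun x => b x * (a k x - u x)) μ :=
      hb.integrable_mul (⟨hm k, hk⟩ : MemLp (fun x => a k x - u x) 2 μ)
    refine (h1.add hbu).congr (Eventually.of_forall fun x => ?_)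
    simp only [Pi.add_apply]
    ring
  · have h2 := ENNReal.Tendsto.const_mul (a := eLpNorm b 2 μ) h (Or.inr hb.2.ne)
    rw [mul_zero] at h2
    refine tendsto_of_tendsto_of_tendsto_of_le_of_le tendsto_const_nhds h2 (fun _ => zero_le)
      fun k => ?_
    have h3 := eLpNorm_smul_le_mul_eLpNorm (p := 2) (q := 2) (r := 1) (hm k) hb.1
    rw [eLpNorm_one_eq_lintegral_enorm] at h3
    refine le_trans (le_of_eq ?_) h3
    congr 1
    ext1 x
    congr 1
    simp only [Pi.smul_apply', smul_eq_mul]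
    ring

theorem IsBoundedSmoothDomain.isFiniteMeasure_vol {Ω : Set (E d)}
    (hΩ : IsBoundedSmoothDomain Ω) : IsFiniteMeasure (vol Ω) :=
  ⟨by rw [Measure.restrict_apply_univ]; exact hΩ.isBounded.measure_lt_top⟩

/-- A smooth partition of unity on a compact set, by test functions. -/
theorem exists_partition_of_unity {K : Set (E d)} (hK : IsCompact K) {P : Set (E d) → Prop}
    (hP : ∀ x ∈ K, ∃ Q, IsOpen Q ∧ x ∈ Q ∧ P Q) :
    ∃ (m : ℕ) (χ : Fin m → E d → ℝ), (∀ k, IsTest (χ k)) ∧ (∀ k, ∃ Q, P Q ∧ tsupport (χ k) ⊆ Q) ∧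
      ∀ x ∈ K, ∑ k, χ k x = 1 := by
  choose! Q hQo hxQ hQP using hP
  -- Intersecting with unit balls forces the functions of the partition to have compact support.
  obtain ⟨t, ht, hcover⟩ := hK.elim_nhds_subcover (fun x => Q x ∩ Metric.ball x 1)
    fun x hx => ((hQo x hx).inter Metric.isOpen_ball).mem_nhds
      ⟨hxQ x hx, Metric.mem_ball_self one_pos⟩
  set e := t.equivFin.symm
  have hmem : ∀ k, (e k : E d) ∈ K := fun k => ht _ (e k).2
  obtain ⟨f, hf⟩ := SmoothPartitionOfUnity.exists_isSubordinate (𝓘(ℝ, E d)) hK.isClosed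
    (fun k => Q (e k) ∩ Metric.ball (e k : E d) 1)
    (fun k => (hQo _ (hmem k)).inter Metric.isOpen_ball) (by
      refine hcover.trans (iUnion₂_subset fun x hx => ?_)
      refine Subset.trans ?_ (subset_iUnion _ (t.equivFin ⟨x, hx⟩))
      simp [e])
  refine ⟨t.card, fun k => f k, fun k => ⟨(f k).contMDiff.contDiff, ?_⟩,
    fun k => ⟨_, hQP _ (hmem k), (hf k).trans inter_subset_left⟩, fun x hx => ?_⟩
  · exact HasCompactSupport.of_support_subset_isCompact
      (isCompact_closedBall (e k : E d) 1)
      ((subset_tsupport _).trans ((hf k).trans (inter_subset_right.trans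
        Metric.ball_subset_closedBall)))
  · rw [← finsum_eq_sum_of_fintype]
    exact f.sum_eq_one hx

/-- The divergence of an `H¹` field with vanishing normal trace has mean zero. -/
theorem integral_divergence_eq_zero {Ω : Set (E d)} (hΩ : IsBoundedSmoothDomain Ω)
    {ψ : H1Vec Ω} {g : E d → E d} (hg : ∀ j, HasTrace (ψ j) fun x => g x j)
    (hn : ∀ᵐ x ∂(surface Ω), ⟪exteriorNormal Ω x, g x⟫ = 0) :
    ∫ x in Ω, divergence ψ x = 0 := by
  have := hΩ.isFiniteMeasure_vol
  choose hgm φ hφ h1 h2 h3 using hg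
  have hG : ∀ j, MemLp (fun x => H1.grad (ψ j) x j) 2 (vol Ω) := fun j =>
    (Lp.memLp (H1.grad (ψ j))).continuousLinearMap_comp (EuclideanSpace.proj j : E d →L[ℝ] ℝ)
  have hu : ∀ j, MemLp (fun x => H1.toL2 (ψ j) x) 2 (vol Ω) := fun j => Lp.memLp _
  have h2' : ∀ j, Tendsto (fun k => eLpNorm (fun x => fderiv ℝ (φ j k) x
      (EuclideanSpace.single j 1) - H1.grad (ψ j) x j) 2 (vol Ω)) atTop (𝓝 0) := fun j => by
    refine tendsto_of_tendsto_of_tendsto_of_le_of_le tendsto_const_nhds (h2 j)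
      (fun _ => zero_le) fun k => eLpNorm_mono fun x => ?_
    rw [← gradient_apply]
    exact PiLp.norm_apply_le (gradient (φ j k) x - H1.grad (ψ j) x) j
  have hcd : ∀ j k, Continuous fun x => fderiv ℝ (φ j k) x (EuclideanSpace.single j 1) :=
    fun j k => ((hφ j k).continuous_fderiv (by simp)).clm_apply continuous_const
  -- The local divergence theorem is applied to the smooth approximants. Convergence in `L²` of the
  -- surface measure passes to the smaller measure `ν`, and the limiting boundary term vanishes
  -- because `b` is parallel to the normal.
  have hloc : ∀ x ∈ closure Ω, ∃ Q, IsOpen Q ∧ x ∈ Q ∧ ∀ χ, IsTest χ → tsupport χ ⊆ Q →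
      ∑ j, ((∫ x in Ω, χ x * H1.grad (ψ j) x j) +
        ∫ x in Ω, fderiv ℝ χ x (EuclideanSpace.single j 1) * H1.toL2 (ψ j) x) = 0 := by
    intro x hx
    obtain ⟨Q, hQ, hxQ, ν, hν, hνs, hQν⟩ := exists_integral_div_eq hΩ hx
    refine ⟨Q, hQ, hxQ, fun χ hχ hχQ => ?_⟩
    obtain ⟨b, hb, hbn, hbv⟩ := hQν χ hχ hχQ
    have hbm : ∀ j, MemLp (b j) 2 ν := fun j =>
      (hb j).smooth.continuous.memLp_of_hasCompactSupport (hb j).compact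
    have hgν : ∀ j, MemLp (fun x => g x j) 2 ν := fun j => (hgm j).mono_measure hνs
    have hL : Tendsto (fun k => ∑ j, ((∫ x in Ω, χ x * fderiv ℝ (φ j k) x
        (EuclideanSpace.single j 1)) + ∫ x in Ω, fderiv ℝ χ x (EuclideanSpace.single j 1) *
          φ j k x)) atTop (𝓝 (∑ j, ((∫ x in Ω, χ x * H1.grad (ψ j) x j) +
        ∫ x in Ω, fderiv ℝ χ x (EuclideanSpace.single j 1) * H1.toL2 (ψ j) x))) :=
      tendsto_finsetSum _ fun j _ =>
        (tendsto_integral_mul (hχ.memLp Ω) (hG j) (hcd j) (h2' j)).add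
          (tendsto_integral_mul ((hχ.fderiv_apply _).memLp Ω) (hu j)
            (fun k => (hφ j k).continuous) (h1 j))
    have hR : Tendsto (fun k => ∑ j, ∫ x, b j x * φ j k x ∂ν) atTop
        (𝓝 (∑ j, ∫ x, b j x * g x j ∂ν)) :=
      tendsto_finsetSum _ fun j _ => tendsto_integral_mul (hbm j) (hgν j)
        (fun k => (hφ j k).continuous) (tendsto_of_tendsto_of_tendsto_of_le_of_le
          tendsto_const_nhds (h3 j) (fun _ => zero_le) fun k => eLpNorm_mono_measure _ hνs)
    have hR0 : ∑ j, ∫ x, b j x * g x j ∂ν = 0 := by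
      have i1 : ∀ j, Integrable (fun x => b j x * g x j) ν :=
        fun j => (hbm j).integrable_mul (hgν j)
      rw [← integral_finsetSum _ fun j _ => i1 j]
      refine integral_eq_zero_of_ae ?_
      have hmem : ∀ᵐ x ∂(surface Ω), x ∈ frontier Ω :=
        ae_restrict_mem isClosed_frontier.measurableSet
      have hac : ν ≪ surface Ω := Measure.absolutelyContinuous_of_le hνs
      filter_upwards [hac.ae_le hmem, hac.ae_le hn] with y hy hny
      exact hbn y hy _ hny
    rw [hR0] at hR
    refine tendsto_nhds_unique (hL.congr fun k => ?_) hR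
    rw [← hbv (fun j => φ j k) fun j => hφ j k, integral_finsetSum _ fun j _ =>
      ((hχ.mul (hφ j k)).fderiv_apply _).integrable.integrableOn]
    refine Finset.sum_congr rfl fun j _ => ?_
    have i1 : IsTest fun x => χ x * fderiv ℝ (φ j k) x (EuclideanSpace.single j 1) :=
      hχ.mul (((hφ j k).fderiv_right (m := ∞) (by simp)).clm_apply contDiff_const)
    have i2 : IsTest fun x => fderiv ℝ χ x (EuclideanSpace.single j 1) * φ j k x :=
      (hχ.fderiv_apply _).mul (hφ j k)
    rw [← integral_add i1.integrable.integrableOn i2.integrable.integrableOn]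
    congr 1
    ext1 x
    rw [fderiv_mul_apply hχ.smooth (hφ j k), mul_comm (fderiv ℝ χ x _)]
  obtain ⟨m, χ, hχ, hχQ, hsum⟩ := exists_partition_of_unity hΩ.isBounded.isCompact_closure hloc
  -- The derivatives of the partition of unity cancel in `Ω`, so summing the local identities leaves
  -- only the integral of the divergence.
  have hderiv : ∀ x ∈ Ω, ∀ v, ∑ k, fderiv ℝ (χ k) x v = 0 := fun x hx v => by
    have e : (fun x => ∑ k, χ k x) =ᶠ[𝓝 x] fun _ => 1 := by
      filter_upwards [hΩ.isOpen.mem_nhds hx] with y hy using hsum y (subset_closure hy)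
    have h4 := e.fderiv_eq (𝕜 := ℝ)
    rw [fderiv_fun_sum fun k _ => (hχ k).smooth.differentiable (by simp) x] at h4
    have h5 := congrArg (fun L : E d →L[ℝ] ℝ => L v) h4
    simpa using h5
  have htot : ∑ k, ∑ j, ((∫ x in Ω, χ k x * H1.grad (ψ j) x j) +
      ∫ x in Ω, fderiv ℝ (χ k) x (EuclideanSpace.single j 1) * H1.toL2 (ψ j) x) = 0 :=
    Finset.sum_eq_zero fun k _ => by
      obtain ⟨Q, hQ, hkQ⟩ := hχQ k
      exact hQ _ (hχ k) hkQ
  rw [integral_congr_ae (divergence_ae ψ),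
    integral_finsetSum _ fun j _ => (hG j).integrable one_le_two, ← htot, Finset.sum_comm]
  refine Finset.sum_congr rfl fun j _ => ?_
  have i1 : ∀ k, Integrable (fun x => χ k x * H1.grad (ψ j) x j) (vol Ω) := fun k =>
    ((hχ k).memLp Ω).integrable_mul (hG j)
  have i2 : ∀ k, Integrable (fun x => fderiv ℝ (χ k) x (EuclideanSpace.single j 1) *
      H1.toL2 (ψ j) x) (vol Ω) := fun k =>
    (((hχ k).fderiv_apply _).memLp Ω).integrable_mul (hu j)
  rw [Finset.sum_add_distrib, ← integral_finsetSum _ fun k _ => i1 k,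
    ← integral_finsetSum _ fun k _ => i2 k]
  have e1 : ∫ x in Ω, ∑ k, χ k x * H1.grad (ψ j) x j = ∫ x in Ω, H1.grad (ψ j) x j :=
    setIntegral_congr_fun hΩ.isOpen.measurableSet fun x hx => by
      simp only [← Finset.sum_mul, hsum x (subset_closure hx), one_mul]
  have e2 : ∫ x in Ω, ∑ k, fderiv ℝ (χ k) x (EuclideanSpace.single j 1) *
      H1.toL2 (ψ j) x = 0 := by
    rw [setIntegral_congr_fun (g := fun _ => (0 : ℝ)) hΩ.isOpen.measurableSet fun x hx => by
      simp only [← Finset.sum_mul, hderiv x hx, zero_mul]]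
    simp
  rw [e1, e2, add_zero]

/-! ### A test field with nonzero flux -/

theorem norm_le_card_mul {x : E d} {C : ℝ} (h : ∀ j, |x j| ≤ C) : ‖x‖ ≤ d * C := by
  have e : x = ∑ j, x j • EuclideanSpace.single j (1 : ℝ) := by
    have := (EuclideanSpace.basisFun (Fin d) ℝ).sum_repr x
    simpa using this.symm
  rw [e]
  refine (norm_sum_le _ _).trans ((Finset.sum_le_card_nsmul _ _ C fun j _ => ?_).trans ?_)
  · simpa [norm_smul] using h j
  · simp

/-- For two boundary points in a small box, the mean value theorem for `ρ`, which vanishes at both,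
bounds the difference of the `i`-th coordinates by that of the others. Projection along the `i`-th
axis is therefore antilipschitz on the boundary, with bounded image. Local finiteness makes smooth
cutoffs square integrable on the boundary, as a trace requires. -/
theorem IsLocalDefiningFunction.exists_surface_lt_top {Ω U : Set (E (n + 1))} {x₀ : E (n + 1)}
    {ρ : E (n + 1) → ℝ} (h : IsLocalDefiningFunction Ω x₀ U ρ) (hΩ : IsOpen Ω) :
    ∃ Q : Set (E (n + 1)), IsOpen Q ∧ x₀ ∈ Q ∧ surface Ω Q < ⊤ := by
  obtain ⟨i, hi⟩ := exists_gradient_apply_ne_zero (h.gradient_ne_zero x₀ h.mem)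
  have hgc : ContinuousAt (gradient ρ) x₀ :=
    h.contDiffOn_gradient.continuousOn.continuousAt (h.isOpen.mem_nhds h.mem)
  have hcont : ContinuousAt (fun x => |gradient ρ x i|) x₀ :=
    ((EuclideanSpace.proj i : E (n + 1) →L[ℝ] ℝ).continuous.continuousAt.comp hgc).abs
  set c := |gradient ρ x₀ i| / 2 with hc
  have hc0 : 0 < c := half_pos (abs_pos.2 hi)
  set M := ‖gradient ρ x₀‖ + 1 with hM
  obtain ⟨r, hr, hbox⟩ := exists_box_subset (Filter.Eventually.and (h.isOpen.mem_nhds h.mem)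
    ((hcont.eventually_const_lt (half_lt_self (abs_pos.2 hi))).and
      (hgc.norm.eventually_lt_const (lt_add_one _))))
  refine ⟨box x₀ r, isOpen_box x₀ r, mem_box_self x₀ hr, ?_⟩
  set S := box x₀ r ∩ frontier Ω with hS
  set K : ℝ := (n + 1) * max 1 (n * M / c) with hK
  have hK0 : 0 ≤ K := by positivity
  have hlip : ∀ x ∈ S, ∀ y ∈ S, dist x y ≤ K * dist (sliceProj i x) (sliceProj i y) := by
    intro x hx y hy
    set D := dist (sliceProj i x) (sliceProj i y) with hD
    have hD0 : 0 ≤ D := dist_nonneg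
    have hk : ∀ k, |(x - y) (i.succAbove k)| ≤ D := fun k =>
      dist_le_pi_dist (sliceProj i x) (sliceProj i y) k
    obtain ⟨z, hz, hzxy⟩ := domain_mvt (f := ρ) (f' := fun z => fderiv ℝ ρ z)
      (fun z hz => (h.differentiableAt (hbox hz).1).hasFDerivAt.hasFDerivWithinAt)
      (convex_box x₀ r) hy.1 hx.1
    have hz' := hbox ((convex_box x₀ r).segment_subset hy.1 hx.1 hz)
    rw [h.eq_zero hΩ (hbox hx.1).1 hx.2, h.eq_zero hΩ (hbox hy.1).1 hy.2, sub_zero,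
      ← inner_gradient_eq, PiLp.inner_apply, Fin.sum_univ_succAbove _ i] at hzxy
    have hxi : |(x - y) i| * c ≤ n * M * D := by
      have h1 : (x - y) i * gradient ρ z i =
          -∑ k, (x - y) (i.succAbove k) * gradient ρ z (i.succAbove k) := by
        rw [eq_neg_iff_add_eq_zero]
        refine Eq.trans ?_ hzxy.symm
        simp [mul_comm]
      have h2 : |(x - y) i| * |gradient ρ z i| ≤ ∑ _k : Fin n, D * M := by
        rw [← abs_mul, h1, abs_neg]
        refine (Finset.abs_sum_le_sum_abs _ _).trans (Finset.sum_le_sum fun k _ => ?_)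
        rw [abs_mul]
        exact mul_le_mul (hk k) ((PiLp.norm_apply_le (gradient ρ z) _).trans hz'.2.2.le)
          (abs_nonneg _) hD0
      calc |(x - y) i| * c ≤ |(x - y) i| * |gradient ρ z i| :=
            mul_le_mul_of_nonneg_left hz'.2.1.le (abs_nonneg _)
        _ ≤ ∑ _k : Fin n, D * M := h2
        _ = n * M * D := by simp; ring
    rw [dist_eq_norm, hK, mul_assoc]
    have h3 : ∀ j, |(x - y) j| ≤ max 1 (n * M / c) * D := fun j => by
      rcases Fin.eq_self_or_eq_succAbove i j with rfl | ⟨k, rfl⟩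
      · refine le_trans ?_ (mul_le_mul_of_nonneg_right (le_max_right _ _) hD0)
        rw [div_mul_eq_mul_div, le_div_iff₀ hc0]
        exact hxi
      · refine (hk k).trans ?_
        exact le_mul_of_one_le_left hD0 (le_max_left _ _)
    simpa using norm_le_card_mul h3
  have hanti : AntilipschitzWith ⟨K, hK0⟩ fun x : S => sliceProj i (x : E (n + 1)) :=
    AntilipschitzWith.of_le_mul_dist fun x y => hlip x x.2 y y.2
  have h1 := hanti.le_hausdorffMeasure_image (d := n) (by positivity) univ
  have h2 := (isometry_subtype_coe (s := S)).hausdorffMeasure_image (d := n)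
    (Or.inl (by positivity)) univ
  have h3 : (Measure.hausdorffMeasure (n : ℝ) : Measure (Fin n → ℝ)) = volume := by
    simpa using hausdorffMeasure_pi_real (ι := Fin n)
  have h4 : (fun x : S => sliceProj i (x : E (n + 1))) '' univ ⊆
      Metric.ball (sliceProj i x₀) r := by
    rintro _ ⟨x, -, rfl⟩
    exact sliceProj_mem_ball hr x.2.1
  rw [image_univ, Subtype.range_coe] at h2
  rw [Measure.restrict_apply (isOpen_box x₀ r).measurableSet]
  have e : (((n + 1 : ℕ) : ℝ) - 1) = n := by push_cast; ring
  rw [e, ← hS, h2]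
  refine h1.trans_lt (ENNReal.mul_lt_top (by finiteness) ?_)
  rw [h3]
  exact (measure_mono h4).trans_lt measure_ball_lt_top

theorem IsTest.memLp_of_measure_lt_top {χ : E d → ℝ} (hχ : IsTest χ) {μ : Measure (E d)}
    {Q : Set (E d)} (hQ : IsOpen Q) (hχQ : tsupport χ ⊆ Q) (hμ : μ Q < ⊤) : MemLp χ 2 μ := by
  have e : Q.indicator χ = χ :=
    indicator_eq_self.2 ((subset_tsupport χ).trans hχQ)
  have hfin : IsFiniteMeasure (μ.restrict Q) := ⟨by rwa [Measure.restrict_apply_univ]⟩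
  obtain ⟨C, hC⟩ := hχ.compact.exists_bound_of_continuous hχ.smooth.continuous
  rw [← e, memLp_indicator_iff_restrict hQ.measurableSet]
  exact MemLp.of_bound hχ.smooth.continuous.aestronglyMeasurable C (Eventually.of_forall hC)

theorem IsTest.hasTrace {χ : E d → ℝ} (hχ : IsTest χ) {Ω : Set (E d)}
    (h : MemLp χ 2 (surface Ω)) : HasTrace (hχ.toH1 Ω) χ := by
  refine ⟨h, fun _ => χ, fun _ => hχ.smooth, ?_, ?_, by simp⟩
  · have e : (fun x => χ x - H1.toL2 (hχ.toH1 Ω) x) =ᵐ[vol Ω] 0 := by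
      filter_upwards [(hχ.memLp Ω).coeFn_toLp] with x hx
      rw [IsTest.toL2_toH1, hx]
      simp
    simp [eLpNorm_congr_ae e]
  · have e : (fun x => gradient χ x - H1.grad (hχ.toH1 Ω) x) =ᵐ[vol Ω] 0 := by
      filter_upwards [(hχ.memLp_gradient Ω).coeFn_toLp] with x hx
      rw [IsTest.grad_toH1, hx]
      simp
    simp [eLpNorm_congr_ae e]

theorem hasDerivAt_integral_translate {Ω : Set (E d)} [IsFiniteMeasure (vol Ω)] {θ : E d → ℝ}
    (hθ : IsTest θ) (p v : E d) (t : ℝ) :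
    HasDerivAt (fun t : ℝ => ∫ x in Ω, θ (x - (p + t • v)))
      (-∫ x in Ω, fderiv ℝ θ (x - (p + t • v)) v) t := by
  obtain ⟨C, hC⟩ := (hθ.fderiv_apply v).compact.exists_bound_of_continuous
    (hθ.fderiv_apply v).smooth.continuous
  obtain ⟨C', hC'⟩ := hθ.compact.exists_bound_of_continuous hθ.smooth.continuous
  have hcθ := hθ.smooth.continuous
  have hcd := (hθ.fderiv_apply v).smooth.continuous
  rw [← integral_neg]
  refine (hasDerivAt_integral_of_dominated_loc_of_deriv_le (s := univ) (bound := fun _ => C)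
    (F' := fun t x => -fderiv ℝ θ (x - (p + t • v)) v) univ_mem
    (Eventually.of_forall fun s => (hcθ.comp (by fun_prop)).aestronglyMeasurable) ?_
    (hcd.comp (by fun_prop : Continuous fun x => x - (p + t • v))).neg.aestronglyMeasurable
    (Eventually.of_forall fun x s _ => by rw [norm_neg]; exact hC _)
    (integrable_const C) (Eventually.of_forall fun x s _ => ?_)).2
  · exact (MemLp.of_bound (p := 1) (hcθ.comp (by fun_prop)).aestronglyMeasurable C'
      (Eventually.of_forall fun x => hC' _)).integrable le_rfl
  · have h1 : HasDerivAt (fun s : ℝ => x - (p + s • v)) (-v) s := by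
      simpa using (((hasDerivAt_id s).smul_const v).const_add p).const_sub x
    have h2 := (hθ.smooth.differentiable (by simp) (x - (p + s • v))).hasFDerivAt.comp_hasDerivAt
      s h1
    rwa [map_neg] at h2

/-- A bump is translated from a point inside `Ω` to a point outside its closure. Its integral over
`Ω` falls from one to zero, so at some intermediate time the derivative in the direction of motion
has nonzero integral. The whole motion stays in a ball inside `W` by convexity. -/
theorem exists_integral_fderiv_ne_zero {Ω : Set (E d)} (hΩ : IsBoundedSmoothDomain Ω)
    {x₀ : E d} (hx₀ : x₀ ∈ frontier Ω) {W : Set (E d)} (hW : W ∈ 𝓝 x₀) :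
    ∃ (χ : E d → ℝ) (v : E d), IsTest χ ∧ tsupport χ ⊆ W ∧ ∫ x in Ω, fderiv ℝ χ x v ≠ 0 := by
  have := hΩ.isFiniteMeasure_vol
  obtain ⟨U, ρ, h⟩ := hΩ.smooth_boundary x₀ hx₀
  obtain ⟨R, hR, hRW⟩ := Metric.mem_nhds_iff.1 hW
  have h0 := h.eq_zero hΩ.isOpen h.mem hx₀
  have hpos : 0 < ⟪gradient ρ x₀, gradient ρ x₀⟫ :=
    real_inner_self_pos.2 (h.gradient_ne_zero x₀ h.mem)
  have hev : ∀ v : E d, ∀ᶠ t in 𝓝[>] (0 : ℝ), x₀ + t • v ∈ Metric.ball x₀ R := fun v => by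
    have hc : ContinuousAt (fun t : ℝ => x₀ + t • v) 0 := by fun_prop
    exact nhdsWithin_le_nhds (hc.preimage_mem_nhds (by
      simpa using Metric.ball_mem_nhds x₀ hR))
  obtain ⟨p, hpΩ, hpR⟩ : ∃ p, p ∈ Ω ∧ p ∈ Metric.ball x₀ R := by
    obtain ⟨t, ht1, ht2⟩ := ((h.eventually_mem (v := -gradient ρ x₀) h0 (by
      rw [inner_neg_left]; linarith)).and (hev _)).exists
    exact ⟨_, ht1, ht2⟩
  obtain ⟨q, hqΩ, hqR⟩ : ∃ q, q ∉ closure Ω ∧ q ∈ Metric.ball x₀ R := by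
    obtain ⟨t, ht1, ht2⟩ := ((h.eventually_notMem (v := gradient ρ x₀) h0 hpos).and
      (hev _)).exists
    exact ⟨_, ht1, ht2⟩
  have hN : ∀ᶠ z in 𝓝 (0 : E d), (p + z ∈ Ω ∧ p + z ∈ Metric.ball x₀ R) ∧
      (q + z ∈ (closure Ω)ᶜ ∧ q + z ∈ Metric.ball x₀ R) := by
    have hcp : ContinuousAt (fun z : E d => p + z) 0 := by fun_prop
    have hcq : ContinuousAt (fun z : E d => q + z) 0 := by fun_prop
    refine Filter.Eventually.and (Filter.Eventually.and (hcp.preimage_mem_nhds ?_)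
      (hcp.preimage_mem_nhds ?_)) (Filter.Eventually.and (hcq.preimage_mem_nhds ?_)
      (hcq.preimage_mem_nhds ?_))
    · simpa using hΩ.isOpen.mem_nhds hpΩ
    · simpa using Metric.isOpen_ball.mem_nhds hpR
    · simpa using isClosed_closure.isOpen_compl.mem_nhds hqΩ
    · simpa using Metric.isOpen_ball.mem_nhds hqR
  obtain ⟨θ, hθ, hθs, hθ1⟩ := exists_isTest_integral_eq_one hN
  set v := q - p with hv
  have htr : ∀ t : ℝ, IsTest fun x => θ (x - (p + t • v)) := fun t =>
    ⟨hθ.smooth.comp (by fun_prop),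
      hθ.compact.comp_homeomorph (Homeomorph.subRight (p + t • v))⟩
  have hts : ∀ t : ℝ, tsupport (fun x => θ (x - (p + t • v))) ⊆
      {x | x - (p + t • v) ∈ tsupport θ} := fun t =>
    closure_minimal (fun x hx => subset_tsupport θ hx)
      ((isClosed_tsupport θ).preimage (by fun_prop))
  have hint : ∀ t : ℝ, ∫ x, θ (x - (p + t • v)) = 1 := fun t => by
    rw [integral_sub_right_eq_self θ, hθ1]
  have I0 : ∫ x in Ω, θ (x - (p + (0 : ℝ) • v)) = 1 := by
    rw [setIntegral_eq_integral_of_forall_compl_eq_zero, hint]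
    intro x hx
    refine image_eq_zero_of_notMem_tsupport fun h1 => hx ?_
    simpa using (hθs h1).1.1
  have I1 : ∫ x in Ω, θ (x - (p + (1 : ℝ) • v)) = 0 := by
    refine setIntegral_eq_zero_of_forall_eq_zero fun x hx => ?_
    refine image_eq_zero_of_notMem_tsupport fun h1 => (hθs h1).2.1 ?_
    simpa [hv] using subset_closure hx
  by_contra! hcon
  have hd : ∀ t ∈ Ioo (0 : ℝ) 1, ∫ x in Ω, fderiv ℝ θ (x - (p + t • v)) v = 0 := fun t ht => by
    have h1 := hcon _ v (htr t) (fun x hx => hRW ?_)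
    · simpa only [fderiv_comp_sub] using h1
    · have h2 := hθs (hts t hx)
      have h3 := convex_ball x₀ R h2.1.2 h2.2.2 (sub_nonneg.2 ht.2.le) ht.1.le (by ring)
      convert h3 using 1
      simp only [hv]
      module
  obtain ⟨t, ht, h1⟩ := exists_hasDerivAt_eq_slope
    (fun t : ℝ => ∫ x in Ω, θ (x - (p + t • v)))
    (fun t => -∫ x in Ω, fderiv ℝ θ (x - (p + t • v)) v) one_pos
    (fun t _ => (hasDerivAt_integral_translate hθ p v t).continuousAt.continuousWithinAt)
    (fun t _ => hasDerivAt_integral_translate hθ p v t)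
  rw [hd t ht, I0, I1] at h1
  norm_num at h1

/-- If some part of the boundary is free, there is a field in the test space with nonzero flux. -/
theorem exists_mem_testSpace_integral_ne_zero {Ω Γ₁ Γ₂ : Set (E d)}
    (hΩ : IsBoundedSmoothDomain Ω) (hΓ₁ : IsClosed Γ₁) (hΓ₂ : IsClosed Γ₂) {x₀ : E d}
    (hx₀ : x₀ ∈ frontier Ω) (hx₁ : x₀ ∉ Γ₁) (hx₂ : x₀ ∉ Γ₂) :
    ∃ ψ ∈ testSpace Ω Γ₁ Γ₂, ∫ x in Ω, divergence ψ x ≠ 0 := by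
  obtain ⟨Q, hQ, hxQ, hQs⟩ : ∃ Q : Set (E d), IsOpen Q ∧ x₀ ∈ Q ∧ surface Ω Q < ⊤ := by
    obtain ⟨U, ρ, h⟩ := hΩ.smooth_boundary x₀ hx₀
    cases d with
    | zero => exact (exists_gradient_apply_ne_zero (h.gradient_ne_zero x₀ h.mem)).choose.elim0
    | succ n => exact h.exists_surface_lt_top hΩ.isOpen
  obtain ⟨χ, v, hχ, hχs, hne⟩ := exists_integral_fderiv_ne_zero hΩ hx₀
    (((hQ.inter hΓ₁.isOpen_compl).inter hΓ₂.isOpen_compl).mem_nhds ⟨⟨hxQ, hx₁⟩, hx₂⟩)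
  have hχm : MemLp χ 2 (surface Ω) :=
    hχ.memLp_of_measure_lt_top hQ (fun x hx => (hχs hx).1.1) hQs
  have hχ0 : ∀ x, x ∈ Γ₁ ∨ x ∈ Γ₂ → χ x = 0 := fun x hx =>
    image_eq_zero_of_notMem_tsupport fun h => by
      rcases hx with hx | hx
      · exact (hχs h).1.2 hx
      · exact (hχs h).2 hx
  -- The field is `χ v`, whose divergence is the derivative of `χ` along `v`; it is its own trace
  -- and vanishes on `Γ₁` and `Γ₂`.
  refine ⟨WithLp.toLp 2 fun j => v j • hχ.toH1 Ω, ⟨fun x => χ x • v, fun j => ?_, ?_, ?_⟩, ?_⟩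
  · have h1 := (hχ.hasTrace hχm).smul (v j)
    simpa [mul_comm] using h1
  · exact Eventually.of_forall fun x hx => by simp [hχ0 x (Or.inl hx)]
  · exact Eventually.of_forall fun x hx => by simp [hχ0 x (Or.inr hx)]
  · have e : (fun x => divergence (WithLp.toLp 2 fun j => v j • hχ.toH1 Ω : H1Vec Ω) x)
        =ᵐ[vol Ω] fun x => fderiv ℝ χ x v := by
      have h1 : ∀ᵐ x ∂(vol Ω), ∀ j, H1.grad (v j • hχ.toH1 Ω) x = v j • gradient χ x :=
        ae_all_iff.2 fun j => by
          filter_upwards [Lp.coeFn_smul (v j) (H1.grad (hχ.toH1 Ω)),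
            (hχ.memLp_gradient Ω).coeFn_toLp] with x hx1 hx2
          refine hx1.trans ?_
          rw [Pi.smul_apply, IsTest.grad_toH1, hx2]
      refine (divergence_ae _).trans ?_
      filter_upwards [h1] with x hx
      rw [← inner_gradient_eq, PiLp.inner_apply]
      refine Finset.sum_congr rfl fun j _ => ?_
      simp only [hx]
      simp [mul_comm]
    rwa [integral_congr_ae e]

/-! ### Representing the functional by a pressure -/

theorem divergence_zero {Ω : Set (E d)} : divergence (0 : H1Vec Ω) = 0 :=
  (divL_apply _).symm.trans (divL Ω).map_zero

theorem divergence_add {Ω : Set (E d)} (ψ χ : H1Vec Ω) :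
    divergence (ψ + χ) = divergence ψ + divergence χ := by
  simpa only [divL_apply] using (divL Ω).map_add ψ χ

theorem divergence_sub {Ω : Set (E d)} (ψ χ : H1Vec Ω) :
    divergence (ψ - χ) = divergence ψ - divergence χ := by
  simpa only [divL_apply] using (divL Ω).map_sub ψ χ

theorem divergence_smul {Ω : Set (E d)} (c : ℝ) (ψ : H1Vec Ω) :
    divergence (c • ψ) = c • divergence ψ := by
  simpa only [divL_apply] using (divL Ω).map_smul c ψ

/-- A continuous functional vanishing on the kernel of a surjective operator factors through the
operator. -/
theorem exists_comp_eq_of_surjective {X Y : Type*} [NormedAddCommGroup X] [NormedSpace ℝ X]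
    [CompleteSpace X] [NormedAddCommGroup Y] [NormedSpace ℝ Y] [CompleteSpace Y] (T : X →L[ℝ] Y)
    (hT : Function.Surjective T) (f : X →L[ℝ] ℝ) (hf : ∀ x, T x = 0 → f x = 0) :
    ∃ g : Y →L[ℝ] ℝ, ∀ x, g (T x) = f x := by
  -- The open mapping theorem gives a right inverse with a linear bound, possibly not linear.
  -- Composed with `f` it becomes linear, since `f` depends only on the image under `T`.
  obtain ⟨S, -⟩ := T.exists_nonlinearRightInverse_of_surjective (LinearMap.range_eq_top.2 hT)
  have hS : ∀ y, T (S y) = y := S.right_inv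
  have key : ∀ x x', T x = T x' → f x = f x' := fun x x' h => by
    rw [← sub_eq_zero, ← map_sub]
    exact hf _ (by rw [map_sub, h, sub_self])
  refine ⟨LinearMap.mkContinuous
    { toFun := fun y => f (S y)
      map_add' := fun y z => by
        rw [← map_add]
        exact key _ _ (by rw [map_add, hS, hS, hS])
      map_smul' := fun c y => by
        rw [← map_smul]
        exact key _ _ (by simp [hS]) } (‖f‖ * S.nnnorm) fun y => ?_, fun x => key _ _ (hS _)⟩
  calc ‖f (S y)‖ ≤ ‖f‖ * ‖S y‖ := f.le_opNorm _
    _ ≤ ‖f‖ * (S.nnnorm * ‖y‖) := by gcongr; exact S.bound y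
    _ = ‖f‖ * S.nnnorm * ‖y‖ := by ring

/-- The constant function `1` in `L²`. -/
noncomputable def oneL2 (Ω : Set (E d)) [IsFiniteMeasure (vol Ω)] : L2 Ω :=
  (memLp_const (1 : ℝ)).toLp fun _ => 1

theorem inner_L2_eq_integral {Ω : Set (E d)} (p f : L2 Ω) : ⟪p, f⟫ = ∫ x in Ω, p x * f x := by
  rw [L2.inner_def]
  congr 1
  ext1 x
  simp [mul_comm]

theorem inner_oneL2 {Ω : Set (E d)} [IsFiniteMeasure (vol Ω)] (p : L2 Ω) :
    ⟪p, oneL2 Ω⟫ = ∫ x in Ω, p x := by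
  rw [inner_L2_eq_integral]
  refine integral_congr_ae ?_
  filter_upwards [(memLp_const (μ := vol Ω) (p := 2) (1 : ℝ)).coeFn_toLp] with x hx
  rw [oneL2, hx, mul_one]

theorem IsBoundedSmoothDomain.inner_oneL2_ne_zero {Ω : Set (E d)} (hΩ : IsBoundedSmoothDomain Ω)
    [IsFiniteMeasure (vol Ω)] : ⟪oneL2 Ω, oneL2 Ω⟫ ≠ 0 := by
  rw [inner_oneL2]
  have e : ∫ x in Ω, oneL2 Ω x = volume.real Ω := by
    rw [oneL2, integral_congr_ae (memLp_const (μ := vol Ω) (p := 2) (1 : ℝ)).coeFn_toLp]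
    simp
  rw [e]
  exact (ENNReal.toReal_pos (hΩ.isOpen.measure_pos volume hΩ.isConnected.nonempty).ne'
    hΩ.isBounded.measure_lt_top.ne).ne'

theorem inner_divergence_oneL2_of_mem_H10Vec {Ω : Set (E d)} (hΩ : IsBoundedSmoothDomain Ω)
    [IsFiniteMeasure (vol Ω)] {ψ : H1Vec Ω} (hψ : ψ ∈ H10Vec Ω) :
    ⟪divergence ψ, oneL2 Ω⟫ = 0 := by
  rw [inner_oneL2]
  exact integral_divergence_eq_zero hΩ (g := fun _ => 0)
    (fun j => hasTrace_of_mem_H10 hΩ.isOpen (hψ j)) (by simp)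

/-- Subtracting the mean leaves a mean-zero function, which is a divergence. Hence `L²(Ω)` is
spanned by divergences of `H₀¹` fields and constants. -/
theorem exists_divergence_add_eq {Ω : Set (E d)} (hΩ : IsBoundedSmoothDomain Ω)
    [IsFiniteMeasure (vol Ω)] (f : L2 Ω) :
    ∃ ψ ∈ H10Vec Ω, ∃ c : ℝ, divergence ψ + c • oneL2 Ω = f := by
  set c : ℝ := ⟪f, oneL2 Ω⟫ / ⟪oneL2 Ω, oneL2 Ω⟫ with hc
  have h0 : ∫ x in Ω, (f - c • oneL2 Ω) x = 0 := by
    rw [← inner_oneL2, inner_sub_left, real_inner_smul_left, hc,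
      div_mul_cancel₀ _ hΩ.inner_oneL2_ne_zero, sub_self]
  obtain ⟨hm, ψ, hψ, hdiv⟩ := isDiv_of_integral_eq_zero hΩ (Lp.memLp (f - c • oneL2 Ω)) h0
  rw [Lp.toLp_coeFn] at hdiv
  refine ⟨ψ, hψ, c, ?_⟩
  rw [← divL_apply]
  exact (congrArg (· + c • oneL2 Ω) hdiv).trans (sub_add_cancel _ _)

/-- A functional vanishing on solenoidal fields is represented by a pressure on `H10Vec`, with
prescribed mean. -/
theorem exists_inner_divergence_eq {Ω Γ₁ Γ₂ : Set (E d)} (hΩ : IsBoundedSmoothDomain Ω)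
    [IsFiniteMeasure (vol Ω)] (F : testSpace Ω Γ₁ Γ₂ →L[ℝ] ℝ)
    (hF : ∀ ψ ∈ solenoidal Ω Γ₁ Γ₂, F ψ = 0) (a : ℝ) :
    ∃ p : L2 Ω, ⟪p, oneL2 Ω⟫ = a ∧ ∀ ψ (hψ : ψ ∈ H10Vec Ω),
      ⟪p, divergence ψ⟫ = F ⟨ψ, H10Vec_le_testSpace hΩ.isOpen Γ₁ Γ₂ hψ⟩ := by
  -- The extra real variable accounts for the constants: it makes the operator surjective, and
  -- assigning it the weight `a` prescribes the pairing of `p` with `1`.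
  set T : H10Vec Ω × ℝ →L[ℝ] L2 Ω := (divL Ω ∘L (H10Vec Ω).subtypeL).coprod
    (ContinuousLinearMap.toSpanSingleton ℝ (oneL2 Ω)) with hT
  have hTa : ∀ ψ c, T (ψ, c) = divergence (ψ : H1Vec Ω) + c • oneL2 Ω := fun ψ c => by
    rw [← divL_apply]; rfl
  have hsurj : Function.Surjective T := fun f => by
    obtain ⟨ψ, hψ, c, h⟩ := exists_divergence_add_eq hΩ f
    exact ⟨(⟨ψ, hψ⟩, c), (hTa _ _).trans h⟩
  set G : H10Vec Ω × ℝ →L[ℝ] ℝ := (F ∘L ((H10Vec Ω).subtypeL.codRestrict (testSpace Ω Γ₁ Γ₂)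
    fun ψ => H10Vec_le_testSpace hΩ.isOpen Γ₁ Γ₂ ψ.2)).coprod
    (ContinuousLinearMap.toSpanSingleton ℝ a) with hG
  have hGa : ∀ (ψ : H10Vec Ω) c, G (ψ, c) =
      F ⟨ψ, H10Vec_le_testSpace hΩ.isOpen Γ₁ Γ₂ ψ.2⟩ + c * a := fun ψ c => rfl
  obtain ⟨g, hg⟩ := exists_comp_eq_of_surjective T hsurj G (by
    rintro ⟨ψ, c⟩ h
    rw [hTa] at h
    -- Pairing with `1` annihilates the divergence, which forces `c = 0` on the kernel.
    have h1 := congrArg (fun f : L2 Ω => ⟪f, oneL2 Ω⟫) h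
    simp only [inner_add_left, real_inner_smul_left, inner_zero_left,
      inner_divergence_oneL2_of_mem_H10Vec hΩ ψ.2, zero_add] at h1
    have hc : c = 0 := (mul_eq_zero.1 h1).resolve_right hΩ.inner_oneL2_ne_zero
    rw [hc, zero_smul, add_zero] at h
    rw [hGa, hc, zero_mul, add_zero]
    exact hF _ h)
  have hp : ∀ f, ⟪(InnerProductSpace.toDual ℝ (L2 Ω)).symm g, f⟫ = g f := fun f =>
    InnerProductSpace.toDual_symm_apply
  refine ⟨(InnerProductSpace.toDual ℝ (L2 Ω)).symm g, ?_, fun ψ hψ => ?_⟩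
  · have h1 := hg (0, 1)
    rw [hTa, hGa] at h1
    rw [hp]
    have h2 : divergence ((0 : H10Vec Ω) : H1Vec Ω) = 0 := divergence_zero
    have h3 : F ⟨((0 : H10Vec Ω) : H1Vec Ω),
      H10Vec_le_testSpace hΩ.isOpen Γ₁ Γ₂ (0 : H10Vec Ω).2⟩ = 0 := hF _ h2
    rwa [h2, h3, zero_add, zero_add, one_smul, one_mul] at h1
  · have h1 := hg (⟨ψ, hψ⟩, 0)
    rw [hTa, hGa, zero_smul, add_zero, zero_mul, add_zero] at h1
    rw [hp]
    exact h1

/-- An element of `L²` orthogonal to the divergences of `H10Vec` and to the constants vanishes. -/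
theorem eq_zero_of_inner_divergence_eq_zero {Ω : Set (E d)} (hΩ : IsBoundedSmoothDomain Ω)
    [IsFiniteMeasure (vol Ω)] {r : L2 Ω} (h1 : ⟪r, oneL2 Ω⟫ = 0)
    (h : ∀ ψ ∈ H10Vec Ω, ⟪r, divergence ψ⟫ = 0) : r = 0 := by
  obtain ⟨ψ, hψ, c, hr⟩ := exists_divergence_add_eq hΩ r
  rw [← inner_self_eq_zero (𝕜 := ℝ)]
  nth_rewrite 2 [← hr]
  rw [inner_add_right, h ψ hψ, real_inner_smul_right, h1, mul_zero, add_zero]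

end StokesPressure

end

/-! ### The main theorem -/

theorem mainTheorem4 (d : ℕ) (hd : d = 2 ∨ d = 3) (Ω Γ₁ Γ₂ Γ₃ : Set (E d))
    (hΩ : IsBoundedSmoothDomain Ω)
    (hΓ₁ : IsClosed Γ₁) (hΓ₂ : IsClosed Γ₂) (hΓ₃ : IsClosed Γ₃)
    (h₁₂ : Disjoint Γ₁ Γ₂) (h₁₃ : Disjoint Γ₁ Γ₃) (h₂₃ : Disjoint Γ₂ Γ₃)
    (hΓ : frontier Ω = Γ₁ ∪ Γ₂ ∪ Γ₃)
    (F : testSpace Ω Γ₁ Γ₂ →L[ℝ] ℝ)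
    (hF : ∀ ψ ∈ solenoidal Ω Γ₁ Γ₂, F ψ = 0) :
    ∃! p : L2 Ω, (Γ₃ = ∅ → ∫ x in Ω, p x = 0) ∧
      ∀ ψ : testSpace Ω Γ₁ Γ₂, F ψ = -∫ x in Ω, p x * divergence (ψ : H1Vec Ω) x := by
  have := hΩ.isFiniteMeasure_vol
  simp only [← inner_L2_eq_integral, ← inner_oneL2]
  have hle := H10Vec_le_testSpace hΩ.isOpen Γ₁ Γ₂
  -- `F` depends only on the divergence, so it may be evaluated on a convenient field with the same
  -- divergence.
  have hsub : ∀ ψ χ : testSpace Ω Γ₁ Γ₂,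
      divergence (ψ : H1Vec Ω) = divergence (χ : H1Vec Ω) → F ψ = F χ := fun ψ χ h => by
    rw [← sub_eq_zero, ← map_sub]
    exact hF _ ((divergence_sub _ _).trans (sub_eq_zero.2 h))
  rcases Γ₃.eq_empty_or_nonempty with h₃ | ⟨x₀, hx₀⟩
  -- Without a free boundary part the normal trace vanishes on the whole frontier, so every test
  -- field already has the divergence of an `H₀¹` field. The pressure is taken with mean zero.
  · have hflux : ∀ ψ : testSpace Ω Γ₁ Γ₂, ⟪divergence (ψ : H1Vec Ω), oneL2 Ω⟫ = 0 := by
      rintro ⟨ψ, g, hg, hg₁, hg₂⟩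
      rw [inner_oneL2]
      refine integral_divergence_eq_zero hΩ hg ?_
      filter_upwards [hg₁, hg₂, ae_restrict_mem isClosed_frontier.measurableSet] with x h1 h2 hx
      rw [hΓ, h₃, Set.union_empty] at hx
      rcases hx with hx | hx
      · rw [h1 hx, inner_zero_right]
      · exact h2 hx
    obtain ⟨p, hp1, hp⟩ := exists_inner_divergence_eq hΩ F hF 0
    refine ⟨-p, ⟨fun _ => by rw [inner_neg_left, hp1, neg_zero], fun ψ => ?_⟩, ?_⟩
    · obtain ⟨χ, hχ, c, h⟩ := exists_divergence_add_eq hΩ (divergence (ψ : H1Vec Ω))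
      have h1 := hflux ψ
      rw [← h, inner_add_left, inner_divergence_oneL2_of_mem_H10Vec hΩ hχ, zero_add,
        real_inner_smul_left] at h1
      rw [(mul_eq_zero.1 h1).resolve_right hΩ.inner_oneL2_ne_zero, zero_smul, add_zero] at h
      rw [inner_neg_left, neg_neg, ← h, hp χ hχ]
      exact hsub _ _ h.symm
    · rintro q ⟨hq1, hq⟩
      rw [eq_neg_iff_add_eq_zero]
      refine eq_zero_of_inner_divergence_eq_zero hΩ ?_ fun ψ hψ => ?_
      · rw [inner_add_left, hq1 h₃, hp1, add_zero]
      · have h1 := hq ⟨ψ, hle hψ⟩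
        rw [inner_add_left, hp ψ hψ, h1, add_neg_cancel]
  · have hxf : x₀ ∈ frontier Ω := hΓ ▸ Or.inr hx₀
    obtain ⟨ψ₁, hψ₁, hI⟩ := exists_mem_testSpace_integral_ne_zero hΩ hΓ₁ hΓ₂ hxf
      (fun h => Set.disjoint_left.1 h₁₃ h hx₀) fun h => Set.disjoint_left.1 h₂₃ h hx₀
    rw [← inner_oneL2] at hI
    obtain ⟨χ₁, hχ₁, c₁, h₁⟩ := exists_divergence_add_eq hΩ (divergence ψ₁)
    have hc₁ : c₁ ≠ 0 := by
      rintro rfl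
      rw [← h₁, zero_smul, add_zero] at hI
      exact hI (inner_divergence_oneL2_of_mem_H10Vec hΩ hχ₁)
    -- Removing the `H₀¹` part of the field with nonzero flux and rescaling gives a test field of
    -- divergence one. The representation applied to `η` forces the mean of the pressure, up to
    -- sign, to be `F η`; this choice gives existence and also uniqueness.
    set η : testSpace Ω Γ₁ Γ₂ := c₁⁻¹ • (⟨ψ₁, hψ₁⟩ - ⟨χ₁, hle hχ₁⟩) with hη
    have hηdiv : divergence (η : H1Vec Ω) = oneL2 Ω := by
      refine (divergence_smul _ _).trans ?_
      refine (congrArg (c₁⁻¹ • ·) ((divergence_sub ψ₁ χ₁).trans (sub_eq_iff_eq_add'.2 h₁.symm))).trans ?_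
      exact inv_smul_smul₀ hc₁ _
    obtain ⟨p, hp1, hp⟩ := exists_inner_divergence_eq hΩ F hF (F η)
    refine ⟨-p, ⟨fun h => absurd hx₀ (by simp [h]), fun ψ => ?_⟩, ?_⟩
    · obtain ⟨χ, hχ, c, h⟩ := exists_divergence_add_eq hΩ (divergence (ψ : H1Vec Ω))
      rw [inner_neg_left, neg_neg, ← h, inner_add_right, hp χ hχ, real_inner_smul_right, hp1,
        ← smul_eq_mul, ← map_smul, ← map_add]
      -- The field `χ + c • η` has the same divergence as `ψ`.
      refine hsub _ _ (h.symm.trans ?_)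
      rw [← hηdiv, ← divergence_smul, ← divergence_add]
      rfl
    · rintro q ⟨-, hq⟩
      rw [eq_neg_iff_add_eq_zero]
      refine eq_zero_of_inner_divergence_eq_zero hΩ ?_ fun ψ hψ => ?_
      · have h1 := hq η
        rw [hηdiv] at h1
        rw [inner_add_left, hp1, h1, add_neg_cancel]
      · have h1 := hq ⟨ψ, hle hψ⟩
        rw [inner_add_left, hp ψ hψ, h1, add_neg_cancel]
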